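/- **Setting.** The cake is $C=[0,1]$. A *portion* is a union of finitely many intervals contained in $C$. Each player $p_i$ ($1\le i\le n$) has a valuation $v_i$, assigning to portions real numbers in $[0,1]$, such that $v_i(C)=1$; $v_i(S)>0$ if $S$ contains a nondegenerate interval; $v_i(S\cup T)=v_i(S)+v_i(T)$ for disjoint $S,T$; and for every portion $S$ and $\alpha\in[0,1]$ some portion $T\subseteq S$ has $v_i(T)=\alpha v_i(S)$. A *division* is a partition of $C$ into nonempty portions $C_1,\dots,C_n$, where $C_i$ goes to $p_i$; it is *proportional* if $v_i(C_i)\ge 1/n$ for all $i$. A protocol is *proportional* if, whatever the valuations, it yields a division and every division it can yield (all players following its rules and strategies, all choices it leaves open being arbitrary) is proportional. The *degree of guaranteed envy-freeness* (DGEF) of a proportional protocol for $n$ players is the largest $d$ such that, for all valuations, every division it can yield has at least $d$ ordered pairs $(i,j)$, $i\ne j$, with $v_i(C_i)\ge v_i(C_j)$. **Theorem.** For every $n\ge 3$, each of the following protocols is proportional and has the stated DGEF (with $\log=\log_2$). 1. *Last Diminisher:* $2+\frac{n(n-1)}2$. 2. *Lone Chooser:* $n$. 3. *Lone Divider:* $2n-2$.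 4. *Cut Your Own Piece:* $n$ with no strategy and $2n-2$ with the left-right strategy, which is indeed a strategy. Cut Your Own Piece with an arbitrary strategy is proportional and has a DGEF of at most $2n-2$. 5. *Divide and Conquer* and *Minimal-Envy Divide and Conquer*, each: $n\lfloor\log n\rfloor+2n-2^{\lfloor\log n\rfloor+1}$. 6. *Recursive Divide and Choose:* $n$. **The protocols.** *Cut-and-choose* on a portion $R$: one player cuts $R$ into two portions of equal value to that player, the other takes one of at least the value of the other one, and the cutter gets the remaining one. *Last Diminisher.* While more than two players are left, the first of them (in the order $p_1,\dots,p_n$) cuts from the remaining cake a portion of value $1/n$ to that player. It is passed along the other remaining players in order; a player who values it above $1/n$ trims it to a part of value exactly $1/n$, the others pass it on unchanged. The last player to trim it (or the cutter, if nobody did) gets it and leaves; trimmings rejoin the remaining cake. The last two players apply cut-and-choose to what remains. *Lone Chooser.* First $p_1$ and $p_2$ apply cut-and-choose to $C$. In round $m=2,\dots,n-1$, each of $p_1,\dots,p_m$ cuts his or her current portion into $m+1$ portions, each worth to that player at least $\frac1{m(m+1)}$; then $p_{m+1}$ takes from each of them one of these portions of greatest value to $p_{m+1}$. *Lone Divider.*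 In a round with a set $N$ of $s$ players and remaining cake $R$, one player of $N$ (the divider) cuts $R$ into $s$ portions of equal value to that player; a chooser (any other player of $N$) accepts those worth to him or her at least $1/s$ of $R$. A set $L\subseteq N$ containing the divider can be served if its players can be given distinct portions such that every chooser in $L$ gets an accepted one and no player of $N\setminus L$ accepts any of the portions given. An inclusion-maximal such $L$ is served in this way (everybody, if possible) and leaves; the players in $N\setminus L$ start a new round with the rest of $R$. *Cut Your Own Piece.* Each player marks $n$ adjacent intervals covering $C$, each of value $1/n$ to that player; their $n-1$ interior end points are the player's marks. The cake is cut at between $n-1$ and $2(n-1)$ (distinct) points that are marks, and the resulting adjacent pieces are distributed so that every player's portion contains (up to end points) at least one of the intervals he or she marked. With no strategy, every such division may result. A strategy is a rule that assigns to the marks a nonempty set of divisions of this kind, any of which may result. The left-right strategy: a player $l$ with the leftmost first mark gets the interval from $0$ to this mark; among the other players, a player $r$ with the rightmost last mark gets the interval from that mark to $1$; exactly $n-1$ cuts are made, and the other players get pieces of the rest in any way permitted by the above rules. *Divide and Conquer.* A set of $s\ge2$ players shares an interval $R$ (initially all players share $C$). Put $k=\lfloor s/2\rfloor$. All players but one,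 the noncutter, cut $R$ in two in the ratio $k:(s-k)$ by their own values, left to right. $R$ is split at the $k$-th cut from the left (ties being ordered arbitrarily). The noncutter identifies the left part as worth at least $k/s$ of $R$, or the right part as worth at least $(s-k)/s$ of $R$. In the first case the noncutter and the makers of the first $k-1$ cuts share the left part and all others the right part; in the second case the makers of the first $k$ cuts share the left part and all others, including the noncutter, the right part. Each part is shared in the same way; a single player gets all of the interval. *Minimal-Envy Divide and Conquer.* The same, but all $s$ players cut $R$ in the ratio $k:(s-k)$, and $R$ is split at an arbitrary point strictly between the $k$-th and the $(k+1)$-st cut (at their common position if they coincide); the makers of the first $k$ cuts share the left part, the others the right part. *Recursive Divide and Choose.* A portion $R$ is shared by $m$ participants (initially $C$ by the $n$ players). If $m=2$, they apply cut-and-choose. If $m\ge3$, some participant, the divider, cuts $R$ into $m$ portions of equal value to that participant, and each other participant marks $m-1$ of them of greatest value to him or her, ties being broken arbitrarily. A portion marked by nobody goes to the divider. Every other portion is shared, in the same way, by $m-1$ participants: those who marked it and as many clones of the divider as are needed to make up $m-1$. Every participant collects what he or she and his or her clones receive. -/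

import Mathlib

namespace CakeCutting

/-! ### Cake, portions, valuations, divisions -/

/-- The cake is the unit interval. -/
def cake : Set ℝ := Set.Icc 0 1

/-- A portion is a union of finitely many intervals (pieces) of the cake. -/
def IsPortion (S : Set ℝ) : Prop :=
  S ⊆ cake ∧ ∃ F : Set (Set ℝ), F.Finite ∧ (∀ I ∈ F, I.OrdConnected) ∧ S = ⋃₀ F

/-- A valuation function. Only its values on portions matter. Positivity is required of the
portions that contain a nondegenerate interval (divisibility forces single points to have
value `0`). -/
structure Valuation where
  val : Set ℝ → ℝ
  mem_unit : ∀ S, IsPortion S → 0 ≤ val S ∧ val S ≤ 1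
  normalized : val cake = 1
  positive : ∀ S, IsPortion S → (interior S).Nonempty → 0 < val S
  additive : ∀ S T, IsPortion S → IsPortion T → Disjoint S T → val (S ∪ T) = val S + val T
  divisible : ∀ S, IsPortion S → ∀ α : ℝ, 0 ≤ α → α ≤ 1 →
    ∃ T, T ⊆ S ∧ IsPortion T ∧ val T = α * val S

instance : CoeFun Valuation (fun _ => Set ℝ → ℝ) := ⟨Valuation.val⟩

/-- `Q` cuts `R` into the pairwise disjoint portions `Q 0, …, Q (k-1)`. -/
def IsPartition {k : ℕ} (R : Set ℝ) (Q : Fin k → Set ℝ) : Prop :=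
  (∀ j, IsPortion (Q j)) ∧ (∀ i j, i ≠ j → Disjoint (Q i) (Q j)) ∧ (⋃ j, Q j) = R

/-- A division of the cake: player `i` receives the nonempty portion `A i`. -/
def IsDivision {n : ℕ} (A : Fin n → Set ℝ) : Prop :=
  IsPartition cake A ∧ ∀ i, (A i).Nonempty

/-- A protocol for `n` players, given by the set of all allocations that can be obtained when
the players have valuations `V` and all follow the rules and strategies of the protocol. -/
abbrev Protocol (n : ℕ) := (Fin n → Valuation) → Set (Fin n → Set ℝ)

/-- Whatever the valuations, the protocol yields a division, and every allocation that it can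
yield is a division in which each player values the own portion at `1/n` or more. -/
def IsProportional {n : ℕ} (P : Protocol n) : Prop :=
  ∀ V : Fin n → Valuation, (P V).Nonempty ∧
    ∀ A ∈ P V, IsDivision A ∧ ∀ i, 1 / (n : ℝ) ≤ V i (A i)

/-- The number of envy-free-relations: ordered pairs `(i, j)` of distinct players such that
`i` does not envy `j`. -/
noncomputable def envyFreeCount {n : ℕ} (V : Fin n → Valuation) (A : Fin n → Set ℝ) : ℕ :=
  Set.ncard {p : Fin n × Fin n | p.1 ≠ p.2 ∧ V p.1 (A p.2) ≤ V p.1 (A p.1)}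

/-- `P` is a proportional protocol whose degree of guaranteed envy-freeness is `d`, the maximum
number of envy-free-relations that exist in every division obtained by `P`. -/
def HasDGEF {n : ℕ} (P : Protocol n) (d : ℕ) : Prop :=
  IsProportional P ∧
    IsGreatest {k : ℕ | ∀ (V : Fin n → Valuation), ∀ A ∈ P V, k ≤ envyFreeCount V A} d

/-- Cut-and-choose on `R`: the player with valuation `a` cuts `R` into two portions of equal
value, the player with valuation `b` takes a preferred one, namely `Y`, and `X` is left. -/
def CutAndChoose (a b : Valuation) (R X Y : Set ℝ) : Prop :=
  IsPortion X ∧ IsPortion Y ∧ Disjoint X Y ∧ X ∪ Y = R ∧ a X = a Y ∧ b X ≤ b Y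

/-! ### Last Diminisher -/

/-- The piece `P`, currently claimed by `h`, is passed along a list of players. A player who
values it at more than `q` trims it to a part of value exactly `q` and becomes the new claimant;
the others pass it on as it is. The last two arguments are the final piece and claimant. -/
def TrimPass {n : ℕ} (V : Fin n → Valuation) (q : ℝ) :
    List (Fin n) → Set ℝ → Fin n → Set ℝ → Fin n → Prop
  | [], P, h, P', h' => P' = P ∧ h' = h
  | p :: ps, P, h, P', h' =>
      (V p P ≤ q ∧ TrimPass V q ps P h P' h') ∨
      (q < V p P ∧ ∃ T, T ⊆ P ∧ IsPortion T ∧ V p T = q ∧ TrimPass V q ps T p P' h')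

/-- Runs of Last Diminisher: the listed players share `R`, player `i` receiving `A i`. While more
than two players are left, the first one cuts a piece of value `1/n` (as a part of the whole
cake) and passes it along; the last player who trimmed it, or else the one who cut it, gets the
piece and leaves. The last two players cut and choose. -/
inductive LastDiminisherRun {n : ℕ} (V : Fin n → Valuation) :
    List (Fin n) → Set ℝ → (Fin n → Set ℝ) → Prop
  | final (a b : Fin n) (R : Set ℝ) (A : Fin n → Set ℝ) :
      CutAndChoose (V a) (V b) R (A a) (A b) → LastDiminisherRun V [a, b] R A
  | round (p : Fin n) (ps : List (Fin n)) (R P : Set ℝ) (w : Fin n) (A : Fin n → Set ℝ) :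
      2 ≤ ps.length → P ⊆ R → IsPortion P → V p P = 1 / (n : ℝ) →
      TrimPass V (1 / (n : ℝ)) ps P p (A w) w →
      LastDiminisherRun V ((p :: ps).erase w) (R \ A w) A →
      LastDiminisherRun V (p :: ps) R A

def lastDiminisher (n : ℕ) : Protocol n :=
  fun V => {A | LastDiminisherRun V (List.finRange n) cake A}

/-! ### Lone Chooser -/

/-- `LoneChooserRun V m A`: after round `m - 1` the cake is shared by the first `m` players,
player `i` holding `A i`. The first round is cut-and-choose. In round `m` each of the first `m`
players (the cutters) cuts the own portion into `m + 1` pieces, each worth at least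
`1 / (m (m + 1))` to that cutter, and the next player `c` (the chooser) takes from every cutter a
piece of highest value to `c`. -/
inductive LoneChooserRun {n : ℕ} (V : Fin n → Valuation) : ℕ → (Fin n → Set ℝ) → Prop
  | start (p q : Fin n) (A : Fin n → Set ℝ) :
      p.val = 0 → q.val = 1 → CutAndChoose (V p) (V q) cake (A p) (A q) →
      LoneChooserRun V 2 A
  | round (m : ℕ) (c : Fin n) (A A' : Fin n → Set ℝ)
      (piece : Fin n → Fin (m + 1) → Set ℝ) (pick : Fin n → Fin (m + 1)) :
      LoneChooserRun V m A → c.val = m →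
      (∀ i < c, IsPartition (A i) (piece i) ∧
        ∀ j, 1 / ((m : ℝ) * ((m : ℝ) + 1)) ≤ V i (piece i j)) →
      (∀ i < c, ∀ j, V c (piece i j) ≤ V c (piece i (pick i))) →
      (∀ i < c, A' i = A i \ piece i (pick i)) →
      A' c = (⋃ i, ⋃ (_ : i < c), piece i (pick i)) →
      LoneChooserRun V (m + 1) A'

def loneChooser (n : ℕ) : Protocol n :=
  fun V => {A | LoneChooserRun V n A}

/-! ### Lone Divider -/

/-- In a round in which the players in `N` share `R`, cut into the portions `Q j`, player `i`
accepts `Q j` if it is worth to `i` at least a proportional part of `R`. -/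
def Accepts {n : ℕ} (V : Fin n → Valuation) (N : Finset (Fin n)) (R : Set ℝ)
    (Q : Fin N.card → Set ℝ) (i : Fin n) (j : Fin N.card) : Prop :=
  V i R / (N.card : ℝ) ≤ V i (Q j)

/-- The players in `L`, among them the divider `d`, can be served without conflict by giving
distinct portions `Q (σ i)` to the `i ∈ L`: the choosers in `L` accept what they get, and no
player outside `L` accepts any portion given to a player in `L`. -/
def Servable {n : ℕ} (V : Fin n → Valuation) (N : Finset (Fin n)) (R : Set ℝ)
    (Q : Fin N.card → Set ℝ) (d : Fin n) (L : Finset (Fin n)) (σ : Fin n → Fin N.card) : Prop :=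
  d ∈ L ∧ L ⊆ N ∧ Set.InjOn σ (L : Set (Fin n)) ∧
    (∀ i ∈ L, i ≠ d → Accepts V N R Q i (σ i)) ∧
    (∀ i ∈ N \ L, ∀ l ∈ L, ¬ Accepts V N R Q i (σ l))

/-- Runs of Lone Divider: the players in `N` share `R`. The divider `d` cuts `R` into as many
portions of equal value as there are players; a maximal set `L` of players is served without
conflict and leaves; the others share what remains. If `L = N` the round is fully decidable (and
by maximality `L = N` whenever this is possible), if `L = {d}` it is fully undecidable, and
otherwise it is partially decidable. -/
inductive LoneDividerRun {n : ℕ} (V : Fin n → Valuation) :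
    Finset (Fin n) → Set ℝ → (Fin n → Set ℝ) → Prop
  | done (R : Set ℝ) (A : Fin n → Set ℝ) : LoneDividerRun V ∅ R A
  | round (N : Finset (Fin n)) (R : Set ℝ) (A : Fin n → Set ℝ) (d : Fin n)
      (Q : Fin N.card → Set ℝ) (L : Finset (Fin n)) (σ : Fin n → Fin N.card) :
      IsPartition R Q → (∀ j, V d (Q j) = V d R / (N.card : ℝ)) →
      Servable V N R Q d L σ →
      (∀ L' σ', Servable V N R Q d L' σ' → L ⊆ L' → L' = L) →
      (∀ i ∈ L, A i = Q (σ i)) →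
      LoneDividerRun V (N \ L) (R \ ⋃ i ∈ L, A i) A →
      LoneDividerRun V N R A

def loneDivider (n : ℕ) : Protocol n :=
  fun V => {A | LoneDividerRun V Finset.univ cake A}

/-! ### Cut Your Own Piece -/

/-- `m i j` is the right end of the `j`-th piece marked by player `i`; `m i 0` and `m i n` are the
ends of the cake, and the others are the `n - 1` marks of player `i`. -/
abbrev Marks (n : ℕ) := Fin n → Fin (n + 1) → ℝ

/-- Every player marks `n` adjacent pieces of value `1/n` each. -/
def IsMarking {n : ℕ} (V : Fin n → Valuation) (m : Marks n) : Prop :=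
  ∀ i, m i 0 = 0 ∧ m i (Fin.last n) = 1 ∧ Monotone (m i) ∧
    ∀ j : Fin n, V i (Set.Icc (m i j.castSucc) (m i j.succ)) = 1 / (n : ℝ)

/-- The cake is cut at the points of `S`, all of them marks, and the division `A` is made up of
the resulting adjacent pieces (a cut point belongs to the piece on its left) in such a way that
every portion contains, up to end points, one of the pieces marked by its owner. -/
def IsCutAllocation {n : ℕ} (m : Marks n) (S : Finset ℝ) (A : Fin n → Set ℝ) : Prop :=
  (∀ s ∈ S, ∃ (i : Fin n) (j : Fin (n + 1)), j ≠ 0 ∧ j ≠ Fin.last n ∧ s = m i j) ∧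
  IsDivision A ∧
  (∀ i, ∀ x ∈ A i, ∀ y ∈ cake, (∀ s ∈ S, x ≤ s ↔ y ≤ s) → y ∈ A i) ∧
  (∀ i, ∃ j : Fin n, Set.Ioo (m i j.castSucc) (m i j.succ) ⊆ A i)

/-- The allocations that the rules of Cut Your Own Piece allow, given the marks. -/
def IsLegal {n : ℕ} (m : Marks n) (A : Fin n → Set ℝ) : Prop :=
  ∃ S : Finset ℝ, n - 1 ≤ S.card ∧ S.card ≤ 2 * (n - 1) ∧ IsCutAllocation m S A

/-- A rule that tells from the marks which allocations may be made. -/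
abbrev CutStrategy (n : ℕ) := Marks n → Set (Fin n → Set ℝ)

/-- For all marks that can arise, a strategy admits an allocation, and only legal ones. -/
def IsStrategy {n : ℕ} (T : CutStrategy n) : Prop :=
  ∀ (V : Fin n → Valuation) (m : Marks n), IsMarking V m →
    (T m).Nonempty ∧ ∀ A ∈ T m, IsLegal m A

/-- Cut Your Own Piece with the strategy `T`. -/
def cutYourOwnPieceWith {n : ℕ} (T : CutStrategy n) : Protocol n :=
  fun V => {A | ∃ m, IsMarking V m ∧ A ∈ T m}

/-- Cut Your Own Piece without a strategy: any legal allocation may result. -/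
def cutYourOwnPiece (n : ℕ) : Protocol n :=
  cutYourOwnPieceWith (fun m => {A | IsLegal m A})

/-- The left-right strategy: the smallest marked piece starting at `0` goes to a player `l` who
marked it, and the smallest piece finishing at `1` among those marked by the other players goes
to a player `r` who marked it; `n - 1` cuts are made, so that all portions are contiguous, and
every other player also gets a portion that contains one of the pieces he or she marked. -/
def leftRight (n : ℕ) : CutStrategy n :=
  fun m => {A | ∃ l r : Fin n, l ≠ r ∧
    (∀ i, m l 1 ≤ m i 1) ∧
    (∀ i, i ≠ l → m i (Fin.rev 1) ≤ m r (Fin.rev 1)) ∧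
    A l = Set.Icc 0 (m l 1) ∧ A r = Set.Ioc (m r (Fin.rev 1)) 1 ∧
    ∃ S : Finset ℝ, S.card = n - 1 ∧ IsCutAllocation m S A}

/-! ### Divide and Conquer -/

/-- Runs of Divide and Conquer: the players in `N` share `R`. With `k = ⌊|N|/2⌋`, all players in
`N` but the noncutter `e` cut `R` in the ratio `k : |N| - k`. The `k`-th cut from the left is
made by `c`; `B` are the `k - 1` cutters before `c`, and `D` are those after `c`. The noncutter
identifies a side of the cut at `cut c` that is worth enough. -/
inductive DivideAndConquerRun {n : ℕ} (V : Fin n → Valuation) :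
    Finset (Fin n) → Set ℝ → (Fin n → Set ℝ) → Prop
  | single (p : Fin n) (R : Set ℝ) (A : Fin n → Set ℝ) :
      A p = R → DivideAndConquerRun V {p} R A
  | left (N : Finset (Fin n)) (R : Set ℝ) (A : Fin n → Set ℝ) (e c : Fin n)
      (B D : Finset (Fin n)) (cut : Fin n → ℝ) :
      2 ≤ N.card → e ∈ N → c ∈ N.erase e →
      Disjoint B D → B ∪ D = (N.erase e).erase c → B.card + 1 = N.card / 2 →
      (∀ i ∈ N.erase e, V i (R ∩ Set.Iic (cut i)) =
        ((N.card / 2 : ℕ) : ℝ) / (N.card : ℝ) * V i R) →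
      (∀ b ∈ B, cut b ≤ cut c) → (∀ b ∈ D, cut c ≤ cut b) →
      ((N.card / 2 : ℕ) : ℝ) / (N.card : ℝ) * V e R ≤ V e (R ∩ Set.Iic (cut c)) →
      DivideAndConquerRun V (insert e B) (R ∩ Set.Iic (cut c)) A →
      DivideAndConquerRun V (insert c D) (R ∩ Set.Ioi (cut c)) A →
      DivideAndConquerRun V N R A
  | right (N : Finset (Fin n)) (R : Set ℝ) (A : Fin n → Set ℝ) (e c : Fin n)
      (B D : Finset (Fin n)) (cut : Fin n → ℝ) :
      2 ≤ N.card → e ∈ N → c ∈ N.erase e →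
      Disjoint B D → B ∪ D = (N.erase e).erase c → B.card + 1 = N.card / 2 →
      (∀ i ∈ N.erase e, V i (R ∩ Set.Iic (cut i)) =
        ((N.card / 2 : ℕ) : ℝ) / (N.card : ℝ) * V i R) →
      (∀ b ∈ B, cut b ≤ cut c) → (∀ b ∈ D, cut c ≤ cut b) →
      ((N.card - N.card / 2 : ℕ) : ℝ) / (N.card : ℝ) * V e R ≤ V e (R ∩ Set.Ioi (cut c)) →
      DivideAndConquerRun V (insert c B) (R ∩ Set.Iic (cut c)) A →
      DivideAndConquerRun V (insert e D) (R ∩ Set.Ioi (cut c)) A →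
      DivideAndConquerRun V N R A

def divideAndConquer (n : ℕ) : Protocol n :=
  fun V => {A | DivideAndConquerRun V Finset.univ cake A}

/-- Runs of Minimal-Envy Divide and Conquer: with `k = ⌊|N|/2⌋`, all players in `N` cut `R` in the
ratio `k : |N| - k`; `c` makes the `k`-th cut from the left, `c'` the next one. `R` is split at a
point `s` strictly between these two cuts (at their common position if they coincide), and the
`k` players with the leftmost cuts go on with the left part, the others with the right part. -/
inductive MinimalEnvyRun {n : ℕ} (V : Fin n → Valuation) :
    Finset (Fin n) → Set ℝ → (Fin n → Set ℝ) → Prop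
  | single (p : Fin n) (R : Set ℝ) (A : Fin n → Set ℝ) :
      A p = R → MinimalEnvyRun V {p} R A
  | split (N : Finset (Fin n)) (R : Set ℝ) (A : Fin n → Set ℝ)
      (B D : Finset (Fin n)) (c c' : Fin n) (cut : Fin n → ℝ) (s : ℝ) :
      2 ≤ N.card → Disjoint B D → B ∪ D = N → B.card = N.card / 2 →
      (∀ i ∈ N, V i (R ∩ Set.Iic (cut i)) =
        ((N.card / 2 : ℕ) : ℝ) / (N.card : ℝ) * V i R) →
      c ∈ B → c' ∈ D →
      (∀ b ∈ B, cut b ≤ cut c) → (∀ b ∈ D, cut c' ≤ cut b) →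
      (cut c < s ∧ s < cut c' ∨ cut c = s ∧ s = cut c') →
      MinimalEnvyRun V B (R ∩ Set.Iic s) A →
      MinimalEnvyRun V D (R ∩ Set.Ioi s) A →
      MinimalEnvyRun V N R A

def minimalEnvyDivideAndConquer (n : ℕ) : Protocol n :=
  fun V => {A | MinimalEnvyRun V Finset.univ cake A}

/-! ### Recursive Divide and Choose -/

/-- Runs of Recursive Divide and Choose: `R` is shared by `m` participants with valuations `w`
(some of them may be clones of one player), participant `s` receiving `B s`.

For `m ≥ 3` a divider `d` cuts `R` into `m` pieces `Q j` of equal value, and every other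
participant `s` marks a set `mark s` of `m - 1` pieces of highest value. Each piece `Q j` has
`m - 1` slots: one for each participant who marked it, and the empty slots are filled by clones
of the divider; `slot j t` is the participant who holds slot `t` of piece `j`. A piece that nobody
marked goes to the divider directly (all its slots are held by `d`); every other piece is shared
by the holders of its slots in the same way. Participants collect what their slots yield. -/
def RecursiveRun : (m : ℕ) → (Fin m → Valuation) → Set ℝ → (Fin m → Set ℝ) → Prop
  | 0, _, _, _ => False
  | 1, _, R, B => B 0 = R
  | 2, w, R, B =>
      CutAndChoose (w 0) (w 1) R (B 0) (B 1) ∨ CutAndChoose (w 1) (w 0) R (B 1) (B 0)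
  | m + 3, w, R, B =>
      ∃ (d : Fin (m + 3)) (Q : Fin (m + 3) → Set ℝ)
        (mark : Fin (m + 3) → Finset (Fin (m + 3)))
        (slot : Fin (m + 3) → Fin (m + 2) → Fin (m + 3))
        (B' : Fin (m + 3) → Fin (m + 2) → Set ℝ),
        IsPartition R Q ∧ (∀ j, w d (Q j) = w d R / ((m + 3 : ℕ) : ℝ)) ∧
        (∀ s, s ≠ d → (mark s).card = m + 2 ∧
          ∀ j ∈ mark s, ∀ j', j' ∉ mark s → w s (Q j') ≤ w s (Q j)) ∧
        (∀ j s, s ≠ d → j ∈ mark s → ∃! t, slot j t = s) ∧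
        (∀ j s, s ≠ d → j ∉ mark s → ∀ t, slot j t ≠ s) ∧
        (∀ j, (∃ s, s ≠ d ∧ j ∈ mark s) →
          RecursiveRun (m + 2) (fun t => w (slot j t)) (Q j) (B' j)) ∧
        (∀ j, (¬ ∃ s, s ≠ d ∧ j ∈ mark s) → (⋃ t, B' j t) = Q j) ∧
        ∀ s, B s = ⋃ j, ⋃ t, ⋃ (_ : slot j t = s), B' j t

def recursiveDivideAndChoose (n : ℕ) : Protocol n :=
  fun V => {A | RecursiveRun n V cake A}

end CakeCutting

/-! An exact degree needs two things: a count showing that every result has that many relations, and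
one choice of valuations with one run that has no more (`HasDGEF.intro`).

Lower bounds rest on averaging (`one_le_card_unenvied`): a player whose own portion is worth at
least the average of some other portions does not envy all of their owners. Applied to the whole
cake, this gives every player of a proportional protocol one relation, hence `n` in all, and Lone
Chooser, Cut Your Own Piece without a strategy and Recursive Divide and Choose guarantee nothing
beyond this. In Last Diminisher nobody who stays envies a player who leaves, which yields a
triangular number; the last pair adds one relation, and so does averaging for the first player to
leave. In Lone Divider the divider is indifferent between the portions given in the first round, and
the unserved reject all of them. With the left-right strategy nobody envies the leftmost player, and
only that player may envy the rightmost one. In the divide-and-conquer protocols averaging over the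
opposite side of a split of `s` players gives `s` relations across it, so the count satisfies `f s =
f ⌊s/2⌋ + f ⌈s/2⌉ + s` (`DCGuarantee.split`, `dcCount_split`).

Upper bounds come from valuations that are uniform on the cells of a grid and have prescribed
weights there (`gridValuation`, `exists_cells`, `exists_valuation_Icc`). In most examples a player's
weights deviate from equality only where this does not disturb the run: with sum zero on either side
of every split (`dcDev`), on blocks that others receive (`exists_envy_example`), inside cells that
stay whole until the last round (`exists_loneChooser_example`), or in a portion in which the player
holds no slot (`exists_recursiveDivideAndChoose_example`). For Cut Your Own Piece the marks
`tightMarks` force each player `i` to receive the `i`-th marked interval (`IsLegal.own_interval`),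
so no strategy has any freedom except with the gaps.

Runs exist because a moving knife takes all intermediate values (`Valuation.exists_cut`). Since
valuations are only finitely additive, its continuity is drawn from divisibility. Lone Divider also
needs Hall's theorem (`exists_conflict_free_matching`). -/

namespace CakeCutting

open Set Filter Topology

/-! ### Portions form a ring of sets -/

/-- Finite unions of intervals. -/
def IsIntervalUnion (S : Set ℝ) : Prop :=
  ∃ F : Set (Set ℝ), F.Finite ∧ (∀ I ∈ F, I.OrdConnected) ∧ S = ⋃₀ F

lemma IsIntervalUnion.of_ordConnected {S : Set ℝ} (h : S.OrdConnected) : IsIntervalUnion S :=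
  ⟨{S}, finite_singleton _, by simpa using h, by simp⟩

lemma IsIntervalUnion.union {S T : Set ℝ} (hS : IsIntervalUnion S) (hT : IsIntervalUnion T) :
    IsIntervalUnion (S ∪ T) := by
  obtain ⟨F, hF, hF', rfl⟩ := hS
  obtain ⟨G, hG, hG', rfl⟩ := hT
  refine ⟨F ∪ G, hF.union hG, ?_, by rw [sUnion_union]⟩
  rintro I (h | h)
  exacts [hF' I h, hG' I h]

lemma IsIntervalUnion.inter {S T : Set ℝ} (hS : IsIntervalUnion S) (hT : IsIntervalUnion T) :
    IsIntervalUnion (S ∩ T) := by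
  obtain ⟨F, hF, hF', rfl⟩ := hS
  obtain ⟨G, hG, hG', rfl⟩ := hT
  refine ⟨image2 (· ∩ ·) F G, hF.image2 _ hG, ?_, ?_⟩
  · rintro _ ⟨I, hI, J, hJ, rfl⟩
    exact (hF' I hI).inter (hG' J hJ)
  · ext x
    simp only [mem_inter_iff, mem_sUnion, mem_image2]
    constructor
    · rintro ⟨⟨I, hI, hx⟩, J, hJ, hy⟩
      exact ⟨_, ⟨I, hI, J, hJ, rfl⟩, hx, hy⟩
    · rintro ⟨_, ⟨I, hI, J, hJ, rfl⟩, hx, hy⟩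
      exact ⟨⟨I, hI, hx⟩, J, hJ, hy⟩

/-- The points outside an interval lie below all of it or above all of it, and each of these two
sets is order-connected. This is what makes portions closed under differences. -/
lemma IsIntervalUnion.compl_of_ordConnected {I : Set ℝ} (h : I.OrdConnected) :
    IsIntervalUnion Iᶜ := by
  have : Iᶜ = {x | ∀ y ∈ I, x < y} ∪ {x | ∀ y ∈ I, y < x} := by
    ext x
    simp only [mem_compl_iff, mem_union, mem_ofPred_eq]
    constructor
    · intro hx
      by_contra! hc
      obtain ⟨⟨y, hy, hyx⟩, z, hz, hxz⟩ := hc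
      exact hx (h.out hy hz ⟨hyx, hxz⟩)
    · rintro (h' | h') hx
      exacts [lt_irrefl _ (h' x hx), lt_irrefl _ (h' x hx)]
  rw [this]
  refine (IsIntervalUnion.of_ordConnected ⟨?_⟩).union (IsIntervalUnion.of_ordConnected ⟨?_⟩)
  · exact fun a _ b hb c hc y hy => hc.2.trans_lt (hb y hy)
  · exact fun a ha b _ c hc y hy => (ha y hy).trans_le hc.1

lemma IsIntervalUnion.compl {S : Set ℝ} (hS : IsIntervalUnion S) : IsIntervalUnion Sᶜ := by
  obtain ⟨F, hF, hF', rfl⟩ := hS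
  induction F, hF using Set.Finite.induction_on with
  | empty => simpa using IsIntervalUnion.of_ordConnected ordConnected_univ
  | @insert I F _ _ ih =>
    rw [sUnion_insert, compl_union]
    exact (compl_of_ordConnected (hF' I (mem_insert _ _))).inter
      (ih fun J hJ => hF' J (mem_insert_of_mem _ hJ))

lemma IsIntervalUnion.measurableSet {S : Set ℝ} (hS : IsIntervalUnion S) : MeasurableSet S := by
  obtain ⟨F, hF, hF', rfl⟩ := hS
  exact MeasurableSet.sUnion hF.countable fun I hI => (hF' I hI).measurableSet

lemma IsPortion.isIntervalUnion {S : Set ℝ} (hS : IsPortion S) : IsIntervalUnion S := hS.2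

lemma IsPortion.measurableSet {S : Set ℝ} (hS : IsPortion S) : MeasurableSet S :=
  hS.isIntervalUnion.measurableSet

lemma IsPortion.of_ordConnected {S : Set ℝ} (h : S.OrdConnected) (hS : S ⊆ cake) : IsPortion S :=
  ⟨hS, IsIntervalUnion.of_ordConnected h⟩

lemma isPortion_empty : IsPortion ∅ := .of_ordConnected ordConnected_empty (empty_subset _)

lemma isPortion_cake : IsPortion cake := .of_ordConnected ordConnected_Icc Subset.rfl

lemma IsPortion.union {S T : Set ℝ} (hS : IsPortion S) (hT : IsPortion T) : IsPortion (S ∪ T) :=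
  ⟨union_subset hS.1 hT.1, hS.isIntervalUnion.union hT.isIntervalUnion⟩

lemma IsPortion.inter_ordConnected {S T : Set ℝ} (hS : IsPortion S) (hT : T.OrdConnected) :
    IsPortion (S ∩ T) :=
  ⟨inter_subset_left.trans hS.1, hS.isIntervalUnion.inter (.of_ordConnected hT)⟩

lemma IsPortion.diff {S T : Set ℝ} (hS : IsPortion S) (hT : IsPortion T) : IsPortion (S \ T) :=
  ⟨sdiff_subset.trans hS.1, hS.isIntervalUnion.inter hT.isIntervalUnion.compl⟩

lemma IsPortion.biUnion {ι : Type*} {s : Finset ι} {P : ι → Set ℝ}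
    (h : ∀ i ∈ s, IsPortion (P i)) : IsPortion (⋃ i ∈ s, P i) := by
  classical
  induction s using Finset.induction_on with
  | empty => simpa using isPortion_empty
  | insert a s _ ih =>
    rw [Finset.set_biUnion_insert]
    exact (h a (Finset.mem_insert_self _ _)).union
      (ih fun i hi => h i (Finset.mem_insert_of_mem hi))

lemma IsPortion.iUnion {ι : Type*} [Fintype ι] {P : ι → Set ℝ}
    (h : ∀ i, IsPortion (P i)) : IsPortion (⋃ i, P i) := by
  simpa using IsPortion.biUnion (s := Finset.univ) fun i _ => h i

/-! ### Valuations -/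

namespace Valuation

variable (v : Valuation)

lemma empty : v ∅ = 0 := by
  have := v.additive ∅ ∅ isPortion_empty isPortion_empty (disjoint_empty _)
  simp only [union_empty] at this
  linarith

lemma nonneg {S : Set ℝ} (hS : IsPortion S) : 0 ≤ v S := (v.mem_unit S hS).1

lemma diff_add {S T : Set ℝ} (hS : IsPortion S) (hT : IsPortion T) (h : S ⊆ T) :
    v (T \ S) + v S = v T := by
  rw [← v.additive _ _ (hT.diff hS) hS disjoint_sdiff_left, sdiff_union_of_subset h]

lemma mono {S T : Set ℝ} (hS : IsPortion S) (hT : IsPortion T) (h : S ⊆ T) : v S ≤ v T := by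
  have := v.diff_add hS hT h
  have := v.nonneg (hT.diff hS)
  linarith

lemma union_le {S T : Set ℝ} (hS : IsPortion S) (hT : IsPortion T) : v (S ∪ T) ≤ v S + v T := by
  have := v.additive S (T \ S) hS (hT.diff hS) disjoint_sdiff_right
  rw [union_sdiff_self] at this
  rw [this]
  gcongr
  exact v.mono (hT.diff hS) hT sdiff_subset

lemma biUnion {ι : Type*} {s : Finset ι} {P : ι → Set ℝ} (h : ∀ i ∈ s, IsPortion (P i))
    (hd : (s : Set ι).PairwiseDisjoint P) : v (⋃ i ∈ s, P i) = ∑ i ∈ s, v (P i) := by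
  classical
  induction s using Finset.induction_on with
  | empty => simpa using v.empty
  | insert a s ha ih =>
    have h' : ∀ i ∈ s, IsPortion (P i) := fun i hi => h i (Finset.mem_insert_of_mem hi)
    rw [Finset.set_biUnion_insert, Finset.sum_insert ha, v.additive, ih h']
    · exact hd.subset (by simp)
    · exact h a (Finset.mem_insert_self _ _)
    · exact .biUnion h'
    · simp only [disjoint_iUnion_right]
      intro i hi
      exact hd (by simp) (by simp [hi]) (by rintro rfl; exact ha hi)

lemma iUnion {ι : Type*} [Fintype ι] {P : ι → Set ℝ} (h : ∀ i, IsPortion (P i))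
    (hd : Pairwise fun i j => Disjoint (P i) (P j)) : v (⋃ i, P i) = ∑ i, v (P i) := by
  simpa using v.biUnion (s := Finset.univ) (fun i _ => h i) fun i _ j _ hij => hd hij

lemma partition {k : ℕ} {R : Set ℝ} {Q : Fin k → Set ℝ} (h : IsPartition R Q) :
    ∑ j, v (Q j) = v R := by
  rw [← v.iUnion h.1 fun i j hij => h.2.1 i j hij, h.2.2]

lemma nonempty_of_pos {S : Set ℝ} (h : 0 < v S) : S.Nonempty := by
  rcases S.eq_empty_or_nonempty with rfl | h'
  · rw [v.empty] at h
    exact absurd h (lt_irrefl _)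
  · exact h'

/-- A part of a point is the point or empty, so halving by `divisible` forces the value `0`. -/
lemma singleton {x : ℝ} (hx : x ∈ cake) : v {x} = 0 := by
  have hp : IsPortion {x} := .of_ordConnected ordConnected_singleton (by simpa using hx)
  obtain ⟨T, hT, -, hv⟩ := v.divisible _ hp (1 / 2) (by norm_num) (by norm_num)
  rcases subset_singleton_iff_eq.1 hT with rfl | rfl
  · rw [v.empty] at hv
    linarith
  · linarith

/-- The two portions differ at most by `x`, which has no value. This allows passing between open,
half-open and closed intervals. -/
lemma congr_singleton {S T : Set ℝ} {x : ℝ} (hS : IsPortion S) (hT : IsPortion T) (hST : S ⊆ T)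
    (hTS : T ⊆ insert x S) : v S = v T := by
  refine le_antisymm (v.mono hS hT hST) ?_
  by_cases hx : x ∈ T
  · have hx' := hT.1 hx
    have hp : IsPortion {x} := .of_ordConnected ordConnected_singleton (by simpa using hx')
    have h1 := v.mono hT (hp.union hS) (by simpa using hTS)
    have h2 := v.union_le hp hS
    rw [v.singleton hx'] at h2
    linarith
  · refine v.mono hT hS fun y hy => ?_
    rcases hTS hy with rfl | h
    exacts [absurd hy hx, h]

end Valuation

lemma isPortion_Icc {a b : ℝ} (ha : 0 ≤ a) (hb : b ≤ 1) : IsPortion (Icc a b) :=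
  .of_ordConnected ordConnected_Icc (Icc_subset_Icc ha hb)

lemma isPortion_Ioc {a b : ℝ} (ha : 0 ≤ a) (hb : b ≤ 1) : IsPortion (Ioc a b) :=
  .of_ordConnected ordConnected_Ioc (Ioc_subset_Icc_self.trans (Icc_subset_Icc ha hb))

lemma isPortion_Ioo {a b : ℝ} (ha : 0 ≤ a) (hb : b ≤ 1) : IsPortion (Ioo a b) :=
  .of_ordConnected ordConnected_Ioo (Ioo_subset_Icc_self.trans (Icc_subset_Icc ha hb))

lemma Valuation.Ioc_eq_Icc (v : Valuation) {a b : ℝ} (ha : 0 ≤ a) (hb : b ≤ 1) :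
    v (Ioc a b) = v (Icc a b) := by
  refine v.congr_singleton (x := a) (isPortion_Ioc ha hb) (isPortion_Icc ha hb)
    Ioc_subset_Icc_self fun y hy => ?_
  rcases hy.1.eq_or_lt with h | h
  exacts [Or.inl h.symm, Or.inr ⟨h, hy.2⟩]

lemma Valuation.Ioo_eq_Icc (v : Valuation) {a b : ℝ} (ha : 0 ≤ a) (hb : b ≤ 1) :
    v (Ioo a b) = v (Icc a b) := by
  rw [← v.Ioc_eq_Icc ha hb]
  refine v.congr_singleton (x := b) (isPortion_Ioo ha hb) (isPortion_Ioc ha hb)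
    Ioo_subset_Ioc_self fun y hy => ?_
  rcases hy.2.eq_or_lt with h | h
  exacts [Or.inl h, Or.inr ⟨hy.1, h⟩]

/-! ### Cutting with a knife -/

/-- A filter that decides every interval decides every finite union of intervals. -/
lemma IsIntervalUnion.mem_or_compl_mem {l : Filter ℝ}
    (hl : ∀ J : Set ℝ, J.OrdConnected → J ∈ l ∨ Jᶜ ∈ l) {S : Set ℝ} (hS : IsIntervalUnion S) :
    S ∈ l ∨ Sᶜ ∈ l := by
  obtain ⟨F, hF, hF', rfl⟩ := hS
  by_cases h : ∃ I ∈ F, I ∈ l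
  · obtain ⟨I, hI, hIl⟩ := h
    exact Or.inl (mem_of_superset hIl (subset_sUnion_of_mem hI))
  · push Not at h
    right
    rw [compl_sUnion, sInter_image]
    exact (biInter_mem hF).2 fun I hI => (hl I (hF' I hI)).resolve_left (h I hI)

/-- An interval that accumulates at `x` from the right contains a right neighbourhood of `x`, by
order-connectedness; otherwise it misses one. So on interval unions the one-sided neighbourhood
filter behaves like an ultrafilter. -/
lemma ordConnected_mem_nhdsGT_or {J : Set ℝ} (hJ : J.OrdConnected) (x : ℝ) :
    J ∈ 𝓝[>] x ∨ Jᶜ ∈ 𝓝[>] x := by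
  by_cases h : ∃ y ∈ J, x < y ∧ ∀ z, x < z → ∃ u ∈ J, x < u ∧ u < z
  · obtain ⟨y, hy, hxy, hz⟩ := h
    left
    filter_upwards [Ioo_mem_nhdsGT hxy] with z hz'
    obtain ⟨u, hu, -, huz⟩ := hz z hz'.1
    exact hJ.out hu hy ⟨huz.le, hz'.2.le⟩
  · right
    push Not at h
    by_cases h' : ∃ y ∈ J, x < y
    · obtain ⟨y, hy, hxy⟩ := h'
      obtain ⟨z, hxz, hz⟩ := h y hy hxy
      filter_upwards [Ioo_mem_nhdsGT hxz] with u hu hu'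
      exact absurd (hz u hu' hu.1) (not_le.2 hu.2)
    · push Not at h'
      filter_upwards [self_mem_nhdsWithin] with u hu hu'
      exact absurd (h' u hu') (not_le.2 hu)

lemma ordConnected_mem_nhdsLT_or {J : Set ℝ} (hJ : J.OrdConnected) (x : ℝ) :
    J ∈ 𝓝[<] x ∨ Jᶜ ∈ 𝓝[<] x := by
  by_cases h : ∃ y ∈ J, y < x ∧ ∀ z, z < x → ∃ u ∈ J, u < x ∧ z < u
  · obtain ⟨y, hy, hxy, hz⟩ := h
    left
    filter_upwards [Ioo_mem_nhdsLT hxy] with z hz'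
    obtain ⟨u, hu, -, huz⟩ := hz z hz'.2
    exact hJ.out hy hu ⟨hz'.1.le, huz.le⟩
  · right
    push Not at h
    by_cases h' : ∃ y ∈ J, y < x
    · obtain ⟨y, hy, hxy⟩ := h'
      obtain ⟨z, hxz, hz⟩ := h y hy hxy
      filter_upwards [Ioo_mem_nhdsLT hxz] with u hu hu'
      exact absurd (hz u hu' hu.2) (not_le.2 hu.1)
    · push Not at h'
      filter_upwards [self_mem_nhdsWithin] with u hu hu'
      exact absurd (h' u hu') (not_le.2 hu)

namespace Valuation

variable (v : Valuation)

/-- Bisection: `divisible` halves a portion, and the filter eventually stays in one of the two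
halves. After `k` halvings the value is at most `(1 / 2) ^ k`. This does the work of countable
additivity, which a `Valuation` need not have. -/
lemma exists_small_of_decides {l : Filter ℝ}
    (hl : ∀ J : Set ℝ, J.OrdConnected → J ∈ l ∨ Jᶜ ∈ l) {ε : ℝ} (hε : 0 < ε) :
    ∃ S, IsPortion S ∧ v S < ε ∧ ∀ᶠ y in l, y ∈ cake → y ∈ S := by
  have key : ∀ k : ℕ, ∃ S, IsPortion S ∧ v S ≤ (1 / 2) ^ k ∧ ∀ᶠ y in l, y ∈ cake → y ∈ S := by
    intro k
    induction k with
    | zero => exact ⟨cake, isPortion_cake, by simp [v.normalized], .of_forall fun _ h => h⟩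
    | succ k ih =>
      obtain ⟨S, hS, hv, hy⟩ := ih
      obtain ⟨T, hTS, hT, hvT⟩ := v.divisible S hS (1 / 2) (by norm_num) (by norm_num)
      rcases hT.isIntervalUnion.mem_or_compl_mem hl with h | h
      · exact ⟨T, hT, by rw [hvT, pow_succ]; linarith, by filter_upwards [h] with y hy _ using hy⟩
      · refine ⟨S \ T, hS.diff hT, ?_, ?_⟩
        · have := v.diff_add hT hS hTS
          rw [pow_succ]
          linarith
        · filter_upwards [h, hy] with y hy h' hc using ⟨h' hc, hy⟩
  obtain ⟨k, hk⟩ := exists_pow_lt_of_lt_one hε (by norm_num : (1 / 2 : ℝ) < 1)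
  obtain ⟨S, hS, hv, hy⟩ := key k
  exact ⟨S, hS, hv.trans_lt hk, hy⟩

lemma inter_Iic_sub {R : Set ℝ} (hR : IsPortion R) {x y : ℝ} (hxy : x ≤ y) :
    v (R ∩ Iic y) - v (R ∩ Iic x) = v (R ∩ Ioc x y) := by
  have h : R ∩ Iic y = R ∩ Iic x ∪ R ∩ Ioc x y := by
    rw [← inter_union_distrib_left, Iic_union_Ioc_eq_Iic hxy]
  rw [h, v.additive _ _ (hR.inter_ordConnected ordConnected_Iic)
    (hR.inter_ordConnected ordConnected_Ioc)]
  · ring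
  · refine Disjoint.mono inter_subset_right inter_subset_right ?_
    exact disjoint_left.2 fun z hz hz' => absurd hz'.1 (not_lt.2 hz)

lemma inter_Iic_mono {R : Set ℝ} (hR : IsPortion R) : Monotone fun x => v (R ∩ Iic x) :=
  fun _ _ h => v.mono (hR.inter_ordConnected ordConnected_Iic)
    (hR.inter_ordConnected ordConnected_Iic) (inter_subset_inter_right _ (Iic_subset_Iic.2 h))

lemma inter_Ioi {R : Set ℝ} (hR : IsPortion R) (x : ℝ) :
    v (R ∩ Iic x) + v (R ∩ Ioi x) = v R := by
  rw [← v.additive _ _ (hR.inter_ordConnected ordConnected_Iic)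
    (hR.inter_ordConnected ordConnected_Ioi), ← inter_union_distrib_left, Iic_union_Ioi,
    inter_univ]
  refine Disjoint.mono inter_subset_right inter_subset_right ?_
  exact disjoint_left.2 fun z hz hz' => absurd (mem_Ioi.1 hz') (not_lt.2 hz)

/-- Close to `x` on one side, an increment of this function is the value of a set that lies, up to
the point `x`, in a portion of small value from `exists_small_of_decides`. -/
lemma continuous_inter_Iic {R : Set ℝ} (hR : IsPortion R) :
    Continuous fun x => v (R ∩ Iic x) := by
  refine continuous_iff_continuousAt.2 fun x => ?_
  rw [continuousAt_iff_continuous_left'_right']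
  have hoc : ∀ a b : ℝ, IsPortion (R ∩ Ioc a b) := fun a b => hR.inter_ordConnected ordConnected_Ioc
  constructor
  · refine Metric.tendsto_nhds.2 fun ε hε => ?_
    obtain ⟨S, hS, hvS, hy⟩ := v.exists_small_of_decides
      (fun J hJ => ordConnected_mem_nhdsLT_or hJ x) hε
    obtain ⟨a, ha, hsub⟩ := mem_nhdsLT_iff_exists_Ioo_subset.1 hy
    filter_upwards [Ioo_mem_nhdsLT ha] with y hy
    have h1 := v.inter_Iic_sub hR hy.2.le
    have h0 := v.inter_Iic_mono hR hy.2.le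
    have h2 : v (R ∩ Ioo y x) ≤ v S := v.mono (hR.inter_ordConnected ordConnected_Ioo) hS
      fun z hz => hsub ⟨hy.1.trans hz.2.1, hz.2.2⟩ (hR.1 hz.1)
    -- From the left the increment includes `x` itself, which the left neighbourhood filter does not
    -- see.
    have h3 : v (R ∩ Ioo y x) = v (R ∩ Ioc y x) := by
      refine v.congr_singleton (x := x) (hR.inter_ordConnected ordConnected_Ioo) (hoc _ _)
        (inter_subset_inter_right _ Ioo_subset_Ioc_self) fun z hz => ?_
      rcases hz.2.2.eq_or_lt with h | h
      exacts [Or.inl h, Or.inr ⟨hz.1, hz.2.1, h⟩]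
    simp only at h0
    rw [Real.dist_eq, abs_sub_comm, abs_of_nonneg (by linarith)]
    linarith
  · refine Metric.tendsto_nhds.2 fun ε hε => ?_
    obtain ⟨S, hS, hvS, hy⟩ := v.exists_small_of_decides
      (fun J hJ => ordConnected_mem_nhdsGT_or hJ x) hε
    obtain ⟨a, ha, hsub⟩ := mem_nhdsGT_iff_exists_Ioo_subset.1 hy
    filter_upwards [Ioo_mem_nhdsGT ha] with y hy
    have h1 := v.inter_Iic_sub hR hy.1.le
    have h0 := v.inter_Iic_mono hR hy.1.le
    have h2 : v (R ∩ Ioc x y) ≤ v S := v.mono (hoc _ _) hS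
      fun z hz => hsub ⟨hz.2.1, hz.2.2.trans_lt hy.2⟩ (hR.1 hz.1)
    simp only at h0
    rw [Real.dist_eq, abs_of_nonneg (by linarith)]
    linarith

lemma inter_Iic_one {R : Set ℝ} (hR : IsPortion R) : R ∩ Iic 1 = R :=
  inter_eq_left.2 fun _ h => (hR.1 h).2

lemma val_inter_Iic_zero {R : Set ℝ} (hR : IsPortion R) : v (R ∩ Iic 0) = 0 := by
  refine Eq.trans ?_ v.empty
  refine (v.congr_singleton (x := 0) isPortion_empty (hR.inter_ordConnected ordConnected_Iic)
    (empty_subset _) fun y hy => Or.inl (le_antisymm hy.2 (hR.1 hy.1).1)).symm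

/-- A moving knife stops at a prescribed value. -/
lemma exists_cut {R : Set ℝ} (hR : IsPortion R) {α : ℝ} (h0 : 0 ≤ α) (h1 : α ≤ v R) :
    ∃ x ∈ Icc (0 : ℝ) 1, v (R ∩ Iic x) = α := by
  have := intermediate_value_Icc (zero_le_one' ℝ) (v.continuous_inter_Iic hR).continuousOn
  rw [v.val_inter_Iic_zero hR, inter_Iic_one hR] at this
  exact this ⟨h0, h1⟩

lemma exists_part {R : Set ℝ} (hR : IsPortion R) {α : ℝ} (h0 : 0 ≤ α) (h1 : α ≤ v R) :
    ∃ T, T ⊆ R ∧ IsPortion T ∧ v T = α := by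
  obtain ⟨x, -, hx⟩ := v.exists_cut hR h0 h1
  exact ⟨_, inter_subset_left, hR.inter_ordConnected ordConnected_Iic, hx⟩

lemma exists_partition {R : Set ℝ} (hR : IsPortion R) (k : ℕ) {c : ℝ} (hc : 0 ≤ c)
    (h : v R = (k + 1 : ℕ) * c) :
    ∃ Q : Fin (k + 1) → Set ℝ, IsPartition R Q ∧ ∀ j, v (Q j) = c := by
  induction k generalizing R with
  | zero =>
    refine ⟨fun _ => R, ⟨fun _ => hR, fun i j hij => absurd (Fin.ext (by omega)) hij,
      iUnion_const _⟩, fun _ => ?_⟩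
    simpa using h
  | succ k ih =>
    have hcR : c ≤ v R := by
      rw [h]
      push_cast
      nlinarith [(Nat.cast_nonneg k : (0 : ℝ) ≤ k)]
    obtain ⟨T, hTR, hT, hv⟩ := v.exists_part hR hc hcR
    have hd := v.diff_add hT hR hTR
    obtain ⟨Q, hQ, hQv⟩ := ih (hR.diff hT) (by push_cast at h ⊢; linarith)
    have hQsub : ∀ j, Q j ⊆ R \ T := fun j => hQ.2.2 ▸ subset_iUnion Q j
    refine ⟨Fin.cons T Q, ⟨?_, ?_, ?_⟩, ?_⟩
    · intro j
      refine Fin.cases ?_ (fun j => ?_) j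
      exacts [hT, hQ.1 j]
    · intro i j
      refine Fin.cases ?_ (fun i => ?_) i <;> refine Fin.cases ?_ (fun j => ?_) j
      · simp
      · intro _
        exact disjoint_sdiff_right.mono_right (hQsub j)
      · intro _
        exact disjoint_sdiff_left.mono_left (hQsub i)
      · intro hij
        exact hQ.2.1 i j fun e => hij (by rw [e])
    · ext x
      rw [mem_iUnion, Fin.exists_fin_succ]
      simp only [Fin.cons_zero, Fin.cons_succ]
      have hx' : (∃ j, x ∈ Q j) ↔ x ∈ R \ T := by rw [← hQ.2.2, mem_iUnion]
      constructor
      · rintro (h | h)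
        exacts [hTR h, (hx'.1 h).1]
      · intro h
        by_cases hx : x ∈ T
        exacts [Or.inl hx, Or.inr (hx'.2 ⟨h, hx⟩)]
    · intro j
      refine Fin.cases ?_ (fun j => ?_) j
      exacts [hv, hQv j]

/-- Every portion can be cut into `k` portions of equal value. -/
lemma exists_equal_partition {R : Set ℝ} (hR : IsPortion R) {k : ℕ} (hk : 0 < k) :
    ∃ Q : Fin k → Set ℝ, IsPartition R Q ∧ ∀ j, v (Q j) = v R / (k : ℝ) := by
  obtain ⟨k, rfl⟩ : ∃ m, k = m + 1 := ⟨k - 1, by omega⟩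
  refine v.exists_partition hR k (div_nonneg (v.nonneg hR) (Nat.cast_nonneg _)) ?_
  field_simp

end Valuation

end CakeCutting

namespace CakeCutting

open Set Filter Topology MeasureTheory

/-! ### Cells of the cake and valuations that are uniform on them -/

/-- The part of the cake whose points have an index in `s`. -/
def cells {ι : Type*} (idx : ℝ → ι) (s : Finset ι) : Set ℝ := {x | x ∈ cake ∧ idx x ∈ s}

section cells

variable {ι : Type*} {idx : ℝ → ι}

lemma mem_cells {s : Finset ι} {x : ℝ} : x ∈ cells idx s ↔ x ∈ cake ∧ idx x ∈ s := Iff.rfl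

lemma cells_mono {s t : Finset ι} (h : s ⊆ t) : cells idx s ⊆ cells idx t :=
  fun _ hx => ⟨hx.1, h hx.2⟩

lemma cells_disjoint {s t : Finset ι} (h : Disjoint s t) : Disjoint (cells idx s) (cells idx t) :=
  disjoint_left.2 fun _ hx hy => Finset.disjoint_left.1 h hx.2 hy.2

lemma cells_union [DecidableEq ι] (s t : Finset ι) :
    cells idx (s ∪ t) = cells idx s ∪ cells idx t := by
  ext x
  simp only [mem_cells, mem_union, Finset.mem_union]
  tauto

lemma cells_univ [Fintype ι] : cells idx Finset.univ = cake := by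
  ext x
  simp [mem_cells]

lemma isPartition_cells {k : ℕ} (hidx : ∀ s : Finset ι, IsPortion (cells idx s)) (s : Finset ι)
    (f : ι → Fin k) :
    IsPartition (cells idx s) fun j => cells idx {b ∈ s | f b = j} := by
  refine ⟨fun j => hidx _, fun i j hij => cells_disjoint ?_, ?_⟩
  · refine Finset.disjoint_left.2 fun b hb hb' => hij ?_
    rw [← (Finset.mem_filter.1 hb).2, (Finset.mem_filter.1 hb').2]
  · ext x
    simp [mem_cells]

end cells

/-- The index of the interval `(b / K, (b + 1) / K]` that contains `x`. -/
noncomputable def gridIndex (K : ℕ) (x : ℝ) : ℕ := ⌈(K : ℝ) * x⌉₊ - 1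

lemma gridIndex_mono (K : ℕ) : Monotone (gridIndex K) := fun _ _ h =>
  Nat.sub_le_sub_right (Nat.ceil_mono (mul_le_mul_of_nonneg_left h (Nat.cast_nonneg _))) 1

/-- Positivity of `c` matters: the truncated subtraction in `gridIndex` puts the point `0` into cell
`0`. -/
lemma gridIndex_lt_iff {K c : ℕ} (hc : 0 < c) {x : ℝ} : gridIndex K x < c ↔ (K : ℝ) * x ≤ c := by
  rw [← Nat.ceil_le, gridIndex]
  omega

lemma gridIndex_lt {K : ℕ} (hK : 0 < K) {x : ℝ} (hx : x ∈ cake) : gridIndex K x < K := by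
  rw [gridIndex_lt_iff hK]
  have : (0 : ℝ) ≤ K := Nat.cast_nonneg _
  nlinarith [hx.2]

lemma gridIndex_lt_iff_le_div {K c : ℕ} (hK : 0 < K) (hc : 0 < c) {x : ℝ} :
    gridIndex K x < c ↔ x ≤ (c : ℝ) / K := by
  rw [gridIndex_lt_iff hc, le_div_iff₀ (by exact_mod_cast hK), mul_comm]

lemma isPortion_gridCells (K : ℕ) (s : Finset ℕ) : IsPortion (cells (gridIndex K) s) := by
  have : cells (gridIndex K) s = ⋃ b ∈ s, cake ∩ gridIndex K ⁻¹' {b} := by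
    ext x
    simp [mem_cells]
  rw [this]
  exact .biUnion fun b _ => isPortion_cake.inter_ordConnected
    (ordConnected_singleton.preimage_mono (gridIndex_mono K))

lemma gridCells_Ico_zero {K b : ℕ} (hK : 0 < K) (hb : 0 < b) (hbK : b ≤ K) :
    cells (gridIndex K) (Finset.Ico 0 b) = Icc 0 ((b : ℝ) / K) := by
  ext x
  rw [mem_cells, Finset.mem_Ico, gridIndex_lt_iff_le_div hK hb, mem_Icc]
  have : (b : ℝ) / K ≤ 1 := div_le_one_of_le₀ (by exact_mod_cast hbK) (Nat.cast_nonneg _)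
  constructor
  · exact fun h => ⟨h.1.1, h.2.2⟩
  · exact fun h => ⟨⟨h.1, h.2.trans this⟩, Nat.zero_le _, h.2⟩

lemma gridCells_Ico {K a b : ℕ} (hK : 0 < K) (ha : 0 < a) (hab : a ≤ b) (hbK : b ≤ K) :
    cells (gridIndex K) (Finset.Ico a b) = Ioc ((a : ℝ) / K) ((b : ℝ) / K) := by
  ext x
  rw [mem_cells, Finset.mem_Ico, gridIndex_lt_iff_le_div hK (ha.trans_le hab), mem_Ioc,
    ← not_lt (a := gridIndex K x), gridIndex_lt_iff_le_div hK ha, not_le]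
  have : (b : ℝ) / K ≤ 1 := div_le_one_of_le₀ (by exact_mod_cast hbK) (Nat.cast_nonneg _)
  have h0 : (0 : ℝ) ≤ (a : ℝ) / K := by positivity
  constructor
  · exact fun h => h.2
  · exact fun h => ⟨⟨h0.trans h.1.le, h.2.trans this⟩, h⟩

lemma volume_gridCell {K b : ℕ} (hb : b < K) :
    volume.real (cells (gridIndex K) {b}) = 1 / (K : ℝ) := by
  have hK : 0 < K := by omega
  have hK' : (K : ℝ) ≠ 0 := by positivity
  rw [← Nat.Ico_succ_singleton]
  rcases b.eq_zero_or_pos with rfl | hb0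
  · rw [gridCells_Ico_zero hK (by omega) hb, Real.volume_real_Icc_of_le (by positivity)]
    simp
  · rw [gridCells_Ico hK hb0 (by omega) hb, Real.volume_real_Ioc_of_le (by gcongr; omega)]
    push_cast
    field_simp
    ring

lemma volume_ne_top_of_subset_cake {S : Set ℝ} (hS : S ⊆ cake) : volume S ≠ ⊤ :=
  ((measure_mono hS).trans_lt (by simp [cake])).ne

lemma continuous_volume_inter_Iic {S : Set ℝ} (hS : S ⊆ cake) (hm : MeasurableSet S) :
    Continuous fun x => volume.real (S ∩ Iic x) := by
  have key : ∀ x y : ℝ, x ≤ y →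
      |volume.real (S ∩ Iic y) - volume.real (S ∩ Iic x)| ≤ y - x := by
    intro x y hxy
    have h : S ∩ Iic y = S ∩ Iic x ∪ S ∩ Ioc x y := by
      rw [← inter_union_distrib_left, Iic_union_Ioc_eq_Iic hxy]
    have hd : Disjoint (S ∩ Iic x) (S ∩ Ioc x y) :=
      Disjoint.mono inter_subset_right inter_subset_right
        (disjoint_left.2 fun z hz hz' => absurd hz'.1 (not_lt.2 hz))
    rw [h, measureReal_union hd (hm.inter measurableSet_Ioc)
      (volume_ne_top_of_subset_cake (inter_subset_left.trans hS))
      (volume_ne_top_of_subset_cake (inter_subset_left.trans hS)), add_sub_cancel_left,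
      abs_of_nonneg measureReal_nonneg, ← Real.volume_real_Ioc_of_le hxy]
    exact measureReal_mono inter_subset_right (by simp)
  refine (LipschitzWith.of_dist_le_mul (K := 1) fun x y => ?_).continuous
  rw [Real.dist_eq, Real.dist_eq, NNReal.coe_one, one_mul]
  rcases le_total x y with h | h
  · rw [abs_sub_comm, abs_sub_comm x, abs_of_nonneg (sub_nonneg.2 h)]
    exact key x y h
  · rw [abs_of_nonneg (sub_nonneg.2 h)]
    exact key y x h

/-- The weight of `S` if the `b`-th of `K` cells has weight `w b`, spread uniformly. -/
noncomputable def gridWeight (K : ℕ) (w : ℕ → ℝ) (S : Set ℝ) : ℝ :=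
  ∑ b ∈ Finset.range K, w b * (K * volume.real (S ∩ cells (gridIndex K) {b}))

lemma gridWeight_cells {K : ℕ} {w : ℕ → ℝ} {s : Finset ℕ} (hs : s ⊆ Finset.range K) :
    gridWeight K w (cells (gridIndex K) s) = ∑ b ∈ s, w b := by
  rw [← Finset.inter_eq_right.2 hs, ← Finset.sum_ite_mem, gridWeight]
  refine Finset.sum_congr rfl fun b hb => ?_
  rw [Finset.mem_range] at hb
  rw [Finset.inter_eq_right.2 hs]
  split_ifs with h
  · rw [inter_eq_right.2 (cells_mono (Finset.singleton_subset_iff.2 h)), volume_gridCell hb]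
    have : (K : ℝ) ≠ 0 := by
      have : 0 < K := by omega
      positivity
    field_simp
  · rw [(cells_disjoint (Finset.disjoint_singleton_right.2 h)).inter_eq]
    simp

lemma gridWeight_union {K : ℕ} {w : ℕ → ℝ} {S T : Set ℝ} (hS : IsPortion S) (hT : IsPortion T)
    (h : Disjoint S T) : gridWeight K w (S ∪ T) = gridWeight K w S + gridWeight K w T := by
  rw [gridWeight, gridWeight, gridWeight, ← Finset.sum_add_distrib]
  refine Finset.sum_congr rfl fun b _ => ?_
  rw [union_inter_distrib_right, measureReal_union (h.mono inter_subset_left inter_subset_left)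
    (hT.measurableSet.inter (isPortion_gridCells K _).measurableSet)
    (volume_ne_top_of_subset_cake (inter_subset_left.trans hS.1))
    (volume_ne_top_of_subset_cake (inter_subset_left.trans hT.1))]
  ring

lemma gridWeight_nonneg {K : ℕ} {w : ℕ → ℝ} (hw : ∀ b < K, 0 < w b) (S : Set ℝ) :
    0 ≤ gridWeight K w S :=
  Finset.sum_nonneg fun b hb => mul_nonneg (hw b (Finset.mem_range.1 hb)).le
    (mul_nonneg (Nat.cast_nonneg _) measureReal_nonneg)

lemma cake_eq_gridCells {K : ℕ} (hK : 0 < K) :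
    cake = cells (gridIndex K) (Finset.range K) := by
  ext x
  simp only [mem_cells, Finset.mem_range]
  exact ⟨fun h => ⟨h, gridIndex_lt hK h⟩, fun h => h.1⟩

/-- The valuation that spreads given positive weights uniformly over the cells of a grid. -/
noncomputable def gridValuation (K : ℕ) (w : ℕ → ℝ) (hK : 0 < K) (hw : ∀ b < K, 0 < w b)
    (h1 : ∑ b ∈ Finset.range K, w b = 1) : Valuation where
  val := gridWeight K w
  normalized := by rw [cake_eq_gridCells hK, gridWeight_cells subset_rfl, h1]
  mem_unit S hS := by
    have h := gridWeight_union (K := K) (w := w) hS (isPortion_cake.diff hS) disjoint_sdiff_right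
    rw [union_sdiff_self, union_eq_right.2 hS.1] at h
    have h' : gridWeight K w cake = 1 := by
      rw [cake_eq_gridCells hK, gridWeight_cells subset_rfl, h1]
    have := gridWeight_nonneg hw (cake \ S)
    exact ⟨gridWeight_nonneg hw S, by linarith⟩
  positive S hS hi := by
    -- A portion of weight zero meets every cell in a null set, as all weights are positive. So it
    -- is null and has empty interior.
    by_contra hc
    have h0 : gridWeight K w S = 0 := le_antisymm (not_lt.1 hc) (gridWeight_nonneg hw S)
    have hK' : (0 : ℝ) < K := by exact_mod_cast hK
    rw [gridWeight, Finset.sum_eq_zero_iff_of_nonneg (fun b hb =>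
      mul_nonneg (hw b (Finset.mem_range.1 hb)).le (mul_nonneg hK'.le measureReal_nonneg))] at h0
    have hz : ∀ b ∈ Finset.range K, volume (S ∩ cells (gridIndex K) {b}) = 0 := by
      intro b hb
      have h := h0 b hb
      rw [mul_eq_zero, mul_eq_zero] at h
      have h := (h.resolve_left (hw b (Finset.mem_range.1 hb)).ne').resolve_left hK'.ne'
      exact (measureReal_eq_zero_iff
        (volume_ne_top_of_subset_cake (inter_subset_left.trans hS.1))).1 h
    have hcov : S ⊆ ⋃ b ∈ Finset.range K, S ∩ cells (gridIndex K) {b} := by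
      intro x hx
      simp only [mem_iUnion]
      exact ⟨gridIndex K x, Finset.mem_range.2 (gridIndex_lt hK (hS.1 hx)), hx, hS.1 hx, by simp⟩
    have hS0 : volume S = 0 := measure_mono_null hcov
      ((measure_biUnion_null_iff (Finset.countable_toSet _)).2 hz)
    exact (isOpen_interior.measure_pos volume hi).ne' (measure_mono_null interior_subset hS0)
  additive S T hS hT h := gridWeight_union hS hT h
  divisible S hS α h0 h1' := by
    -- Divisibility holds because the weight to the left of a moving knife is continuous.
    have hcont : Continuous fun x => gridWeight K w (S ∩ Iic x) := by
      unfold gridWeight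
      refine continuous_finsetSum _ fun b _ => continuous_const.mul (continuous_const.mul ?_)
      have hcomm : ∀ x, S ∩ Iic x ∩ cells (gridIndex K) {b} =
          S ∩ cells (gridIndex K) {b} ∩ Iic x := fun x => inter_right_comm _ _ _
      simp only [hcomm]
      exact continuous_volume_inter_Iic (inter_subset_left.trans hS.1)
        (hS.measurableSet.inter (isPortion_gridCells K _).measurableSet)
    have hz : gridWeight K w (S ∩ Iic 0) = 0 := by
      refine Finset.sum_eq_zero fun b _ => ?_
      have hsub : S ∩ Iic 0 ∩ cells (gridIndex K) {b} ⊆ {0} := fun y hy =>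
        le_antisymm hy.1.2 (hS.1 hy.1.1).1
      rw [measureReal_def, measure_mono_null hsub (by simp)]
      simp
    have ho : S ∩ Iic 1 = S := inter_eq_left.2 fun _ h => (hS.1 h).2
    have := intermediate_value_Icc (zero_le_one' ℝ) hcont.continuousOn
    have hn := gridWeight_nonneg hw S
    rw [hz, ho] at this
    obtain ⟨x, -, hx⟩ := this
      (show α * gridWeight K w S ∈ _ from ⟨mul_nonneg h0 hn, mul_le_of_le_one_left hn h1'⟩)
    exact ⟨_, inter_subset_left, hS.inter_ordConnected ordConnected_Iic, hx⟩

lemma gridValuation_cells {K : ℕ} {w : ℕ → ℝ} (hK : 0 < K) (hw : ∀ b < K, 0 < w b)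
    (h1 : ∑ b ∈ Finset.range K, w b = 1) {s : Finset ℕ} (hs : s ⊆ Finset.range K) :
    gridValuation K w hK hw h1 (cells (gridIndex K) s) = ∑ b ∈ s, w b :=
  gridWeight_cells hs

/-- There are valuations with prescribed values at the intervals between the points `b / K`. -/
lemma exists_valuation_Icc {K : ℕ} (hK : 0 < K) (C : ℕ → ℝ) (h0 : C 0 = 0) (h1 : C K = 1)
    (hC : ∀ b < K, C b < C (b + 1)) :
    ∃ v : Valuation, ∀ a b : ℕ, a ≤ b → b ≤ K →
      v (Icc ((a : ℝ) / K) ((b : ℝ) / K)) = C b - C a := by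
  have hsum : ∀ a b : ℕ, a ≤ b → ∑ c ∈ Finset.Ico a b, (C (c + 1) - C c) = C b - C a :=
    fun a b hab => Finset.sum_Ico_sub C hab
  refine ⟨gridValuation K (fun b => C (b + 1) - C b) hK (fun b hb => sub_pos.2 (hC b hb))
    (by rw [Finset.sum_range_sub, h0, h1, sub_zero]), fun a b hab hbK => ?_⟩
  rcases hab.eq_or_lt with rfl | hlt
  · rw [Icc_self, Valuation.singleton, sub_self]
    exact ⟨by positivity, div_le_one_of_le₀ (by exact_mod_cast hbK) (Nat.cast_nonneg _)⟩
  · have hs : Finset.Ico a b ⊆ Finset.range K := fun c hc =>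
      Finset.mem_range.2 ((Finset.mem_Ico.1 hc).2.trans_le hbK)
    rw [← hsum a b hab, ← gridValuation_cells hK _ _ hs]
    rcases a.eq_zero_or_pos with rfl | ha
    · rw [gridCells_Ico_zero hK hlt hbK]
      simp
    · rw [gridCells_Ico hK ha hab hbK, Valuation.Ioc_eq_Icc]
      · positivity
      · exact div_le_one_of_le₀ (by exact_mod_cast hbK) (Nat.cast_nonneg _)

/-- The cake can be cut into cells, indexed by a given finite type, such that there are valuations
with arbitrary positive values at the cells. -/
lemma exists_cells (ι : Type*) [Fintype ι] [Nonempty ι] :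
    ∃ idx : ℝ → ι, (∀ s, IsPortion (cells idx s)) ∧
      ∀ w : ι → ℝ, (∀ b, 0 < w b) → ∑ b, w b = 1 →
        ∃ v : Valuation, ∀ s, v (cells idx s) = ∑ b ∈ s, w b := by
  have hK : 0 < Fintype.card ι := Fintype.card_pos
  set K := Fintype.card ι with hKdef
  let e := Fintype.equivFin ι
  let g : ι ↪ ℕ := e.toEmbedding.trans Fin.valEmbedding
  have hg : ∀ b, g b < K := fun b => (e b).2
  -- The remainder only makes the index total; on the cake `gridIndex K x` is below `K` already.
  let idx : ℝ → ι := fun x => e.symm ⟨gridIndex K x % K, Nat.mod_lt _ hK⟩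
  have hidx : ∀ s, cells idx s = cells (gridIndex K) (s.map g) := by
    intro s
    ext x
    simp only [mem_cells, Finset.mem_map]
    refine and_congr_right fun hx => ?_
    have hlt := gridIndex_lt hK hx
    constructor
    · intro h
      refine ⟨_, h, ?_⟩
      simp [g, idx, Nat.mod_eq_of_lt hlt]
    · rintro ⟨b, hb, hbx⟩
      have : idx x = b := by
        rw [Equiv.symm_apply_eq]
        ext
        simp [← hbx, Nat.mod_eq_of_lt (hg b)]
        rfl
      rwa [this]
  refine ⟨idx, fun s => by rw [hidx]; exact isPortion_gridCells _ _, fun w hw h1 => ?_⟩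
  have hsurj : ∀ b < K, ∃ a, g a = b := fun b hb => ⟨e.symm ⟨b, hb⟩, by simp [g]⟩
  have hmap : (Finset.univ : Finset ι).map g = Finset.range K := by
    ext b
    simp only [Finset.mem_map, Finset.mem_univ, true_and, Finset.mem_range]
    exact ⟨fun ⟨a, ha⟩ => ha ▸ hg a, hsurj b⟩
  have hinv : ∀ a, Function.extend g w 0 (g a) = w a := fun a => g.injective.extend_apply _ _ _
  refine ⟨gridValuation K (Function.extend g w 0) hK ?_ ?_, fun s => ?_⟩
  · intro b hb
    obtain ⟨a, rfl⟩ := hsurj b hb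
    rw [hinv]
    exact hw a
  · rw [← hmap, Finset.sum_map, ← h1]
    exact Finset.sum_congr rfl fun a _ => hinv a
  · rw [hidx, gridValuation_cells, Finset.sum_map]
    · exact Finset.sum_congr rfl fun a _ => hinv a
    · rw [← hmap]
      exact Finset.map_subset_map.2 (Finset.subset_univ s)

end CakeCutting

namespace CakeCutting

open Set

/-! ### Counting envy-free-relations -/

section counting

variable {n : ℕ} {V : Fin n → Valuation} {A : Fin n → Set ℝ}

/-- The players in `s`, other than `i`, that `i` does not envy. -/
noncomputable def unenvied (V : Fin n → Valuation) (A : Fin n → Set ℝ) (i : Fin n)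
    (s : Finset (Fin n)) : Finset (Fin n) :=
  open Classical in {j ∈ s | i ≠ j ∧ V i (A j) ≤ V i (A i)}

lemma mem_unenvied {i j : Fin n} {s : Finset (Fin n)} :
    j ∈ unenvied V A i s ↔ j ∈ s ∧ i ≠ j ∧ V i (A j) ≤ V i (A i) := by
  simp [unenvied]

lemma unenvied_subset (i : Fin n) (s : Finset (Fin n)) : unenvied V A i s ⊆ s :=
  fun _ hj => (mem_unenvied.1 hj).1

lemma unenvied_mono {i : Fin n} {s t : Finset (Fin n)} (h : s ⊆ t) :
    unenvied V A i s ⊆ unenvied V A i t := fun _ hj =>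
  mem_unenvied.2 ⟨h (mem_unenvied.1 hj).1, (mem_unenvied.1 hj).2⟩

lemma card_unenvied_union {i : Fin n} {s t : Finset (Fin n)} (h : Disjoint s t) :
    (unenvied V A i (s ∪ t)).card = (unenvied V A i s).card + (unenvied V A i t).card := by
  rw [← Finset.card_union_of_disjoint]
  · congr 1
    ext j
    simp only [mem_unenvied, Finset.mem_union]
    tauto
  · exact h.mono (unenvied_subset _ _) (unenvied_subset _ _)

lemma card_unenvied_add_le {i : Fin n} {s t u : Finset (Fin n)} (h : Disjoint s t)
    (hs : s ⊆ u) (ht : t ⊆ u) :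
    (unenvied V A i s).card + (unenvied V A i t).card ≤ (unenvied V A i u).card := by
  rw [← card_unenvied_union h]
  exact Finset.card_le_card (unenvied_mono (Finset.union_subset hs ht))

lemma card_unenvied_eq {i : Fin n} {s : Finset (Fin n)} (hi : i ∉ s)
    (h : ∀ j ∈ s, V i (A j) ≤ V i (A i)) : (unenvied V A i s).card = s.card := by
  congr 1
  ext j
  rw [mem_unenvied]
  exact ⟨fun h => h.1, fun hj => ⟨hj, fun e => hi (e ▸ hj), h j hj⟩⟩

/-- Averaging: portions whose total is at most `s.card` times the own value cannot all exceed it. -/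
lemma one_le_card_unenvied {i : Fin n} {s : Finset (Fin n)} (hi : i ∉ s) (hs : s.Nonempty)
    (h : ∑ j ∈ s, V i (A j) ≤ s.card * V i (A i)) : 1 ≤ (unenvied V A i s).card := by
  rw [← nsmul_eq_mul, ← Finset.sum_const] at h
  obtain ⟨j, hj, hle⟩ := Finset.exists_le_of_sum_le hs h
  exact Finset.card_pos.2 ⟨j, mem_unenvied.2 ⟨hj, fun e => hi (e ▸ hj), hle⟩⟩

lemma envyFreeCount_eq_sum :
    envyFreeCount V A = ∑ i, (unenvied V A i Finset.univ).card := by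
  classical
  rw [← Finset.card_sigma, envyFreeCount, ← Set.ncard_coe_finset]
  refine Set.ncard_congr (fun p _ => ⟨p.1, p.2⟩) ?_ ?_ ?_
  · rintro ⟨i, j⟩ h
    simp only [Finset.coe_sigma, mem_sigma_iff, Finset.mem_coe, Finset.mem_univ, mem_unenvied,
      true_and]
    exact h
  · rintro ⟨i, j⟩ ⟨i', j'⟩ _ _ h
    simp only [Sigma.mk.injEq, heq_eq_eq] at h
    rw [h.1, h.2]
  · rintro ⟨i, j⟩ h
    simp only [Finset.coe_sigma, mem_sigma_iff, Finset.mem_coe, Finset.mem_univ, mem_unenvied,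
      true_and] at h
    exact ⟨(i, j), h, rfl⟩

lemma envyFreeCount_le_sum {T : Fin n → Finset (Fin n)}
    (h : ∀ i j, i ≠ j → V i (A j) ≤ V i (A i) → j ∈ T i) :
    envyFreeCount V A ≤ ∑ i, (T i).card := by
  rw [envyFreeCount_eq_sum]
  refine Finset.sum_le_sum fun i _ => Finset.card_le_card fun j hj => ?_
  rw [mem_unenvied] at hj
  exact h i j hj.2.1 hj.2.2

/-- The `n - 1` other portions are worth at most `1 - 1 / n` together, so averaging applies. Summed
over all players, this is the lower bound `n` for every proportional protocol. -/
lemma IsDivision.one_le_card_unenvied (hA : IsDivision A) (hn : 2 ≤ n) {i : Fin n}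
    (hi : 1 / (n : ℝ) ≤ V i (A i)) : 1 ≤ (unenvied V A i Finset.univ).card := by
  have hcard : (Finset.univ.erase i).card = n - 1 := by simp
  have hn0 : (0 : ℝ) < n := by positivity
  refine le_trans ?_ (Finset.card_le_card (unenvied_mono (Finset.subset_univ
    (Finset.univ.erase i))))
  refine CakeCutting.one_le_card_unenvied (by simp) (Finset.card_pos.1 (by omega)) ?_
  have hs := (V i).partition hA.1
  rw [(V i).normalized, ← Finset.add_sum_erase _ _ (Finset.mem_univ i)] at hs
  rw [hcard, Nat.cast_sub (by omega), Nat.cast_one]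
  rw [div_le_iff₀ hn0] at hi
  linarith

lemma IsProportional.le_envyFreeCount {P : Protocol n} (hP : IsProportional P) (hn : 2 ≤ n)
    (hA : A ∈ P V) : n ≤ envyFreeCount V A := by
  rw [envyFreeCount_eq_sum]
  have h := (hP V).2 A hA
  calc n = ∑ _i : Fin n, 1 := by simp
    _ ≤ _ := Finset.sum_le_sum fun i _ => h.1.one_le_card_unenvied hn (h.2 i)

lemma HasDGEF.intro {P : Protocol n} {d : ℕ} (hP : IsProportional P)
    (hle : ∀ V, ∀ A ∈ P V, d ≤ envyFreeCount V A)
    (hge : ∃ V, ∃ A ∈ P V, envyFreeCount V A ≤ d) : HasDGEF P d := by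
  obtain ⟨V, A, hA, h⟩ := hge
  exact ⟨hP, hle, fun k hk => (hk V A hA).trans h⟩

/-- For an arbitrary strategy no exact value is at hand. The maximum still exists, because a single
example bounds all guaranteed counts. -/
lemma HasDGEF.exists_le {P : Protocol n} {d : ℕ} (hP : IsProportional P)
    (hge : ∃ V, ∃ A ∈ P V, envyFreeCount V A ≤ d) : ∃ d' ≤ d, HasDGEF P d' := by
  classical
  obtain ⟨V, A, hA, h⟩ := hge
  let S : Set ℕ := {k : ℕ | ∀ (V : Fin n → Valuation), ∀ A ∈ P V, k ≤ envyFreeCount V A}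
  have hb : ∀ k ∈ S, k ≤ d := fun k hk => (hk V A hA).trans h
  have hne : S.Nonempty := ⟨0, fun _ _ _ => Nat.zero_le _⟩
  have hbdd : BddAbove S := ⟨d, hb⟩
  exact ⟨sSup S, hb _ (Nat.sSup_mem hne hbdd), hP, Nat.sSup_mem hne hbdd,
    fun k hk => le_csSup hbdd hk⟩

end counting

/-! ### Sharing a portion among some of the players -/

/-- The portions `A i` with `i ∈ N` form a partition of `R`. -/
structure IsSharing {n : ℕ} (N : Finset (Fin n)) (R : Set ℝ) (A : Fin n → Set ℝ) : Prop where
  portion : ∀ i ∈ N, IsPortion (A i)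
  disjoint : (N : Set (Fin n)).PairwiseDisjoint A
  cover : (⋃ i ∈ N, A i) = R

namespace IsSharing

variable {n : ℕ} {N M : Finset (Fin n)} {R S : Set ℝ} {A : Fin n → Set ℝ}

lemma isPortion (h : IsSharing N R A) : IsPortion R := h.cover ▸ .biUnion h.portion

lemma subset (h : IsSharing N R A) {i : Fin n} (hi : i ∈ N) : A i ⊆ R :=
  h.cover ▸ subset_biUnion_of_mem (u := A) (Finset.mem_coe.2 hi)

lemma sum_eq (h : IsSharing N R A) (v : Valuation) : ∑ i ∈ N, v (A i) = v R := by
  rw [← h.cover, v.biUnion h.portion h.disjoint]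

lemma union [DecidableEq (Fin n)] (h : IsSharing N R A) (h' : IsSharing M S A)
    (hd : Disjoint R S) : IsSharing (N ∪ M) (R ∪ S) A where
  portion i hi := (Finset.mem_union.1 hi).elim (h.portion i) (h'.portion i)
  disjoint := by
    intro i hi j hj hij
    rw [Finset.mem_coe, Finset.mem_union] at hi hj
    rcases hi with hi | hi <;> rcases hj with hj | hj
    · exact h.disjoint hi hj hij
    · exact hd.mono (h.subset hi) (h'.subset hj)
    · exact hd.symm.mono (h'.subset hi) (h.subset hj)
    · exact h'.disjoint hi hj hij
  cover := by
    rw [Finset.set_biUnion_union, h.cover, h'.cover]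

lemma singleton {i : Fin n} (h : IsPortion (A i)) : IsSharing {i} (A i) A where
  portion j hj := by rwa [Finset.mem_singleton.1 hj]
  disjoint := by simp
  cover := by simp

lemma isDivision (h : IsSharing Finset.univ cake A) (V : Fin n → Valuation)
    (hpos : ∀ i, 0 < V i (A i)) : IsDivision A :=
  ⟨⟨fun i => h.portion i (Finset.mem_univ _), fun i j hij =>
    h.disjoint (Finset.mem_coe.2 (Finset.mem_univ i)) (Finset.mem_coe.2 (Finset.mem_univ j)) hij,
    by simpa using h.cover⟩, fun i => (V i).nonempty_of_pos (hpos i)⟩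

lemma congr {B : Fin n → Set ℝ} (h : IsSharing N R A) (hAB : ∀ i ∈ N, A i = B i) :
    IsSharing N R B where
  portion i hi := hAB i hi ▸ h.portion i hi
  disjoint i hi j hj hij := by
    have := h.disjoint hi hj hij
    simp only [Function.onFun] at this ⊢
    rwa [← hAB i hi, ← hAB j hj]
  cover := by
    rw [← h.cover]
    exact (iUnion₂_congr hAB).symm

end IsSharing

/-- A protocol is proportional if every result shares the cake proportionally. -/
lemma IsProportional.of_isSharing {n : ℕ} (hn : 0 < n) {P : Protocol n}
    (hne : ∀ V, (P V).Nonempty)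
    (h : ∀ V, ∀ A ∈ P V, IsSharing Finset.univ cake A ∧ ∀ i, 1 / (n : ℝ) ≤ V i (A i)) :
    IsProportional P := fun V => ⟨hne V, fun A hA =>
  ⟨(h V A hA).1.isDivision V fun i => lt_of_lt_of_le (by positivity) ((h V A hA).2 i),
    (h V A hA).2⟩⟩

lemma CutAndChoose.values {a b : Valuation} {R X Y : Set ℝ} (h : CutAndChoose a b R X Y) :
    a X = a R / 2 ∧ a Y = a R / 2 ∧ b R / 2 ≤ b Y := by
  obtain ⟨hX, hY, hd, rfl, ha, hb⟩ := h
  have h1 := a.additive X Y hX hY hd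
  have h2 := b.additive X Y hX hY hd
  refine ⟨by linarith, by linarith, by linarith⟩

lemma exists_cutAndChoose (a b : Valuation) {R : Set ℝ} (hR : IsPortion R) :
    ∃ X Y, CutAndChoose a b R X Y := by
  obtain ⟨T, hT, hp, hv⟩ := a.divisible R hR (1 / 2) (by norm_num) (by norm_num)
  have h := a.diff_add hp hR hT
  rcases le_total (b T) (b (R \ T)) with hb | hb
  · exact ⟨T, R \ T, hp, hR.diff hp, disjoint_sdiff_right, union_sdiff_cancel hT,
      by linarith, hb⟩
  · exact ⟨R \ T, T, hR.diff hp, hp, disjoint_sdiff_left, sdiff_union_of_subset hT,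
      by linarith, hb⟩

lemma CutAndChoose.isSharing {n : ℕ} {v w : Valuation} {a b : Fin n} (hab : a ≠ b) {R : Set ℝ}
    {A : Fin n → Set ℝ} (h : CutAndChoose v w R (A a) (A b)) : IsSharing {a, b} R A where
  portion i hi := by
    rcases Finset.mem_insert.1 hi with rfl | hi
    exacts [h.1, Finset.mem_singleton.1 hi ▸ h.2.1]
  disjoint := by
    simp only [Finset.coe_insert, Finset.coe_singleton]
    exact (pairwiseDisjoint_insert.2 ⟨by simp, fun j hj _ => by
      rw [mem_singleton_iff.1 hj]; exact h.2.2.1⟩)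
  cover := by
    rw [Finset.set_biUnion_insert, Finset.set_biUnion_singleton]
    exact h.2.2.2.1

end CakeCutting

namespace CakeCutting

open Set

/-! ### Divide and Conquer: the number of envy-free-relations -/

/-- The degree of guaranteed envy-freeness of the divide-and-conquer protocols. -/
def dcCount (s : ℕ) : ℕ := s * Nat.log 2 s + 2 * s - 2 ^ (Nat.log 2 s + 1)

/-- The formulas for consecutive exponents agree at `2 ^ (l + 1)`. The closed upper end is needed
because half of a number below `2 ^ (l + 2)`, rounded up, can be `2 ^ (l + 1)`. -/
lemma dcCount_eq {s l : ℕ} (h1 : 2 ^ l ≤ s) (h2 : s ≤ 2 ^ (l + 1)) :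
    dcCount s = s * l + 2 * s - 2 ^ (l + 1) := by
  rcases h2.eq_or_lt with rfl | h
  · rw [dcCount, Nat.log_pow (by norm_num)]
    rw [mul_add, pow_succ 2 (l + 1)]
    omega
  · have hl := Nat.one_le_two_pow (n := l)
    rw [dcCount, (Nat.log_eq_iff (Or.inr ⟨by norm_num, by omega⟩)).2 ⟨h1, h⟩]

lemma dcCount_one : dcCount 1 = 0 := by simp [dcCount]

/-- If `s` has binary logarithm `l + 1`, both halves lie between `2 ^ l` and `2 ^ (l + 1)`, where
`dcCount_eq` gives one affine formula. -/
lemma dcCount_split {s : ℕ} (hs : 2 ≤ s) :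
    dcCount s = dcCount (s / 2) + dcCount (s - s / 2) + s := by
  obtain ⟨l, hl⟩ : ∃ l, Nat.log 2 s = l + 1 :=
    ⟨Nat.log 2 s - 1, by have := Nat.log_pos (by norm_num : 1 < 2) hs; omega⟩
  have h1 : 2 ^ (l + 1) ≤ s := hl ▸ Nat.pow_log_le_self 2 (by omega)
  have h2 : s < 2 ^ (l + 2) := by
    have := Nat.lt_pow_succ_log_self (by norm_num : 1 < 2) s
    rwa [hl] at this
  have e1 : 2 ^ (l + 1) = 2 * 2 ^ l := by ring
  have e2 : 2 ^ (l + 2) = 4 * 2 ^ l := by ring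
  rw [dcCount_eq h1 h2.le, dcCount_eq (s := s / 2) (l := l) (by omega) (by omega),
    dcCount_eq (s := s - s / 2) (l := l) (by omega) (by omega), e1, e2]
  have e3 : s * (l + 1) = s / 2 * l + (s - s / 2) * l + s := by
    rw [← add_mul, mul_add, mul_one]
    congr 2
    omega
  rw [e3]
  omega

/-! ### Divide and Conquer: guarantees -/

section guarantee

variable {n : ℕ} {V : Fin n → Valuation} {A : Fin n → Set ℝ}

/-- The guarantees of the divide-and-conquer protocols when the players in `N` share `R`. -/
structure DCGuarantee (V : Fin n → Valuation) (N : Finset (Fin n)) (R : Set ℝ)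
    (A : Fin n → Set ℝ) : Prop where
  sharing : IsSharing N R A
  fair : ∀ i ∈ N, V i R ≤ N.card * V i (A i)
  count : dcCount N.card ≤ ∑ i ∈ N, (unenvied V A i N).card

lemma DCGuarantee.single {p : Fin n} {R : Set ℝ} (hR : IsPortion R) (h : A p = R) :
    DCGuarantee V {p} R A := by
  subst h
  exact ⟨.singleton hR, by simp, by simp [dcCount_one]⟩

lemma fair_of_part {N M : Finset (Fin n)} {R R₁ : Set ℝ} (hM : M.Nonempty) {i : Fin n}
    (h : M.card * V i R ≤ N.card * V i R₁) (hi : V i R₁ ≤ M.card * V i (A i)) :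
    V i R ≤ N.card * V i (A i) := by
  have hM' : (0 : ℝ) < M.card := by exact_mod_cast hM.card_pos
  refine le_of_mul_le_mul_left (h.trans ?_) hM'
  calc (N.card : ℝ) * V i R₁ ≤ N.card * (M.card * V i (A i)) := by gcongr
    _ = _ := by ring

/-- For a player who finds `R₁` proportionally large, the portions inside `R₂` are on average worth
no more than a fair portion of `R₁`, hence no more than the own portion. This is independent of how
`M` shares `R₂`. -/
lemma unenvied_other_part {N M : Finset (Fin n)} {R R₁ R₂ : Set ℝ} (hN : N.Nonempty)
    (hM : M.Nonempty) (hd : Disjoint N M) (hM' : IsSharing M R₂ A) {i : Fin n} (hi : i ∈ N)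
    (hsum : V i R₁ + V i R₂ = V i R)
    (h : N.card * V i R ≤ (N.card + M.card : ℕ) * V i R₁) (hf : V i R₁ ≤ N.card * V i (A i)) :
    1 ≤ (unenvied V A i M).card := by
  have hN0 : (0 : ℝ) < N.card := by exact_mod_cast hN.card_pos
  refine one_le_card_unenvied (fun hiM => Finset.disjoint_left.1 hd hi hiM) hM ?_
  rw [hM'.sum_eq]
  push_cast at h
  have h1 : (N.card : ℝ) * V i R₂ ≤ M.card * V i R₁ := by
    rw [← hsum] at h
    linarith
  refine le_of_mul_le_mul_left (h1.trans ?_) hN0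
  calc (M.card : ℝ) * V i R₁ ≤ M.card * (N.card * V i (A i)) := by gcongr
    _ = _ := by ring

/-- The relations inside the parts are inherited, and `unenvied_other_part` adds one relation across
the split for each player. These are the summands of `dcCount_split`. -/
lemma DCGuarantee.split {N M : Finset (Fin n)} {R R₁ R₂ : Set ℝ}
    (hN : DCGuarantee V N R₁ A) (hM : DCGuarantee V M R₂ A) (hN0 : N.Nonempty)
    (hd : Disjoint N M) (hcard : N.card = (N.card + M.card) / 2)
    (hR : R₁ ∪ R₂ = R) (hRd : Disjoint R₁ R₂)
    (h1 : ∀ i ∈ N, N.card * V i R ≤ (N.card + M.card : ℕ) * V i R₁)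
    (h2 : ∀ i ∈ M, M.card * V i R ≤ (N.card + M.card : ℕ) * V i R₂) :
    DCGuarantee V (N ∪ M) R A := by
  have hNc := hN0.card_pos
  have hM0 : M.Nonempty := Finset.card_pos.1 (by omega)
  have hc : (N ∪ M).card = N.card + M.card := Finset.card_union_of_disjoint hd
  have hsum : ∀ i, V i R₁ + V i R₂ = V i R := fun i => by
    rw [← hR, (V i).additive _ _ hN.sharing.isPortion hM.sharing.isPortion hRd]
  refine ⟨hR ▸ hN.sharing.union hM.sharing hRd, fun i hi => ?_, ?_⟩
  · rcases Finset.mem_union.1 hi with hi | hi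
    · exact fair_of_part hN0 (hc ▸ h1 i hi) (hN.fair i hi)
    · exact fair_of_part hM0 (hc ▸ h2 i hi) (hM.fair i hi)
  · rw [hc, dcCount_split (by omega), ← hcard, Nat.add_sub_cancel_left,
      Finset.sum_union hd]
    have e1 : dcCount N.card + N.card ≤ ∑ i ∈ N, (unenvied V A i (N ∪ M)).card := by
      calc _ ≤ ∑ i ∈ N, (unenvied V A i N).card + ∑ i ∈ N, 1 := by
            simpa using hN.count
        _ ≤ _ := by
            rw [← Finset.sum_add_distrib]
            refine Finset.sum_le_sum fun i hi => ?_
            rw [card_unenvied_union hd]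
            gcongr
            exact unenvied_other_part hN0 hM0 hd hM.sharing hi (hsum i) (h1 i hi) (hN.fair i hi)
    have e2 : dcCount M.card + M.card ≤ ∑ i ∈ M, (unenvied V A i (N ∪ M)).card := by
      calc _ ≤ ∑ i ∈ M, (unenvied V A i M).card + ∑ i ∈ M, 1 := by
            simpa using hM.count
        _ ≤ _ := by
            rw [← Finset.sum_add_distrib]
            refine Finset.sum_le_sum fun i hi => ?_
            rw [card_unenvied_union hd, add_comm]
            gcongr
            refine unenvied_other_part hM0 hN0 hd.symm hN.sharing hi
              (by rw [add_comm]; exact hsum i) ?_ (hM.fair i hi)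
            rw [add_comm M.card]
            exact h2 i hi
    omega

lemma disjoint_inter_Iic_Ioi (R : Set ℝ) (x : ℝ) : Disjoint (R ∩ Iic x) (R ∩ Ioi x) :=
  Disjoint.mono inter_subset_right inter_subset_right
    (disjoint_left.2 fun _ hz hz' => absurd (mem_Ioi.1 hz') (not_lt.2 hz))

lemma inter_Iic_union_inter_Ioi (R : Set ℝ) (x : ℝ) : R ∩ Iic x ∪ R ∩ Ioi x = R := by
  rw [← inter_union_distrib_left, Iic_union_Ioi, inter_univ]

/-- Splitting at a knife position which every player finds acceptable. -/
lemma DCGuarantee.split_at {N N₁ N₂ : Finset (Fin n)} {R : Set ℝ} {x : ℝ}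
    (hR : IsPortion R) (hs : 2 ≤ N.card) (hN : N₁ ∪ N₂ = N) (hd : Disjoint N₁ N₂)
    (hcard : N₁.card = N.card / 2)
    (hN₁ : DCGuarantee V N₁ (R ∩ Iic x) A) (hN₂ : DCGuarantee V N₂ (R ∩ Ioi x) A)
    (h1 : ∀ i ∈ N₁, ((N.card / 2 : ℕ) : ℝ) / (N.card : ℝ) * V i R ≤ V i (R ∩ Iic x))
    (h2 : ∀ i ∈ N₂, V i (R ∩ Iic x) ≤ ((N.card / 2 : ℕ) : ℝ) / (N.card : ℝ) * V i R) :
    DCGuarantee V N R A := by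
  subst hN
  have hc : (N₁ ∪ N₂).card = N₁.card + N₂.card := Finset.card_union_of_disjoint hd
  rw [hc] at h1 h2 hcard hs
  have hpos : (0 : ℝ) < (N₁.card + N₂.card : ℕ) := Nat.cast_pos.2 (by omega)
  rw [← hcard] at h1 h2
  refine hN₁.split hN₂ (Finset.card_pos.1 (by omega)) hd hcard (inter_Iic_union_inter_Ioi R x)
    (disjoint_inter_Iic_Ioi R x) (fun i hi => ?_) fun i hi => ?_
  · have := h1 i hi
    rwa [div_mul_eq_mul_div, div_le_iff₀ hpos, mul_comm (V i _)] at this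
  · have := h2 i hi
    rw [div_mul_eq_mul_div, le_div_iff₀ hpos] at this
    have hv := (V i).inter_Ioi hR x
    push_cast at this ⊢
    rw [← hv] at this ⊢
    linarith

lemma DivideAndConquerRun.guarantee {N : Finset (Fin n)} {R : Set ℝ}
    (h : DivideAndConquerRun V N R A) (hR : IsPortion R) : DCGuarantee V N R A := by
  induction h with
  | single p R A h => exact .single hR h
  | left N R A e c B D cut hs he hc hBD hBDN hB hcut hBc hcD hcond _ _ ih1 ih2 =>
    have heB : e ∉ B ∪ D := by simp [hBDN]
    have hcB : c ∉ B ∪ D := by simp [hBDN]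
    have hce : c ≠ e := (Finset.mem_erase.1 hc).1
    simp only [Finset.mem_union, not_or] at heB hcB
    refine .split_at (N₁ := insert e B) (N₂ := insert c D) (x := cut c) hR hs ?_ ?_ ?_
      (ih1 (hR.inter_ordConnected ordConnected_Iic)) (ih2 (hR.inter_ordConnected ordConnected_Ioi))
      ?_ ?_
    · rw [Finset.insert_union, Finset.union_insert, hBDN, Finset.insert_erase hc,
        Finset.insert_erase he]
    · rw [Finset.disjoint_insert_left, Finset.disjoint_insert_right, Finset.mem_insert]
      exact ⟨by tauto, hcB.1, hBD⟩
    · rw [Finset.card_insert_of_notMem heB.1, hB]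
    -- A member of `B` cut no further to the right than `c` did, so the left part contains what that
    -- member cut off. For the noncutter the inequality is the condition of the protocol.
    · intro i hi
      rcases Finset.mem_insert.1 hi with rfl | hi
      · exact hcond
      · rw [← hcut i]
        · exact (V i).inter_Iic_mono hR (hBc i hi)
        · exact Finset.mem_of_mem_erase (hBDN ▸ Finset.mem_union_left _ hi)
    · intro i hi
      rcases Finset.mem_insert.1 hi with rfl | hi
      · exact (hcut i hc).le
      · rw [← hcut i]
        · exact (V i).inter_Iic_mono hR (hcD i hi)
        · exact Finset.mem_of_mem_erase (hBDN ▸ Finset.mem_union_right _ hi)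
  | right N R A e c B D cut hs he hc hBD hBDN hB hcut hBc hcD hcond _ _ ih1 ih2 =>
    have heB : e ∉ B ∪ D := by simp [hBDN]
    have hcB : c ∉ B ∪ D := by simp [hBDN]
    have hce : c ≠ e := (Finset.mem_erase.1 hc).1
    simp only [Finset.mem_union, not_or] at heB hcB
    refine .split_at (N₁ := insert c B) (N₂ := insert e D) (x := cut c) hR hs ?_ ?_ ?_
      (ih1 (hR.inter_ordConnected ordConnected_Iic)) (ih2 (hR.inter_ordConnected ordConnected_Ioi))
      ?_ ?_
    · rw [Finset.insert_union, Finset.union_insert, hBDN, Finset.insert_comm,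
        Finset.insert_erase hc, Finset.insert_erase he]
    · rw [Finset.disjoint_insert_left, Finset.disjoint_insert_right, Finset.mem_insert]
      exact ⟨by tauto, heB.1, hBD⟩
    · rw [Finset.card_insert_of_notMem hcB.1, hB]
    · intro i hi
      rcases Finset.mem_insert.1 hi with rfl | hi
      · exact (hcut i hc).ge
      · rw [← hcut i]
        · exact (V i).inter_Iic_mono hR (hBc i hi)
        · exact Finset.mem_of_mem_erase (hBDN ▸ Finset.mem_union_left _ hi)
    · intro i hi
      rcases Finset.mem_insert.1 hi with rfl | hi
      -- The noncutter's condition concerns the right part; complementation turns it into an upper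
      -- bound for the left part.
      · have hv := (V i).inter_Ioi hR (cut c)
        have hpos : (N.card : ℝ) ≠ 0 := by positivity
        rw [Nat.cast_sub (Nat.div_le_self _ _), sub_div, div_self hpos] at hcond
        linarith
      · rw [← hcut i]
        · exact (V i).inter_Iic_mono hR (hcD i hi)
        · exact Finset.mem_of_mem_erase (hBDN ▸ Finset.mem_union_right _ hi)

lemma MinimalEnvyRun.guarantee {N : Finset (Fin n)} {R : Set ℝ}
    (h : MinimalEnvyRun V N R A) (hR : IsPortion R) : DCGuarantee V N R A := by
  induction h with
  | single p R A h => exact .single hR h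
  | split N R A B D c c' cut s hs hBD hBDN hB hcut _ _ hBc hcD hsp _ _ ih1 ih2 =>
    have h1 : cut c ≤ s := by rcases hsp with h | h; exacts [h.1.le, h.1.le]
    have h2 : s ≤ cut c' := by rcases hsp with h | h; exacts [h.2.le, h.2.le]
    refine .split_at hR hs hBDN hBD hB (ih1 (hR.inter_ordConnected ordConnected_Iic))
      (ih2 (hR.inter_ordConnected ordConnected_Ioi)) (fun i hi => ?_) fun i hi => ?_
    · rw [← hcut i (hBDN ▸ Finset.mem_union_left _ hi)]
      exact (V i).inter_Iic_mono hR ((hBc i hi).trans h1)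
    · rw [← hcut i (hBDN ▸ Finset.mem_union_right _ hi)]
      exact (V i).inter_Iic_mono hR (h2.trans (hcD i hi))

/-! ### Divide and Conquer: existence of runs -/

/-- A run constrains `A` only at the players of `N`, so allocations found separately for the two
sides of a split can be glued. -/
lemma DivideAndConquerRun.congr {N : Finset (Fin n)} {R : Set ℝ} {A' : Fin n → Set ℝ}
    (h : DivideAndConquerRun V N R A) (hA : ∀ i ∈ N, A i = A' i) :
    DivideAndConquerRun V N R A' := by
  induction h with
  | single p R A h => exact .single p R A' (by rw [← hA p (by simp), h])
  | left N R A e c B D cut hs he hc hBD hBDN hB hcut hBc hcD hcond _ _ ih1 ih2 =>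
    have hsub : B ∪ D ⊆ N := hBDN ▸ (Finset.erase_subset _ _).trans (Finset.erase_subset _ _)
    exact .left N R A' e c B D cut hs he hc hBD hBDN hB hcut hBc hcD hcond
      (ih1 fun i hi => hA i (Finset.insert_subset he (Finset.union_subset_left hsub) hi))
      (ih2 fun i hi => hA i (Finset.insert_subset (Finset.mem_of_mem_erase hc)
        (Finset.union_subset_right hsub) hi))
  | right N R A e c B D cut hs he hc hBD hBDN hB hcut hBc hcD hcond _ _ ih1 ih2 =>
    have hsub : B ∪ D ⊆ N := hBDN ▸ (Finset.erase_subset _ _).trans (Finset.erase_subset _ _)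
    exact .right N R A' e c B D cut hs he hc hBD hBDN hB hcut hBc hcD hcond
      (ih1 fun i hi => hA i (Finset.insert_subset (Finset.mem_of_mem_erase hc)
        (Finset.union_subset_left hsub) hi))
      (ih2 fun i hi => hA i (Finset.insert_subset he (Finset.union_subset_right hsub) hi))

lemma MinimalEnvyRun.congr {N : Finset (Fin n)} {R : Set ℝ} {A' : Fin n → Set ℝ}
    (h : MinimalEnvyRun V N R A) (hA : ∀ i ∈ N, A i = A' i) : MinimalEnvyRun V N R A' := by
  induction h with
  | single p R A h => exact .single p R A' (by rw [← hA p (by simp), h])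
  | split N R A B D c c' cut s hs hBD hBDN hB hcut hc hc' hBc hcD hsp _ _ ih1 ih2 =>
    exact .split N R A' B D c c' cut s hs hBD hBDN hB hcut hc hc' hBc hcD hsp
      (ih1 fun i hi => hA i (hBDN ▸ Finset.mem_union_left _ hi))
      (ih2 fun i hi => hA i (hBDN ▸ Finset.mem_union_right _ hi))

/-- There is an element of given rank with respect to a real-valued function. -/
lemma exists_rank {α : Type*} [DecidableEq α] (f : α → ℝ) (r : ℕ) (S : Finset α)
    (hr : r < S.card) : ∃ c ∈ S, ∃ B D : Finset α, Disjoint B D ∧ B ∪ D = S.erase c ∧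
      B.card = r ∧ (∀ b ∈ B, f b ≤ f c) ∧ ∀ b ∈ D, f c ≤ f b := by
  induction r generalizing S with
  | zero =>
    obtain ⟨c, hc, hmin⟩ := S.exists_min_image f (Finset.card_pos.1 hr)
    exact ⟨c, hc, ∅, S.erase c, by simp, by simp, rfl, by simp,
      fun b hb => hmin b (Finset.mem_of_mem_erase hb)⟩
  | succ r ih =>
    obtain ⟨a, ha, hmin⟩ := S.exists_min_image f (Finset.card_pos.1 (by omega))
    obtain ⟨c, hc, B, D, hd, hBD, hB, hBc, hcD⟩ := ih (S.erase a)
      (by rw [Finset.card_erase_of_mem ha]; omega)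
    have hca := (Finset.mem_erase.1 hc).1
    have haBD : a ∉ B ∪ D := by simp [hBD]
    rw [Finset.mem_union, not_or] at haBD
    refine ⟨c, Finset.mem_of_mem_erase hc, insert a B, D, ?_, ?_, ?_, ?_, hcD⟩
    · exact Finset.disjoint_insert_left.2 ⟨haBD.2, hd⟩
    · rw [Finset.insert_union, hBD, Finset.erase_right_comm, Finset.insert_erase]
      exact Finset.mem_erase.2 ⟨hca.symm, ha⟩
    · rw [Finset.card_insert_of_notMem haBD.1, hB]
    · intro b hb
      rcases Finset.mem_insert.1 hb with rfl | hb
      exacts [hmin c (Finset.mem_of_mem_erase hc), hBc b hb]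

lemma exists_cut_function (V : Fin n → Valuation) {R : Set ℝ} (hR : IsPortion R) (s k : ℕ)
    (hks : k ≤ s) : ∃ cut : Fin n → ℝ, ∀ i, V i (R ∩ Iic (cut i)) = (k : ℝ) / (s : ℝ) * V i R := by
  have : ∀ i, ∃ x, V i (R ∩ Iic x) = (k : ℝ) / (s : ℝ) * V i R := fun i => by
    have h := (V i).nonneg hR
    obtain ⟨x, -, hx⟩ := (V i).exists_cut hR (α := (k : ℝ) / (s : ℝ) * V i R) (by positivity)
      (mul_le_of_le_one_left h (div_le_one_of_le₀ (by exact_mod_cast hks) (Nat.cast_nonneg _)))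
    exact ⟨x, hx⟩
  choose cut hcut using this
  exact ⟨cut, hcut⟩

lemma exists_divideAndConquerRun (V : Fin n → Valuation) (s : ℕ) (N : Finset (Fin n))
    (hs : N.card = s) (hN : N.Nonempty) {R : Set ℝ} (hR : IsPortion R) :
    ∃ A, DivideAndConquerRun V N R A := by
  classical
  induction s using Nat.strong_induction_on generalizing N R with
  | _ s ih =>
  rcases Nat.lt_or_ge N.card 2 with h | h
  · have := hN.card_pos
    obtain ⟨p, rfl⟩ := Finset.card_eq_one.1 (by omega : N.card = 1)
    exact ⟨fun _ => R, .single p R _ rfl⟩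
  obtain ⟨e, he⟩ := hN
  obtain ⟨cut, hcut⟩ := exists_cut_function V hR N.card (N.card / 2) (Nat.div_le_self _ _)
  have hce := Finset.card_erase_of_mem he
  obtain ⟨c, hc, B, D, hd, hBD, hB, hBc, hcD⟩ := exists_rank cut (N.card / 2 - 1) (N.erase e)
    (by omega)
  have heB : e ∉ B ∪ D := by simp [hBD]
  have hcB : c ∉ B ∪ D := by simp [hBD]
  have hcne : c ≠ e := (Finset.mem_erase.1 hc).1
  have hcards : B.card + D.card = N.card - 2 := by
    rw [← Finset.card_union_of_disjoint hd, hBD, Finset.card_erase_of_mem hc, hce]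
    omega
  rw [Finset.mem_union, not_or] at heB hcB
  have h1 := hR.inter_ordConnected (T := Iic (cut c)) ordConnected_Iic
  have h2 := hR.inter_ordConnected (T := Ioi (cut c)) ordConnected_Ioi
  have hv := (V e).inter_Ioi hR (cut c)
  have hpos : (N.card : ℝ) ≠ 0 := by positivity
  -- Stated for two arbitrary players, since the noncutter `e` and the cutter `c` may go to either
  -- side.
  have glue : ∀ x y, x ∉ B → x ∉ D → y ∉ B → y ∉ D → x ≠ y →
      ∃ A, DivideAndConquerRun V (insert x B) (R ∩ Iic (cut c)) A ∧
        DivideAndConquerRun V (insert y D) (R ∩ Ioi (cut c)) A := by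
    intro x y hxB hxD hyB hyD hxy
    obtain ⟨A₁, hA₁⟩ := ih (insert x B).card (by rw [Finset.card_insert_of_notMem hxB]; omega)
      (insert x B) rfl (Finset.insert_nonempty _ _) h1
    obtain ⟨A₂, hA₂⟩ := ih (insert y D).card (by rw [Finset.card_insert_of_notMem hyD]; omega)
      (insert y D) rfl (Finset.insert_nonempty _ _) h2
    refine ⟨fun i => if i ∈ insert x B then A₁ i else A₂ i,
      hA₁.congr fun i hi => (if_pos hi).symm, hA₂.congr fun i hi => (if_neg fun h => ?_).symm⟩
    rcases Finset.mem_insert.1 h with rfl | h <;> rcases Finset.mem_insert.1 hi with rfl | hi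
    exacts [hxy rfl, hxD hi, hyB h, Finset.disjoint_left.1 hd h hi]
  -- If the left part is too small for the noncutter, the right part is large enough.
  rcases le_or_gt (((N.card / 2 : ℕ) : ℝ) / (N.card : ℝ) * V e R) (V e (R ∩ Iic (cut c)))
    with hle | hlt
  · obtain ⟨A, hA₁, hA₂⟩ := glue e c heB.1 heB.2 hcB.1 hcB.2 hcne.symm
    exact ⟨A, .left N R A e c B D cut h he hc hd hBD (by omega) (fun i _ => hcut i) hBc hcD hle
      hA₁ hA₂⟩
  · obtain ⟨A, hA₁, hA₂⟩ := glue c e hcB.1 hcB.2 heB.1 heB.2 hcne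
    refine ⟨A, .right N R A e c B D cut h he hc hd hBD (by omega) (fun i _ => hcut i) hBc hcD ?_
      hA₁ hA₂⟩
    rw [Nat.cast_sub (Nat.div_le_self _ _), sub_div, div_self hpos]
    linarith

lemma exists_minimalEnvyRun (V : Fin n → Valuation) (s : ℕ) (N : Finset (Fin n))
    (hs : N.card = s) (hN : N.Nonempty) {R : Set ℝ} (hR : IsPortion R) :
    ∃ A, MinimalEnvyRun V N R A := by
  classical
  induction s using Nat.strong_induction_on generalizing N R with
  | _ s ih =>
  rcases Nat.lt_or_ge N.card 2 with h | h
  · have := hN.card_pos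
    obtain ⟨p, rfl⟩ := Finset.card_eq_one.1 (by omega : N.card = 1)
    exact ⟨fun _ => R, .single p R _ rfl⟩
  obtain ⟨cut, hcut⟩ := exists_cut_function V hR N.card (N.card / 2) (Nat.div_le_self _ _)
  obtain ⟨c, hc, B, D, hd, hBD, hB, hBc, hcD⟩ := exists_rank cut (N.card / 2 - 1) N (by omega)
  have hcB : c ∉ B ∪ D := by simp [hBD]
  have hcards : B.card + D.card = N.card - 1 := by
    rw [← Finset.card_union_of_disjoint hd, hBD, Finset.card_erase_of_mem hc]
  rw [Finset.mem_union, not_or] at hcB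
  have hd' : Disjoint (insert c B) D := Finset.disjoint_insert_left.2 ⟨hcB.2, hd⟩
  obtain ⟨c', hc', hmin⟩ := D.exists_min_image cut (Finset.card_pos.1 (by omega))
  obtain ⟨x, hx⟩ : ∃ x, cut c < x ∧ x < cut c' ∨ cut c = x ∧ x = cut c' := by
    rcases (hcD c' hc').lt_or_eq with h | h
    · obtain ⟨x, hx⟩ := exists_between h
      exact ⟨x, Or.inl hx⟩
    · exact ⟨_, Or.inr ⟨rfl, h⟩⟩
  have hcB' : (insert c B).card = N.card / 2 := by
    rw [Finset.card_insert_of_notMem hcB.1]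
    omega
  obtain ⟨A₁, hA₁⟩ := ih (insert c B).card (by omega) (insert c B) rfl
    (Finset.insert_nonempty _ _) (hR.inter_ordConnected (T := Iic x) ordConnected_Iic)
  obtain ⟨A₂, hA₂⟩ := ih D.card (by omega) D rfl ⟨c', hc'⟩
    (hR.inter_ordConnected (T := Ioi x) ordConnected_Ioi)
  refine ⟨fun i => if i ∈ insert c B then A₁ i else A₂ i,
    .split N R _ (insert c B) D c c' cut x h hd' ?_ hcB' (fun i _ => hcut i)
    (Finset.mem_insert_self _ _) hc' ?_ hmin hx (hA₁.congr fun i hi => (if_pos hi).symm)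
    (hA₂.congr fun i hi => (if_neg fun h => Finset.disjoint_left.1 hd' h hi).symm)⟩
  · rw [Finset.insert_union, hBD, Finset.insert_erase hc]
  · intro b hb
    rcases Finset.mem_insert.1 hb with rfl | hb
    exacts [le_rfl, hBc b hb]

lemma DCGuarantee.conclusion (hn : 0 < n) (h : DCGuarantee V Finset.univ cake A) :
    (IsSharing Finset.univ cake A ∧ ∀ i, 1 / (n : ℝ) ≤ V i (A i)) ∧
      dcCount n ≤ envyFreeCount V A := by
  refine ⟨⟨h.sharing, fun i => ?_⟩, ?_⟩
  · have := h.fair i (Finset.mem_univ i)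
    rw [(V i).normalized, Finset.card_univ, Fintype.card_fin] at this
    rw [div_le_iff₀ (by positivity)]
    linarith
  · have := h.count
    rwa [Finset.card_univ, Fintype.card_fin, ← envyFreeCount_eq_sum] at this

end guarantee

end CakeCutting

namespace CakeCutting

open Set

/-! ### Valuations given by weights of `n` equal intervals -/

lemma exists_gridValuations {n K : ℕ} (hK : 0 < K) (w : Fin n → ℕ → ℝ)
    (hw : ∀ i, ∀ b < K, 0 < w i b) (h1 : ∀ i, ∑ b ∈ Finset.range K, w i b = 1) :
    ∃ V : Fin n → Valuation, ∀ i, ∀ s ⊆ Finset.range K,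
      V i (cells (gridIndex K) s) = ∑ b ∈ s, w i b :=
  ⟨fun i => gridValuation K (w i) hK (hw i) (h1 i), fun i _ hs =>
    gridValuation_cells hK (hw i) (h1 i) hs⟩

/-- Player `i` gets the `i`-th of `n` intervals of equal length. -/
noncomputable def blockAllocation (n : ℕ) (i : Fin n) : Set ℝ := cells (gridIndex n) {i.val}

lemma gridCells_inter_Iic {K a b c : ℕ} (hK : 0 < K) (hc : 0 < c) (hcb : c ≤ b) :
    cells (gridIndex K) (Finset.Ico a b) ∩ Iic ((c : ℝ) / K) =
      cells (gridIndex K) (Finset.Ico a c) := by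
  ext x
  simp only [mem_inter_iff, mem_cells, Finset.mem_Ico, mem_Iic, ← gridIndex_lt_iff_le_div hK hc]
  constructor
  · exact fun h => ⟨h.1.1, h.1.2.1, h.2⟩
  · exact fun h => ⟨⟨h.1, h.2.1, h.2.2.trans_le hcb⟩, h.2.2⟩

lemma gridCells_inter_Ioi {K a b c : ℕ} (hK : 0 < K) (hc : 0 < c) (hac : a ≤ c) :
    cells (gridIndex K) (Finset.Ico a b) ∩ Ioi ((c : ℝ) / K) =
      cells (gridIndex K) (Finset.Ico c b) := by
  ext x
  rw [mem_inter_iff, mem_Ioi, ← not_le, ← gridIndex_lt_iff_le_div hK hc, not_lt]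
  simp only [mem_cells, Finset.mem_Ico]
  constructor
  · exact fun h => ⟨h.1.1, h.2, h.1.2.2⟩
  · exact fun h => ⟨⟨h.1, hac.trans h.2.1, h.2.2⟩, h.2.1⟩

/-! ### Divide and Conquer: an example with few envy-free-relations -/

/-- Deviation from the average of the value that the `i`-th of `s` players assigns to the `j`-th
interval: on the other side of every split one interval is worth less than the average, and the
others are worth more. -/
def dcDev (s i j : ℕ) : ℤ :=
  if s < 2 then 0
  else if i < s / 2 then
    if j < s / 2 then dcDev (s / 2) i j
    else if j = s / 2 then 1 - (s - s / 2 : ℕ) else 1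
  else
    if j < s / 2 then (if j = 0 then 1 - (s / 2 : ℕ) else 1)
    else dcDev (s - s / 2) (i - s / 2) (j - s / 2)
termination_by s
decreasing_by all_goals omega

lemma dcDev_of_lt_two {s i j : ℕ} (hs : s < 2) : dcDev s i j = 0 := by
  rw [dcDev, if_pos hs]

lemma dcDev_left_left {s i j : ℕ} (hs : 2 ≤ s) (hi : i < s / 2) (hj : j < s / 2) :
    dcDev s i j = dcDev (s / 2) i j := by
  rw [dcDev, if_neg (by omega), if_pos hi, if_pos hj]

lemma dcDev_left_right {s i j : ℕ} (hs : 2 ≤ s) (hi : i < s / 2) :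
    dcDev s i (s / 2 + j) = if j = 0 then 1 - ((s - s / 2 : ℕ) : ℤ) else 1 := by
  rw [dcDev, if_neg (by omega), if_pos hi, if_neg (by omega)]
  simp

lemma dcDev_right_left {s i j : ℕ} (hs : 2 ≤ s) (hj : j < s / 2) :
    dcDev s (s / 2 + i) j = if j = 0 then 1 - ((s / 2 : ℕ) : ℤ) else 1 := by
  rw [dcDev, if_neg (by omega), if_neg (by omega), if_pos hj]

lemma dcDev_right_right {s i j : ℕ} (hs : 2 ≤ s) :
    dcDev s (s / 2 + i) (s / 2 + j) = dcDev (s - s / 2) i j := by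
  rw [dcDev, if_neg (by omega), if_neg (by omega), if_neg (by omega), Nat.add_sub_cancel_left,
    Nat.add_sub_cancel_left]

lemma sum_ite_zero_dev {t : ℕ} (ht : 0 < t) :
    ∑ j ∈ Finset.range t, (if j = 0 then 1 - (t : ℤ) else 1) = 0 := by
  obtain ⟨t, rfl⟩ : ∃ m, t = m + 1 := ⟨t - 1, by omega⟩
  rw [Finset.sum_range_succ']
  simp

/-- The total must vanish for the weights to sum to `1`. The sum over the first half must vanish so
that all players cut at the same block boundary. -/
lemma sum_dcDev {s i : ℕ} (hi : i < s) : ∑ j ∈ Finset.range s, dcDev s i j = 0 ∧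
    (2 ≤ s → ∑ j ∈ Finset.range (s / 2), dcDev s i j = 0) := by
  induction s using Nat.strong_induction_on generalizing i with
  | _ s ih =>
  rcases Nat.lt_or_ge s 2 with hs | hs
  · exact ⟨Finset.sum_eq_zero fun j _ => dcDev_of_lt_two hs, fun h => by omega⟩
  have key : ∑ j ∈ Finset.range (s / 2), dcDev s i j = 0 ∧
      ∑ j ∈ Finset.range (s - s / 2), dcDev s i (s / 2 + j) = 0 := by
    rcases Nat.lt_or_ge i (s / 2) with h | h
    · constructor
      · rw [← (ih (s / 2) (by omega) h).1]
        exact Finset.sum_congr rfl fun j hj => dcDev_left_left hs h (Finset.mem_range.1 hj)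
      · rw [← sum_ite_zero_dev (t := s - s / 2) (by omega)]
        exact Finset.sum_congr rfl fun j _ => dcDev_left_right hs h
    · obtain ⟨i, rfl⟩ := Nat.exists_eq_add_of_le h
      constructor
      · rw [← sum_ite_zero_dev (t := s / 2) (by omega)]
        exact Finset.sum_congr rfl fun j hj => dcDev_right_left hs (Finset.mem_range.1 hj)
      · rw [← (ih (s - s / 2) (by omega) (i := i) (by omega)).1]
        exact Finset.sum_congr rfl fun j _ => dcDev_right_right hs
  refine ⟨?_, fun _ => key.1⟩
  have h := Finset.sum_range_add (dcDev s i) (s / 2) (s - s / 2)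
  rw [Nat.add_sub_cancel' (Nat.div_le_self _ _)] at h
  rw [h, key.1, key.2, add_zero]

lemma neg_le_dcDev (s i j : ℕ) : -(s : ℤ) ≤ dcDev s i j := by
  induction s using Nat.strong_induction_on generalizing i j with
  | _ s ih =>
  rcases Nat.lt_or_ge s 2 with hs | hs
  · rw [dcDev_of_lt_two hs]
    omega
  · have h1 := ih (s / 2) (by omega) i j
    have h2 := ih (s - s / 2) (by omega) (i - s / 2) (j - s / 2)
    rw [dcDev, if_neg (by omega)]
    split_ifs <;> omega

lemma dcDev_self (s i : ℕ) : dcDev s i i = 0 := by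
  induction s using Nat.strong_induction_on generalizing i with
  | _ s ih =>
  rcases Nat.lt_or_ge s 2 with hs | hs
  · exact dcDev_of_lt_two hs
  · rw [dcDev, if_neg (by omega)]
    split_ifs
    · exact ih _ (by omega) _
    · exact ih _ (by omega) _

lemma sum_ite_zero_nonpos {t : ℕ} (ht : 0 < t) :
    ∑ j ∈ Finset.range t, (if (if j = 0 then 1 - (t : ℤ) else 1) ≤ 0 then 1 else 0) = 1 := by
  obtain ⟨t, rfl⟩ : ∃ m, t = m + 1 := ⟨t - 1, by omega⟩
  rw [Finset.sum_range_succ']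
  simp

/-- Every row has exactly one nonpositive entry on the other side of the split, which is the
recursion of `dcCount_split`. The extra `s` counts the zero diagonal. -/
lemma count_dcDev (s : ℕ) (hs : 0 < s) :
    ∑ i ∈ Finset.range s, ∑ j ∈ Finset.range s, (if dcDev s i j ≤ 0 then 1 else 0) =
      dcCount s + s := by
  induction s using Nat.strong_induction_on with
  | _ s ih =>
  rcases Nat.lt_or_ge s 2 with h | h
  · obtain rfl : s = 1 := by omega
    simp [dcDev_of_lt_two, dcCount_one]
  have hsplit : ∀ f : ℕ → ℕ, ∑ i ∈ Finset.range s, f i =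
      ∑ i ∈ Finset.range (s / 2), f i + ∑ i ∈ Finset.range (s - s / 2), f (s / 2 + i) := by
    intro f
    rw [← Finset.sum_range_add, Nat.add_sub_cancel' (Nat.div_le_self _ _)]
  have e1 : ∑ i ∈ Finset.range (s / 2), ∑ j ∈ Finset.range s, (if dcDev s i j ≤ 0 then 1 else 0)
      = dcCount (s / 2) + s / 2 + s / 2 := by
    rw [← ih (s / 2) (by omega) (by omega)]
    -- The last `s / 2` becomes a sum of ones: one entry of the other half for each row.
    nth_rw 6 [← Finset.card_range (s / 2)]
    rw [Finset.card_eq_sum_ones, ← Finset.sum_add_distrib]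
    refine Finset.sum_congr rfl fun i hi => ?_
    rw [hsplit]
    congr 1
    · refine Finset.sum_congr rfl fun j hj => ?_
      rw [dcDev_left_left h (Finset.mem_range.1 hi) (Finset.mem_range.1 hj)]
    · refine Eq.trans ?_ (sum_ite_zero_nonpos (t := s - s / 2) (by omega))
      refine Finset.sum_congr rfl fun j _ => ?_
      rw [dcDev_left_right h (Finset.mem_range.1 hi)]
  have e2 : ∑ i ∈ Finset.range (s - s / 2), ∑ j ∈ Finset.range s,
      (if dcDev s (s / 2 + i) j ≤ 0 then 1 else 0)
      = dcCount (s - s / 2) + (s - s / 2) + (s - s / 2) := by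
    rw [← ih (s - s / 2) (by omega) (by omega)]
    have : s - s / 2 = ∑ i ∈ Finset.range (s - s / 2), 1 := by simp
    conv_rhs => rw [add_comm]; arg 1; rw [this]
    rw [← Finset.sum_add_distrib]
    refine Finset.sum_congr rfl fun i hi => ?_
    rw [hsplit]
    congr 1
    · refine Eq.trans ?_ (sum_ite_zero_nonpos (t := s / 2) (by omega))
      refine Finset.sum_congr rfl fun j hj => ?_
      rw [dcDev_right_left h (Finset.mem_range.1 hj)]
    · refine Finset.sum_congr rfl fun j _ => ?_
      rw [dcDev_right_right h]
  rw [hsplit, e1, e2, dcCount_split h]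
  omega

section tightValuations

variable {n : ℕ} {V : Fin n → Valuation}

/-- The players `a, …, a + s - 1`. -/
def playersFrom (n a s : ℕ) : Finset (Fin n) := {i : Fin n | a ≤ i.val ∧ i.val < a + s}

lemma mem_playersFrom {a s : ℕ} {i : Fin n} :
    i ∈ playersFrom n a s ↔ a ≤ i.val ∧ i.val < a + s := by
  simp [playersFrom]

lemma card_playersFrom {a s : ℕ} (h : a + s ≤ n) : (playersFrom n a s).card = s := by
  have : (playersFrom n a s).map Fin.valEmbedding = Finset.Ico a (a + s) := by
    ext b
    simp only [Finset.mem_map, mem_playersFrom, Fin.valEmbedding_apply, Finset.mem_Ico]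
    constructor
    · rintro ⟨i, hi, rfl⟩
      exact hi
    · exact fun hb => ⟨⟨b, by omega⟩, hb, rfl⟩
  rw [← Finset.card_map Fin.valEmbedding, this, Nat.card_Ico, Nat.add_sub_cancel_left]

lemma playersFrom_split {a s k : ℕ} (hk : k ≤ s) :
    playersFrom n a k ∪ playersFrom n (a + k) (s - k) = playersFrom n a s := by
  ext i
  simp only [Finset.mem_union, mem_playersFrom]
  omega

lemma disjoint_playersFrom {a s k : ℕ} :
    Disjoint (playersFrom n a k) (playersFrom n (a + k) (s - k)) := by
  refine Finset.disjoint_left.2 fun i hi hi' => ?_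
  rw [mem_playersFrom] at hi hi'
  omega

/-- The weights are described relative to the block starting at `a`, so both halves are again
instances of the hypothesis. All cuts fall on the boundary `(a + k) / n`, and since ties may be
ordered at will, the first `k` players can go left. -/
lemma dc_example_runs {η : ℝ} {w : ℕ → ℕ → ℝ}
    (hV : ∀ i : Fin n, ∀ s ⊆ Finset.range n,
      V i (cells (gridIndex n) s) = ∑ b ∈ s, w i b)
    (s : ℕ) (hs : 0 < s) (a : ℕ) (has : a + s ≤ n)
    (hw : ∀ i < s, ∀ j < s, w (a + i) (a + j) = 1 / n + η * dcDev s i j) :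
    DivideAndConquerRun V (playersFrom n a s) (cells (gridIndex n) (Finset.Ico a (a + s)))
      (blockAllocation n) ∧
    MinimalEnvyRun V (playersFrom n a s) (cells (gridIndex n) (Finset.Ico a (a + s)))
      (blockAllocation n) := by
  induction s using Nat.strong_induction_on generalizing a with
  | _ s ih =>
  have hn : 0 < n := by omega
  have hn' : (n : ℝ) ≠ 0 := by positivity
  rcases Nat.lt_or_ge s 2 with h | h
  · obtain rfl : s = 1 := by omega
    have h1 : playersFrom n a 1 = {⟨a, by omega⟩} := by
      ext i
      rw [mem_playersFrom, Finset.mem_singleton, Fin.ext_iff]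
      simp only
      omega
    rw [h1]
    have h2 : blockAllocation n ⟨a, by omega⟩ =
        cells (gridIndex n) (Finset.Ico a (a + 1)) := by
      rw [Nat.Ico_succ_singleton, blockAllocation]
    exact ⟨.single _ _ _ h2, .single _ _ _ h2⟩
  set k := s / 2 with hk
  have hk0 : 0 < k := by omega
  have hks : k < s := by omega
  have hak : a + k + (s - k) = a + s := by omega
  have ih1 := ih k hks hk0 a (by omega) fun i hi j hj => by
    rw [hw i (by omega) j (by omega), dcDev_left_left h hi hj]
  have ih2 := ih (s - k) (by omega) (by omega) (a + k) (by omega) fun i hi j hj => by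
    rw [add_assoc, add_assoc, hw (k + i) (by omega) (k + j) (by omega), dcDev_right_right h]
  rw [hak] at ih2
  have hIic : cells (gridIndex n) (Finset.Ico a (a + s)) ∩ Iic (((a + k : ℕ) : ℝ) / n) =
      cells (gridIndex n) (Finset.Ico a (a + k)) := gridCells_inter_Iic hn (by omega) (by omega)
  have hIoi : cells (gridIndex n) (Finset.Ico a (a + s)) ∩ Ioi (((a + k : ℕ) : ℝ) / n) =
      cells (gridIndex n) (Finset.Ico (a + k) (a + s)) :=
    gridCells_inter_Ioi hn (by omega) (by omega)
  have hval : ∀ i ∈ playersFrom n a s, ∀ t ≤ s,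
      ∑ j ∈ Finset.range t, dcDev s (i.val - a) j = 0 →
      V i (cells (gridIndex n) (Finset.Ico a (a + t))) = (t : ℝ) / n := by
    intro i hi t ht hsum
    rw [mem_playersFrom] at hi
    rw [hV i _ fun b hb => by rw [Finset.mem_Ico] at hb; exact Finset.mem_range.2 (by omega),
      Finset.sum_Ico_eq_sum_range, Nat.add_sub_cancel_left]
    have : ∀ j ∈ Finset.range t, w i (a + j) = 1 / n + η * dcDev s (i.val - a) j := by
      intro j hj
      rw [Finset.mem_range] at hj
      rw [← hw (i.val - a) (by omega) j (by omega), Nat.add_sub_cancel' hi.1]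
    rw [Finset.sum_congr rfl this, Finset.sum_add_distrib, ← Finset.mul_sum, ← Int.cast_sum, hsum]
    simp [div_eq_mul_inv]
  have hcard : (playersFrom n a s).card = s := card_playersFrom has
  have hratio : ∀ i ∈ playersFrom n a s,
      V i (cells (gridIndex n) (Finset.Ico a (a + s)) ∩ Iic (((a + k : ℕ) : ℝ) / n)) =
        (((playersFrom n a s).card / 2 : ℕ) : ℝ) / ((playersFrom n a s).card : ℝ) *
          V i (cells (gridIndex n) (Finset.Ico a (a + s))) := by
    intro i hi
    have hi' := mem_playersFrom.1 hi
    have hsum := sum_dcDev (s := s) (i := i.val - a) (by omega)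
    rw [hIic, hval i hi k hks.le (hsum.2 h), hval i hi s le_rfl hsum.1, hcard, ← hk]
    have : (s : ℝ) ≠ 0 := by positivity
    field_simp
  have hck : (playersFrom n a k).card = k := card_playersFrom (by omega)
  have hdisj : Disjoint (playersFrom n a k) (playersFrom n (a + k) (s - k)) :=
    disjoint_playersFrom
  have hunion := playersFrom_split (n := n) (a := a) hks.le
  let e : Fin n := ⟨a, by omega⟩
  let c : Fin n := ⟨a + k, by omega⟩
  have he : e ∈ playersFrom n a k := mem_playersFrom.2 ⟨le_rfl, by simp only [e]; omega⟩
  have hc : c ∈ playersFrom n (a + k) (s - k) := mem_playersFrom.2 ⟨le_rfl, by simp only [c]; omega⟩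
  have hes : e ∈ playersFrom n a s := hunion ▸ Finset.mem_union_left _ he
  have hcs : c ∈ playersFrom n a s := hunion ▸ Finset.mem_union_right _ hc
  have hce : c ≠ e := fun h => by
    rw [Fin.ext_iff] at h
    simp only [c, e] at h
    omega
  constructor
  -- The noncutter `e` is the first player of the left half, and `c`, credited with the `k`-th cut,
  -- is the first player of the right half. The left part is worth exactly the required share to
  -- `e`.
  · refine .left _ _ _ e c ((playersFrom n a k).erase e) ((playersFrom n (a + k) (s - k)).erase c)
      (fun _ => ((a + k : ℕ) : ℝ) / n) (by omega) hes (Finset.mem_erase.2 ⟨hce, hcs⟩)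
      (hdisj.mono (Finset.erase_subset _ _) (Finset.erase_subset _ _)) ?_ ?_
      (fun i hi => hratio i (Finset.mem_of_mem_erase hi)) (fun _ _ => le_rfl) (fun _ _ => le_rfl)
      (hratio e hes).ge ?_ ?_
    · rw [← hunion]
      ext i
      have h1 : i ∈ playersFrom n a k → i ≠ c := fun h h' =>
        Finset.disjoint_left.1 hdisj h (h' ▸ hc)
      have h2 : i ∈ playersFrom n (a + k) (s - k) → i ≠ e := fun h h' =>
        Finset.disjoint_left.1 hdisj he (h' ▸ h)
      simp only [Finset.mem_union, Finset.mem_erase]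
      tauto
    · rw [Finset.card_erase_of_mem he, hck, hcard]
      omega
    · rw [Finset.insert_erase he, hIic]
      exact ih1.1
    · rw [Finset.insert_erase hc, hIoi]
      exact ih2.1
  · refine .split _ _ _ (playersFrom n a k) (playersFrom n (a + k) (s - k)) e c
      (fun _ => ((a + k : ℕ) : ℝ) / n) (((a + k : ℕ) : ℝ) / n) (by omega) hdisj hunion (by omega)
      hratio he hc (fun _ _ => le_rfl) (fun _ _ => le_rfl) (Or.inr ⟨rfl, rfl⟩) ?_ ?_
    · rw [hIic]
      exact ih1.2
    · rw [hIoi]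
      exact ih2.2

lemma exists_dc_example (hn : 0 < n) : ∃ V : Fin n → Valuation,
    DivideAndConquerRun V Finset.univ cake (blockAllocation n) ∧
    MinimalEnvyRun V Finset.univ cake (blockAllocation n) ∧
    envyFreeCount V (blockAllocation n) ≤ dcCount n := by
  have hn' : (0 : ℝ) < n := by exact_mod_cast hn
  -- Deviations are at least `-n`, so with this factor every weight is at least `1 / (2 * n)`.
  let η : ℝ := 1 / (2 * n * n)
  have hη : 0 < η := by positivity
  let w : ℕ → ℕ → ℝ := fun i b => 1 / n + η * dcDev n i b
  obtain ⟨V, hV⟩ := exists_gridValuations (n := n) hn (fun i b => w i b)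
    (fun i b _ => by
      have h : (-(n : ℝ)) ≤ dcDev n i b := by exact_mod_cast neg_le_dcDev n i b
      have h2 : η * (-(n : ℝ)) ≤ η * dcDev n i b := mul_le_mul_of_nonneg_left h hη.le
      have h3 : η * (-(n : ℝ)) = - (1 / n) / 2 := by
        simp only [η]
        field_simp
      have h4 : (0 : ℝ) < 1 / n := by positivity
      simp only [w]
      linarith)
    (fun i => by
      have := (sum_dcDev i.2).1
      simp only [w]
      rw [Finset.sum_add_distrib, ← Finset.mul_sum, ← Int.cast_sum, this]
      simp [hn'.ne'])
  have hruns := dc_example_runs (η := η) (w := w) hV n hn 0 (by omega) fun i _ j _ => by simp [w]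
  have hpl : playersFrom n 0 n = Finset.univ := by
    ext i
    simp [mem_playersFrom]
  rw [hpl, zero_add, ← Finset.range_eq_Ico, ← cake_eq_gridCells hn] at hruns
  refine ⟨V, hruns.1, hruns.2, ?_⟩
  have hval : ∀ i j : Fin n, V i (blockAllocation n j) = w i j := fun i j => by
    rw [blockAllocation, hV i _ (by simp), Finset.sum_singleton]
  have hle := envyFreeCount_le_sum (V := V) (A := blockAllocation n)
    (T := fun i => ({j : Fin n | dcDev n i j ≤ 0} : Finset (Fin n)).erase i) fun i j hij h => by
      rw [hval, hval] at h
      simp only [w, dcDev_self, add_le_add_iff_left, Int.cast_zero, mul_zero] at h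
      have : (dcDev n i j : ℝ) ≤ 0 := by
        by_contra hc
        exact absurd h (not_le.2 (mul_pos hη (not_le.1 hc)))
      simp only [Finset.mem_erase, Finset.mem_filter, Finset.mem_univ, true_and]
      exact ⟨hij.symm, by exact_mod_cast this⟩
  have hcount := count_dcDev n hn
  rw [← Fin.sum_univ_eq_sum_range (fun i => ∑ j ∈ Finset.range n,
    if dcDev n i j ≤ 0 then 1 else 0) n] at hcount
  have hcard : ∀ i : Fin n, (({j : Fin n | dcDev n i j ≤ 0} : Finset (Fin n)).erase i).card + 1 =
      ∑ j ∈ Finset.range n, if dcDev n i j ≤ 0 then 1 else 0 := by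
    intro i
    rw [← Fin.sum_univ_eq_sum_range (fun j => if dcDev n i j ≤ 0 then 1 else 0) n,
      Finset.card_erase_add_one (by simp [dcDev_self]), Finset.card_filter]
  rw [← Finset.sum_congr rfl fun i _ => hcard i, Finset.sum_add_distrib] at hcount
  simp only [Finset.sum_const, Finset.card_univ, Fintype.card_fin, smul_eq_mul, mul_one,
    add_left_inj] at hcount
  exact hle.trans hcount.le

end tightValuations

/-! ### Degrees of the two divide-and-conquer protocols. -/

theorem hasDGEF_divideAndConquer {n : ℕ} (hn : 0 < n) :
    HasDGEF (divideAndConquer n) (dcCount n) := by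
  obtain ⟨V, h1, -, h2⟩ := exists_dc_example hn
  have hne : (Finset.univ : Finset (Fin n)).Nonempty := ⟨⟨0, hn⟩, Finset.mem_univ _⟩
  have hG : ∀ V, ∀ A ∈ divideAndConquer n V, DCGuarantee V Finset.univ cake A :=
    fun V A hA => DivideAndConquerRun.guarantee hA isPortion_cake
  exact .intro (.of_isSharing hn (fun V => exists_divideAndConquerRun V _ _ rfl hne isPortion_cake)
    fun V A hA => ((hG V A hA).conclusion hn).1) (fun V A hA => ((hG V A hA).conclusion hn).2)
    ⟨V, _, h1, h2⟩

theorem hasDGEF_minimalEnvyDivideAndConquer {n : ℕ} (hn : 0 < n) :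
    HasDGEF (minimalEnvyDivideAndConquer n) (dcCount n) := by
  obtain ⟨V, -, h1, h2⟩ := exists_dc_example hn
  have hne : (Finset.univ : Finset (Fin n)).Nonempty := ⟨⟨0, hn⟩, Finset.mem_univ _⟩
  have hG : ∀ V, ∀ A ∈ minimalEnvyDivideAndConquer n V, DCGuarantee V Finset.univ cake A :=
    fun V A hA => MinimalEnvyRun.guarantee hA isPortion_cake
  exact .intro (.of_isSharing hn (fun V => exists_minimalEnvyRun V _ _ rfl hne isPortion_cake)
    fun V A hA => ((hG V A hA).conclusion hn).1) (fun V A hA => ((hG V A hA).conclusion hn).2)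
    ⟨V, _, h1, h2⟩

end CakeCutting

namespace CakeCutting

open Set

/-! ### Valuations with prescribed envy towards the owners of equal blocks -/

/-- Deviation from the average: one index is worth less, those in `G` are worth more. -/
noncomputable def envyDev {ι : Type*} [DecidableEq ι] (z : ι) (G : Finset ι) (j : ι) : ℝ :=
  if G = ∅ then 0 else if j = z then -1 else if j ∈ G then 1 / G.card else 0

lemma neg_one_le_envyDev {ι : Type*} [DecidableEq ι] (z : ι) (G : Finset ι) (j : ι) :
    -1 ≤ envyDev z G j := by
  have : (0 : ℝ) ≤ 1 / G.card := by positivity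
  unfold envyDev
  split_ifs <;> linarith

lemma sum_envyDev {ι : Type*} [DecidableEq ι] [Fintype ι] {z : ι} {G : Finset ι} (hz : z ∉ G) :
    ∑ j, envyDev z G j = 0 := by
  by_cases hG : G = ∅
  · simp [envyDev, hG]
  have h : ∀ j, envyDev z G j =
      (if j = z then -1 else 0) + if j ∈ G then 1 / (G.card : ℝ) else 0 := by
    intro j
    rw [envyDev, if_neg hG]
    split_ifs with h1 h2 h2
    · exact absurd (h1 ▸ h2) hz
    all_goals simp
  simp only [h, Finset.sum_add_distrib]
  rw [Finset.sum_ite_eq' Finset.univ z, Finset.sum_ite_mem, Finset.univ_inter, Finset.sum_const,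
    nsmul_eq_mul]
  have : (G.card : ℝ) ≠ 0 := by
    rw [Nat.cast_ne_zero, Finset.card_ne_zero]
    exact Finset.nonempty_iff_ne_empty.2 hG
  field_simp
  simp

lemma blockAllocation_isSharing {n : ℕ} (hn : 0 < n) :
    IsSharing Finset.univ cake (blockAllocation n) where
  portion _ _ := isPortion_gridCells n _
  disjoint i _ j _ hij := cells_disjoint (by simpa using fun h => hij (Fin.ext h))
  cover := by
    ext x
    simp only [Finset.mem_univ, iUnion_true, mem_iUnion, blockAllocation, mem_cells,
      Finset.mem_singleton]
    exact ⟨fun ⟨_, h⟩ => h.1, fun h => ⟨⟨_, gridIndex_lt hn h⟩, h, rfl⟩⟩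

/-- The block of `z i` pays for the surplus of the blocks in `G i`. If the own block is neither of
these, it is worth `1 / n`, and then `i` envies exactly the owners in `G i`. The factor `1 / (2 *
n)` keeps the weights positive, as `envyDev` is at least `-1`. -/
lemma exists_envy_example {n : ℕ} (hn : 0 < n) (z : Fin n → Fin n) (G : Fin n → Finset (Fin n))
    (hz : ∀ i, z i ∉ G i) : ∃ V : Fin n → Valuation,
      (∀ i, ∀ j ∉ G i, V i (blockAllocation n j) ≤ 1 / n) ∧
      (∀ i, ∀ j ∈ G i, 1 / n < V i (blockAllocation n j)) ∧
      ∀ i, ∀ j ∉ G i, j ≠ z i ∨ G i = ∅ → V i (blockAllocation n j) = 1 / n := by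
  have hn' : (0 : ℝ) < n := by exact_mod_cast hn
  let w : Fin n → ℕ → ℝ := fun i b =>
    1 / n + 1 / (2 * n) * if h : b < n then envyDev (z i) (G i) ⟨b, h⟩ else 0
  have hw : ∀ i j : Fin n, w i j = 1 / n + 1 / (2 * n) * envyDev (z i) (G i) j := by
    intro i j
    simp [w]
  have hpos : (0 : ℝ) < 1 / (2 * n) := by positivity
  have hhalf : (1 : ℝ) / n = 1 / (2 * n) + 1 / (2 * n) := by field_simp; norm_num
  obtain ⟨V, hV⟩ := exists_gridValuations (n := n) hn w
    (fun i b hb => by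
      have := neg_one_le_envyDev (z i) (G i) ⟨b, hb⟩
      have h := hw i ⟨b, hb⟩
      simp only at h
      rw [h]
      nlinarith)
    (fun i => by
      rw [← Fin.sum_univ_eq_sum_range, Finset.sum_congr rfl fun j _ => hw i j,
        Finset.sum_add_distrib, ← Finset.mul_sum, sum_envyDev (hz i)]
      simp [hn'.ne'])
  have hval : ∀ i j : Fin n, V i (blockAllocation n j) =
      1 / n + 1 / (2 * n) * envyDev (z i) (G i) j := fun i j => by
    rw [blockAllocation, hV i _ (by simp), Finset.sum_singleton, hw]
  refine ⟨V, fun i j hj => ?_, fun i j hj => ?_, fun i j hj h => ?_⟩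
  · have : envyDev (z i) (G i) j ≤ 0 := by
      unfold envyDev
      split_ifs <;> simp
    rw [hval]
    nlinarith
  · have hne : (G i).Nonempty := ⟨j, hj⟩
    have : 0 < envyDev (z i) (G i) j := by
      rw [envyDev, if_neg hne.ne_empty, if_neg (by rintro rfl; exact hz i hj), if_pos hj]
      have := hne.card_pos
      positivity
    rw [hval]
    nlinarith
  · have : envyDev (z i) (G i) j = 0 := by
      unfold envyDev
      rcases h with h | h
      · simp [h, hj]
      · simp [h]
    rw [hval, this]
    simp

/-! ### Last Diminisher -/

section lastDiminisher

variable {n : ℕ} {V : Fin n → Valuation}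

lemma TrimPass.mem {q : ℝ} {ps : List (Fin n)} {P P' : Set ℝ} {h w : Fin n}
    (H : TrimPass V q ps P h P' w) : w ∈ h :: ps := by
  induction ps generalizing P h with
  | nil => simp [H.2]
  | cons p ps ih =>
    rcases H with ⟨-, H⟩ | ⟨-, T, -, -, -, H⟩
    · have := ih H
      simp only [List.mem_cons] at this ⊢
      tauto
    · exact List.mem_cons_of_mem _ (ih H)

/-- Trimming only shrinks the piece. So whoever handled it earlier still values it at most `q`,
while the final claimant gets it exactly as he or she left it. -/
lemma TrimPass.spec {q : ℝ} {ps : List (Fin n)} {P P' : Set ℝ} {h w : Fin n}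
    (H : TrimPass V q ps P h P' w) (hP : IsPortion P) (hh : V h P = q) :
    P' ⊆ P ∧ IsPortion P' ∧ V w P' = q ∧ ∀ p ∈ h :: ps, V p P' ≤ q := by
  induction ps generalizing P h with
  | nil =>
    obtain ⟨rfl, rfl⟩ := H
    exact ⟨Subset.rfl, hP, hh, by simp [hh]⟩
  | cons p ps ih =>
    rcases H with ⟨hp, H⟩ | ⟨-, T, hT, hTp, hv, H⟩
    · obtain ⟨h1, h2, h3, h4⟩ := ih H hP hh
      refine ⟨h1, h2, h3, fun i hi => ?_⟩
      simp only [List.mem_cons] at hi h4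
      rcases hi with rfl | rfl | hi
      exacts [h4 _ (Or.inl rfl), ((V _).mono h2 hP h1).trans hp, h4 _ (Or.inr hi)]
    · obtain ⟨h1, h2, h3, h4⟩ := ih H hTp hv
      refine ⟨h1.trans hT, h2, h3, fun i hi => ?_⟩
      rcases List.mem_cons.1 hi with rfl | hi
      exacts [hh ▸ (V _).mono h2 hP (h1.trans hT), h4 _ hi]

lemma exists_trimPass {q : ℝ} (hq : 0 ≤ q) (ps : List (Fin n)) {P : Set ℝ} (hP : IsPortion P)
    (h : Fin n) : ∃ P' w, TrimPass V q ps P h P' w := by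
  induction ps generalizing P h with
  | nil => exact ⟨P, h, rfl, rfl⟩
  | cons p ps ih =>
    rcases le_or_gt (V p P) q with hp | hp
    · obtain ⟨P', w, H⟩ := ih hP h
      exact ⟨P', w, Or.inl ⟨hp, H⟩⟩
    · obtain ⟨T, hT, hTp, hv⟩ := (V p).exists_part hP hq hp.le
      obtain ⟨P', w, H⟩ := ih hTp p
      exact ⟨P', w, Or.inr ⟨hp, T, hT, hTp, hv, H⟩⟩

lemma TrimPass.of_untrimmed {q : ℝ} {ps : List (Fin n)} {P : Set ℝ} {h : Fin n}
    (H : ∀ p ∈ ps, V p P ≤ q) : TrimPass V q ps P h P h := by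
  induction ps with
  | nil => exact ⟨rfl, rfl⟩
  | cons p ps ih =>
    exact Or.inl ⟨H p (by simp), ih fun i hi => H i (List.mem_cons_of_mem _ hi)⟩

lemma LastDiminisherRun.congr {l : List (Fin n)} {R : Set ℝ} {A A' : Fin n → Set ℝ}
    (h : LastDiminisherRun V l R A) (hA : ∀ i ∈ l, A i = A' i) : LastDiminisherRun V l R A' := by
  induction h with
  | final a b R A h =>
    exact .final a b R A' (by rwa [← hA a (by simp), ← hA b (by simp)])
  | round p ps R P w A hps hP hP' hv ht hrun ih =>
    have hw := hA w ht.mem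
    have hrun := ih fun i hi => hA i (List.mem_of_mem_erase hi)
    rw [hw] at ht hrun
    exact .round p ps R P w A' hps hP hP' hv ht hrun

/-- The effect of a round of Last Diminisher. -/
lemma lastDiminisher_round {l : List (Fin n)} {p : Fin n} {ps : List (Fin n)} (hl : l = p :: ps)
    (hnd : l.Nodup) {R P P' : Set ℝ} {w : Fin n} (hR : IsPortion R) (hPR : P ⊆ R)
    (hP : IsPortion P) (hv : V p P = 1 / (n : ℝ)) (ht : TrimPass V (1 / (n : ℝ)) ps P p P' w)
    (hval : ∀ i ∈ l, (l.length : ℝ) / n ≤ V i R) :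
    w ∈ l ∧ P' ⊆ R ∧ IsPortion P' ∧ V w P' = 1 / n ∧ (∀ i ∈ l, V i P' ≤ 1 / n) ∧
      (l.erase w).length + 1 = l.length ∧ (l.erase w).Nodup ∧ IsPortion (R \ P') ∧
      ∀ i ∈ l.erase w, ((l.erase w).length : ℝ) / n ≤ V i (R \ P') := by
  obtain ⟨h1, h2, h3, h4⟩ := ht.spec hP hv
  have hw : w ∈ l := hl ▸ ht.mem
  have hlen : (l.erase w).length + 1 = l.length := by
    rw [List.length_erase_of_mem hw]
    have := List.length_pos_of_mem hw
    omega
  refine ⟨hw, h1.trans hPR, h2, h3, hl ▸ h4, hlen, hnd.erase w, hR.diff h2, fun i hi => ?_⟩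
  have hi' := List.mem_of_mem_erase hi
  have h5 := (V i).diff_add h2 hR (h1.trans hPR)
  have h6 := hval i hi'
  have h7 : V i P' ≤ 1 / n := h4 i (hl ▸ hi')
  rw [← hlen] at h6
  push_cast at h6
  rw [add_div] at h6
  linarith

lemma exists_lastDiminisherRun (hn : 0 < n) (m : ℕ) (l : List (Fin n)) (hlen : l.length = m + 2)
    (hnd : l.Nodup) {R : Set ℝ} (hR : IsPortion R)
    (hval : ∀ i ∈ l, (l.length : ℝ) / n ≤ V i R) : ∃ A, LastDiminisherRun V l R A := by
  have hn' : (0 : ℝ) < n := by exact_mod_cast hn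
  induction m generalizing l R with
  | zero =>
    obtain ⟨a, b, rfl⟩ := List.length_eq_two.1 hlen
    obtain ⟨X, Y, h⟩ := exists_cutAndChoose (V a) (V b) hR
    have hab : b ≠ a := by
      rintro rfl
      simp at hnd
    exact ⟨fun i => if i = a then X else Y, .final a b R _ (by simpa [hab] using h)⟩
  | succ m ih =>
    obtain ⟨p, ps, rfl⟩ : ∃ p ps, l = p :: ps := by
      cases l with
      | nil => simp at hlen
      | cons p ps => exact ⟨p, ps, rfl⟩
    have h1 : 1 / (n : ℝ) ≤ V p R := by
      refine le_trans ?_ (hval p (by simp))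
      gcongr
      rw [hlen]
      exact_mod_cast (by omega : 1 ≤ m + 1 + 2)
    obtain ⟨P, hPR, hP, hv⟩ := (V p).exists_part hR (by positivity) h1
    obtain ⟨P', w, ht⟩ := exists_trimPass (V := V) (q := 1 / (n : ℝ)) (by positivity) ps hP p
    obtain ⟨-, -, -, -, -, hlen', hnd', hR', hval'⟩ :=
      lastDiminisher_round rfl hnd hR hPR hP hv ht hval
    obtain ⟨A, hA⟩ := ih _ (by omega) hnd' hR' hval'
    refine ⟨Function.update A w P', .round p ps R P w _ ?_ hPR hP hv ?_ ?_⟩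
    · simp only [List.length_cons] at hlen
      omega
    · rwa [Function.update_self]
    · rw [Function.update_self]
      refine hA.congr fun i hi => ?_
      rw [Function.update_of_ne]
      rintro rfl
      exact hnd.not_mem_erase hi

/-- The guarantees of Last Diminisher when the players of the list `l` share `R`. -/
structure LDGuarantee (V : Fin n → Valuation) (l : List (Fin n)) (R : Set ℝ)
    (A : Fin n → Set ℝ) : Prop where
  sharing : IsSharing l.toFinset R A
  fair : ∀ i ∈ l, 1 / (n : ℝ) ≤ V i (A i)
  count : l.length * (l.length - 1) / 2 + 1 ≤
    ∑ i ∈ l.toFinset, (unenvied V A i l.toFinset).card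

/-- Those who stay value `A w` at most `1 / n` and do not envy `w`; this is the difference of
consecutive triangular numbers. The relations starting at `w` are kept as a separate summand, since
in a later round `w` may envy everybody else in `l`. -/
lemma LDGuarantee.round {l : List (Fin n)} (hnd : l.Nodup) {w : Fin n} (hw : w ∈ l) {R : Set ℝ}
    {A : Fin n → Set ℝ} (h : LDGuarantee V (l.erase w) (R \ A w) A) (hA : A w ⊆ R)
    (hAp : IsPortion (A w)) (hAw : V w (A w) = 1 / n) (hle : ∀ i ∈ l, V i (A w) ≤ 1 / n) :
    IsSharing l.toFinset R A ∧ (∀ i ∈ l, 1 / (n : ℝ) ≤ V i (A i)) ∧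
      l.length * (l.length - 1) / 2 + 1 + (unenvied V A w l.toFinset).card ≤
        ∑ i ∈ l.toFinset, (unenvied V A i l.toFinset).card := by
  have hset : (l.erase w).toFinset = l.toFinset.erase w := by
    ext i
    simp [hnd.mem_erase_iff]
  have hwl : w ∈ l.toFinset := List.mem_toFinset.2 hw
  have hins : {w} ∪ (l.erase w).toFinset = l.toFinset := by
    rw [hset]
    ext i
    simp only [Finset.mem_union, Finset.mem_singleton, Finset.mem_erase]
    by_cases hi : i = w
    · simp [hi, hw]
    · simp [hi]
  have hfair : ∀ i ∈ l, 1 / (n : ℝ) ≤ V i (A i) := by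
    intro i hi
    by_cases hiw : i = w
    · rw [hiw, hAw]
    · exact h.fair i ((hnd.mem_erase_iff).2 ⟨hiw, hi⟩)
  refine ⟨?_, hfair, ?_⟩
  · have := (IsSharing.singleton hAp).union h.sharing disjoint_sdiff_right
    rwa [hins, union_sdiff_cancel hA] at this
  · have hlen : l.length = (l.erase w).length + 1 := by
      rw [List.length_erase_of_mem hw]
      have := List.length_pos_of_mem hw
      omega
    have hc : (l.erase w).toFinset.card = (l.erase w).length :=
      List.toFinset_card_of_nodup (hnd.erase w)
    have hcount := h.count
    rw [hlen, Nat.triangle_succ, ← Finset.add_sum_erase _ _ hwl, ← hset]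
    have : ∑ i ∈ (l.erase w).toFinset, (unenvied V A i (l.erase w).toFinset).card +
        (l.erase w).length ≤ ∑ i ∈ (l.erase w).toFinset, (unenvied V A i l.toFinset).card := by
      rw [← hc, Finset.card_eq_sum_ones, ← Finset.sum_add_distrib]
      refine Finset.sum_le_sum fun i hi => ?_
      rw [hset, Finset.mem_erase, List.mem_toFinset] at hi
      rw [← hins, card_unenvied_union (by rw [hset]; simp), add_comm]
      gcongr
      rw [card_unenvied_eq (by simpa using hi.1)]
      · simp
      · intro j hj
        rw [Finset.mem_singleton.1 hj]
        exact (hle i hi.2).trans (hfair i hi.2)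
    omega

/-- After cut-and-choose neither of the last two players envies the other. These two relations are
one more than the triangular number `1`, which explains the `+ 1` in `LDGuarantee.count`. -/
lemma LastDiminisherRun.guarantee {l : List (Fin n)} {R : Set ℝ} {A : Fin n → Set ℝ}
    (h : LastDiminisherRun V l R A) (hnd : l.Nodup) (hR : IsPortion R)
    (hval : ∀ i ∈ l, (l.length : ℝ) / n ≤ V i R) : LDGuarantee V l R A := by
  induction h with
  | final a b R A h =>
    have hab : a ≠ b := by
      rintro rfl
      simp at hnd
    have hset : [a, b].toFinset = {a, b} := by
      ext
      simp
    have hva := hval a (by simp)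
    have hvb := hval b (by simp)
    obtain ⟨h1, h2, h3⟩ := h.values
    have h2n : ((2 : ℕ) : ℝ) / n = 1 / n + 1 / n := by
      push_cast
      ring
    simp only [List.length_cons, List.length_nil, zero_add, Nat.reduceAdd, h2n] at hva hvb
    refine ⟨hset ▸ h.isSharing hab, ?_, ?_⟩
    · intro i hi
      simp only [List.mem_cons, List.not_mem_nil, or_false] at hi
      rcases hi with rfl | rfl <;> linarith
    · rw [hset, Finset.sum_pair hab]
      have ha : b ∈ unenvied V A a {a, b} := mem_unenvied.2 ⟨by simp, hab, by rw [h1, h2]⟩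
      have hb : a ∈ unenvied V A b {a, b} :=
        mem_unenvied.2 ⟨by simp, hab.symm, h.2.2.2.2.2⟩
      have := Finset.card_pos.2 ⟨_, ha⟩
      have := Finset.card_pos.2 ⟨_, hb⟩
      simp only [List.length_cons, List.length_nil]
      omega
  | round p ps R P w A _ hPR hP hv ht _ ih =>
    obtain ⟨hw, h1, h2, h3, h4, -, hnd', hR', hval'⟩ :=
      lastDiminisher_round rfl hnd hR hPR hP hv ht hval
    obtain ⟨k1, k2, k3⟩ := (ih hnd' hR' hval').round hnd hw h1 h2 h3 h4
    exact ⟨k1, k2, by omega⟩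

lemma toFinset_finRange (n : ℕ) : (List.finRange n).toFinset = Finset.univ := by
  ext
  simp

lemma finRange_fair (V : Fin n → Valuation) (hn : 0 < n) :
    ∀ i ∈ List.finRange n, ((List.finRange n).length : ℝ) / n ≤ V i cake := by
  intro i _
  have hn' : (n : ℝ) ≠ 0 := by positivity
  rw [(V i).normalized, List.length_finRange, div_self hn']

lemma isProportional_lastDiminisher (hn : 3 ≤ n) : IsProportional (lastDiminisher n) := by
  refine .of_isSharing (by omega) (fun V => ?_) fun V A hA => ?_
  · exact exists_lastDiminisherRun (by omega) (n - 2) _ (by rw [List.length_finRange]; omega)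
      (List.nodup_finRange n) isPortion_cake (finRange_fair V (by omega))
  · have h := LastDiminisherRun.guarantee hA (List.nodup_finRange n) isPortion_cake
      (finRange_fair V (by omega))
    exact ⟨toFinset_finRange n ▸ h.sharing, fun i => h.fair i (List.mem_finRange i)⟩

/-- The first round is treated separately: for the first player to leave, averaging over the whole
cake yields one more relation. -/
lemma le_envyFreeCount_lastDiminisher (hn : 3 ≤ n) {A : Fin n → Set ℝ}
    (hA : A ∈ lastDiminisher n V) : 2 + n * (n - 1) / 2 ≤ envyFreeCount V A := by
  have hdiv := (isProportional_lastDiminisher hn V).2 A hA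
  have hA : LastDiminisherRun V (List.finRange n) cake A := hA
  -- Case analysis of the run requires variables in place of the initial list and cake.
  generalize hl : List.finRange n = l at hA
  generalize hR : cake = R at hA
  cases hA with
  | final a b =>
    have := congrArg List.length hl
    simp only [List.length_finRange, List.length_cons, List.length_nil] at this
    omega
  | round p ps R P w A _ hPR hP hv ht hrun =>
    subst hR
    have hnd : (p :: ps).Nodup := hl ▸ List.nodup_finRange n
    obtain ⟨hw, h1, h2, h3, h4, -, hnd', hR', hval'⟩ :=
      lastDiminisher_round rfl hnd isPortion_cake hPR hP hv ht
        (hl ▸ finRange_fair V (by omega))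
    obtain ⟨-, -, k3⟩ := (hrun.guarantee hnd' hR' hval').round hnd hw h1 h2 h3 h4
    rw [← hl, toFinset_finRange, List.length_finRange, ← envyFreeCount_eq_sum] at k3
    have := hdiv.1.one_le_card_unenvied (by omega) (hdiv.2 w)
    omega

end lastDiminisher

/-- In each round the first player left cuts the own block, which nobody trims because of `hle`. The
last two players are indifferent between their two blocks. The induction is on the number `m` of
rounds still to come before cut-and-choose. -/
lemma lastDiminisher_example_run {n : ℕ} {V : Fin n → Valuation}
    (hle : ∀ i j : Fin n, j < i → V i (blockAllocation n j) ≤ 1 / n)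
    (heq : ∀ i : Fin n, V i (blockAllocation n i) = 1 / n)
    (hlast : ∀ i j : Fin n, n - 2 ≤ i.val → n - 2 ≤ j.val → V i (blockAllocation n j) = 1 / n)
    (m : ℕ) (t : ℕ) (ht : t + m + 2 = n) :
    LastDiminisherRun V ((List.finRange n).drop t)
      (cells (gridIndex n) (Finset.Ico t n)) (blockAllocation n) := by
  have hpart : ∀ t (htn : t < n), cells (gridIndex n) (Finset.Ico t n) =
      blockAllocation n ⟨t, htn⟩ ∪ cells (gridIndex n) (Finset.Ico (t + 1) n) := by
    intro t htn
    rw [blockAllocation, ← cells_union, ← Finset.insert_eq, Finset.insert_Ico_add_one_left_eq_Ico htn]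
  have hdisj : ∀ t (htn : t < n), Disjoint (blockAllocation n ⟨t, htn⟩)
      (cells (gridIndex n) (Finset.Ico (t + 1) n)) := fun t htn => cells_disjoint (by simp)
  have hdrop : ∀ t (htn : t < n), (List.finRange n).drop t =
      ⟨t, htn⟩ :: (List.finRange n).drop (t + 1) := by
    intro t htn
    rw [List.drop_eq_getElem_cons (by simpa using htn)]
    simp
  induction m generalizing t with
  | zero =>
    have hnil : (List.finRange n).drop (t + 1 + 1) = [] := List.drop_eq_nil_of_le (by simp; omega)
    have hemp : cells (gridIndex n) (Finset.Ico (t + 1 + 1) n) = ∅ := by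
      rw [Finset.Ico_eq_empty (by omega)]
      ext x
      simp [mem_cells]
    rw [hdrop t (by omega), hdrop (t + 1) (by omega), hnil, hpart t (by omega)]
    have h1 := hpart (t + 1) (by omega)
    rw [hemp, union_empty] at h1
    have hd := hdisj t (by omega)
    rw [h1] at hd ⊢
    refine .final _ _ _ _ ⟨isPortion_gridCells _ _, isPortion_gridCells _ _, hd, rfl, ?_, ?_⟩
    · rw [hlast _ _ (by simp; omega) (by simp; omega), hlast _ _ (by simp; omega) (by simp; omega)]
    · rw [hlast _ _ (by simp; omega) (by simp; omega), hlast _ _ (by simp; omega) (by simp; omega)]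
  | succ m ih =>
    have htn : t < n := by omega
    rw [hdrop t htn]
    refine .round ⟨t, htn⟩ _ _ (blockAllocation n ⟨t, htn⟩) ⟨t, htn⟩ _ ?_ ?_
      (isPortion_gridCells _ _) (heq _) (.of_untrimmed fun p hp => hle _ _ ?_) ?_
    · rw [List.length_drop, List.length_finRange]
      omega
    · rw [hpart t htn]
      exact subset_union_left
    · obtain ⟨k, hk, rfl⟩ := List.mem_iff_getElem.1 hp
      rw [Fin.lt_def]
      simp
      omega
    · rw [List.erase_cons_head, hpart t htn, union_sdiff_cancel_left]
      · exact ih (t + 1) (by omega)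
      · rw [(hdisj t htn).inter_eq]

theorem hasDGEF_lastDiminisher {n : ℕ} (hn : 3 ≤ n) :
    HasDGEF (lastDiminisher n) (2 + n * (n - 1) / 2) := by
  refine .intro (isProportional_lastDiminisher hn)
    (fun V A hA => le_envyFreeCount_lastDiminisher hn hA) ?_
  -- Player `0` envies all but the last player, a player `i` with `0 < i < n - 2` envies all later
  -- ones, and the last two envy nobody. The relations number `1 + (1 + ⋯ + (n - 3)) + 2 (n - 1)`.
  let G : Fin n → Finset (Fin n) := fun i =>
    if i.val = 0 then Finset.univ.filter fun j : Fin n => 0 < j.val ∧ j.val < n - 1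
    else if i.val < n - 2 then Finset.Ioi i else ∅
  let z : Fin n → Fin n := fun i => if i.val = 0 then ⟨n - 1, by omega⟩ else ⟨0, by omega⟩
  have hG : ∀ i j : Fin n, j ∈ G i ↔
      (i.val = 0 ∧ 0 < j.val ∧ j.val < n - 1) ∨ (i.val ≠ 0 ∧ i.val < n - 2 ∧ i.val < j.val) := by
    intro i j
    simp only [G]
    split_ifs with h1 h2
    · simp [h1]
    · simp only [Finset.mem_Ioi, Fin.lt_def]
      omega
    · simp only [Finset.notMem_empty, false_iff]
      omega
  have hz : ∀ i, (z i).val = if i.val = 0 then n - 1 else 0 := by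
    intro i
    simp only [z]
    split_ifs <;> rfl
  obtain ⟨V, h1, h2, h3⟩ := exists_envy_example (by omega : 0 < n) z G (fun i hi => by
    rw [hG, hz] at hi
    split_ifs at hi <;> omega)
  have hself : ∀ i, V i (blockAllocation n i) = 1 / n := fun i => by
    refine h3 i i (fun h => ?_) (Or.inl fun h => ?_)
    · rw [hG] at h
      omega
    · have := hz i
      rw [← h] at this
      split_ifs at this <;> omega
  refine ⟨V, blockAllocation n, ?_, ?_⟩
  · have hrun := lastDiminisher_example_run (V := V) (fun i j hij => h1 i j fun h => ?_) hself
      (fun i j hi hj => h3 i j (fun h => ?_) ?_) (n - 2) 0 (by omega)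
    · rw [List.drop_zero, ← Finset.range_eq_Ico, ← cake_eq_gridCells (by omega)] at hrun
      exact hrun
    · rw [hG] at h
      rw [Fin.lt_def] at hij
      omega
    · rw [hG] at h
      omega
    · right
      simp only [G]
      rw [if_neg (by omega), if_neg (by omega)]
  · let T : Fin n → Finset (Fin n) := fun i =>
      if i.val = 0 then {⟨n - 1, by omega⟩} else if i.val < n - 2 then Finset.Iio i
      else Finset.univ.erase i
    refine (envyFreeCount_le_sum (T := T) fun i j hij h => ?_).trans ?_
    · have hj : j ∉ G i := fun hj => by
        have := h2 i j hj
        rw [hself] at h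
        linarith
      rw [hG] at hj
      have hij' : i.val ≠ j.val := fun h => hij (Fin.ext h)
      simp only [T]
      split_ifs with c1 c2
      · rw [Finset.mem_singleton, Fin.ext_iff]
        simp only
        omega
      · rw [Finset.mem_Iio, Fin.lt_def]
        omega
      · exact Finset.mem_erase.2 ⟨hij.symm, Finset.mem_univ _⟩
    · have hcard : ∀ i : Fin n, (T i).card =
          if i.val = 0 then 1 else if i.val < n - 2 then i.val else n - 1 := by
        intro i
        simp only [T]
        split_ifs <;> simp
      rw [Finset.sum_congr rfl fun i _ => hcard i, Fin.sum_univ_eq_sum_range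
        (fun i => if i = 0 then 1 else if i < n - 2 then i else n - 1) n]
      obtain ⟨m, rfl⟩ : ∃ m, n = m + 3 := ⟨n - 3, by omega⟩
      rw [Finset.sum_range_succ, Finset.sum_range_succ, Finset.sum_range_succ']
      have : ∑ k ∈ Finset.range m, (if k + 1 = 0 then 1 else if k + 1 < m + 3 - 2 then k + 1
          else m + 3 - 1) = (m + 1) * m / 2 := by
        have hid := Finset.sum_range_id_mul_two (m + 1)
        rw [Nat.add_sub_cancel] at hid
        rw [← hid, Nat.mul_div_cancel _ (by norm_num), Finset.sum_range_succ', add_zero]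
        refine Finset.sum_congr rfl fun k hk => ?_
        rw [Finset.mem_range] at hk
        rw [if_neg (by omega), if_pos (by omega)]
      rw [this]
      have e : (m + 3) * (m + 3 - 1) = (m + 1) * m + 2 * (2 * m + 3) := by
        rw [show m + 3 - 1 = m + 2 by omega]
        ring
      rw [e, Nat.add_mul_div_left _ _ (by norm_num)]
      simp
      omega

end CakeCutting

namespace CakeCutting

open Set

/-! ### Lone Divider -/

section loneDivider

variable {n : ℕ} {V : Fin n → Valuation}

/-- The effect of a round of Lone Divider. -/
structure LoneDividerRound (V : Fin n → Valuation) (N : Finset (Fin n)) (R : Set ℝ)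
    (A : Fin n → Set ℝ) (d : Fin n) (L : Finset (Fin n)) : Prop where
  mem : d ∈ L
  subset : L ⊆ N
  sharing : IsSharing L (⋃ i ∈ L, A i) A
  union_subset : (⋃ i ∈ L, A i) ⊆ R
  cover : L = N → (⋃ i ∈ L, A i) = R
  divider : ∀ i ∈ L, V d (A i) = V d R / N.card
  served : ∀ i ∈ L, V i R / N.card ≤ V i (A i)
  unserved : ∀ i ∈ N \ L, ∀ j ∈ L, V i (A j) < V i R / N.card

lemma Servable.round {N : Finset (Fin n)} {R : Set ℝ} {A : Fin n → Set ℝ} {d : Fin n}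
    {Q : Fin N.card → Set ℝ} {L : Finset (Fin n)} {σ : Fin n → Fin N.card}
    (h : Servable V N R Q d L σ) (hQ : IsPartition R Q)
    (hd : ∀ j, V d (Q j) = V d R / (N.card : ℝ)) (hA : ∀ i ∈ L, A i = Q (σ i)) :
    LoneDividerRound V N R A d L := by
  obtain ⟨hdL, hLN, hinj, hacc, hrej⟩ := h
  have hsub : (⋃ i ∈ L, A i) ⊆ R := by
    rw [← hQ.2.2]
    refine iUnion₂_subset fun i hi => ?_
    rw [hA i hi]
    exact subset_iUnion Q _
  refine ⟨hdL, hLN, ⟨fun i hi => ?_, fun i hi j hj hij => ?_, rfl⟩, hsub, fun hLN' => ?_,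
    fun i hi => ?_, fun i hi => ?_, fun i hi j hj => ?_⟩
  · rw [hA i hi]
    exact hQ.1 _
  · rw [Function.onFun, hA i hi, hA j hj]
    exact hQ.2.1 _ _ fun e => hij (hinj hi hj e)
  · refine hsub.antisymm ?_
    rw [← hQ.2.2]
    refine iUnion_subset fun j => ?_
    have himg : L.image σ = Finset.univ := by
      rw [← Finset.card_eq_iff_eq_univ, Finset.card_image_of_injOn hinj, hLN', Fintype.card_fin]
    obtain ⟨i, hi, rfl⟩ := Finset.mem_image.1 (himg ▸ Finset.mem_univ j)
    rw [← hA i hi]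
    exact subset_biUnion_of_mem (u := A) (Finset.mem_coe.2 hi)
  · rw [hA i hi, hd]
  · by_cases hid : i = d
    · rw [hA i hi, hid, hd]
    · rw [hA i hi]
      exact hacc i hi hid
  · rw [hA j hj]
    exact not_le.1 (hrej i hi j hj)

/-- An unserved player finds every portion handed out worth less than a fair part of `R`. So a fair
part of the rest, among fewer players, is no smaller than a fair part of `R`. -/
lemma LoneDividerRound.rest_fair {N : Finset (Fin n)} {R : Set ℝ} {A : Fin n → Set ℝ} {d : Fin n}
    {L : Finset (Fin n)} (h : LoneDividerRound V N R A d L) (hR : IsPortion R) {i : Fin n}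
    (hi : i ∈ N \ L) (hf : V i (R \ ⋃ i ∈ L, A i) ≤ (N \ L).card * V i (A i)) :
    V i R ≤ N.card * V i (A i) := by
  have hNpos : (0 : ℝ) < N.card := by
    exact_mod_cast Finset.card_pos.2 ⟨i, (Finset.mem_sdiff.1 hi).1⟩
  have hpos : (0 : ℝ) < (N \ L).card := by exact_mod_cast Finset.card_pos.2 ⟨i, hi⟩
  have hdiff := (V i).diff_add h.sharing.isPortion hR h.union_subset
  have hsum := h.sharing.sum_eq (V i)
  have hle : ∑ j ∈ L, V i (A j) ≤ ∑ _j ∈ L, V i R / N.card :=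
    Finset.sum_le_sum fun j hj => (h.unserved i hi j hj).le
  rw [Finset.sum_const, nsmul_eq_mul] at hle
  have hc : ((N \ L).card : ℝ) = N.card - L.card := by
    rw [Finset.card_sdiff_of_subset h.subset, Nat.cast_sub (Finset.card_le_card h.subset)]
  have key : V i R / N.card * (N \ L).card ≤ V i (A i) * (N \ L).card := by
    have e : V i R / N.card * (N \ L).card = V i R - L.card * (V i R / N.card) := by
      rw [hc]
      field_simp
    rw [e]
    linarith
  have := le_of_mul_le_mul_right key hpos
  rw [div_le_iff₀ hNpos] at this
  linarith

lemma LoneDividerRun.guarantee {N : Finset (Fin n)} {R : Set ℝ} {A : Fin n → Set ℝ}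
    (h : LoneDividerRun V N R A) (hR : IsPortion R) (hN : N.Nonempty) :
    IsSharing N R A ∧ ∀ i ∈ N, V i R ≤ N.card * V i (A i) := by
  induction h with
  | done => exact absurd hN (by simp)
  | round N R A d Q L σ hQ hd hserv _ hA _ ih =>
    have hr := hserv.round hQ hd hA
    have hNpos : (0 : ℝ) < N.card := by exact_mod_cast hN.card_pos
    have hserved : ∀ i ∈ L, V i R ≤ N.card * V i (A i) := fun i hi => by
      have := hr.served i hi
      rw [div_le_iff₀ hNpos] at this
      linarith
    rcases (N \ L).eq_empty_or_nonempty with he | hne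
    · have hLN : L = N := hr.subset.antisymm (Finset.sdiff_eq_empty_iff_subset.1 he)
      have hcov := hr.cover hLN
      have hs := hr.sharing
      rw [hcov, hLN] at hs
      exact ⟨hs, fun i hi => hserved i (hLN ▸ hi)⟩
    · obtain ⟨h1, h2⟩ := ih (hR.diff hr.sharing.isPortion) hne
      refine ⟨?_, fun i hi => ?_⟩
      · have := hr.sharing.union h1 disjoint_sdiff_right
        rwa [Finset.union_sdiff_of_subset hr.subset, union_sdiff_cancel hr.union_subset] at this
      · by_cases hiL : i ∈ L
        · exact hserved i hiL
        · have hi' := Finset.mem_sdiff.2 ⟨hi, hiL⟩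
          exact hr.rest_fair hR hi' (h2 i hi')

lemma LoneDividerRun.congr {N : Finset (Fin n)} {R : Set ℝ} {A A' : Fin n → Set ℝ}
    (h : LoneDividerRun V N R A) (hA : ∀ i ∈ N, A i = A' i) : LoneDividerRun V N R A' := by
  induction h with
  | done R A => exact .done R A'
  | round N R A d Q L σ hQ hd hserv hmax hAQ _ ih =>
    have hL : ∀ i ∈ L, A i = A' i := fun i hi => hA i (hserv.2.1 hi)
    refine .round N R A' d Q L σ hQ hd hserv hmax (fun i hi => by rw [← hL i hi, hAQ i hi]) ?_
    rw [← iUnion₂_congr hL]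
    exact ih fun i hi => hA i (Finset.mem_sdiff.1 hi).1

/-! ### Lone Divider: existence of servable sets and of runs. -/

/-- In a bipartite graph with more vertices on the right than on the left there are a set `X` on
the left, a matching of the other vertices on the left into vertices that are not adjacent to `X`,
and one more vertex that is neither matched nor adjacent to `X`. -/
lemma exists_conflict_free_matching {α β : Type*} [DecidableEq α] [DecidableEq β] [Fintype β]
    (C : Finset α) (acc : α → Finset β) (hC : C.card < Fintype.card β) :
    ∃ X ⊆ C, ∃ f : α → β, ∃ b : β, Set.InjOn f (C \ X : Finset α) ∧
      (∀ i ∈ C \ X, f i ∈ acc i ∧ f i ≠ b ∧ ∀ x ∈ X, f i ∉ acc x) ∧ ∀ x ∈ X, b ∉ acc x := by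
  -- `X` has maximal deficiency in the sense of Hall's theorem. Comparison with `∅` shows that it
  -- has at most `X.card` neighbours.
  obtain ⟨X, hXC, hmax⟩ := C.powerset.exists_max_image
    (fun X => (X.card : ℤ) - (X.biUnion acc).card) ⟨∅, by simp⟩
  rw [Finset.mem_powerset] at hXC
  have hdef : (X.biUnion acc).card ≤ X.card := by
    have := hmax ∅ (by simp)
    simp only [Finset.card_empty, Finset.biUnion_empty] at this
    omega
  let t : {i // i ∈ C \ X} → Finset β := fun i => acc i \ X.biUnion acc
  -- Hall's condition away from `X`: a set violating it could be added to `X` and would increase the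
  -- deficiency.
  have hall : ∀ s : Finset {i // i ∈ C \ X}, s.card ≤ (s.biUnion t).card := by
    intro s
    let Y : Finset α := s.map (Function.Embedding.subtype _)
    have hY : ∀ y ∈ Y, y ∈ C ∧ y ∉ X := by
      intro y hy
      obtain ⟨⟨y', hy'⟩, -, rfl⟩ := Finset.mem_map.1 hy
      exact Finset.mem_sdiff.1 hy'
    have hYX : Disjoint X Y := Finset.disjoint_left.2 fun a ha ha' => (hY a ha').2 ha
    have h1 := hmax (X ∪ Y)
      (Finset.mem_powerset.2 (Finset.union_subset hXC fun y hy => (hY y hy).1))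
    have h2 : (X ∪ Y).biUnion acc = X.biUnion acc ∪ s.biUnion t := by
      ext b
      simp only [Finset.mem_biUnion, Finset.mem_union, t, Finset.mem_sdiff, Y, Finset.mem_map,
        Function.Embedding.subtype_apply]
      constructor
      · rintro ⟨a, ha | ⟨a', ha', rfl⟩, hb⟩
        · exact Or.inl ⟨a, ha, hb⟩
        · by_cases hX : ∃ a ∈ X, b ∈ acc a
          exacts [Or.inl hX, Or.inr ⟨a', ha', hb, hX⟩]
      · rintro (⟨a, ha, hb⟩ | ⟨a', ha', hb, -⟩)
        exacts [⟨a, Or.inl ha, hb⟩, ⟨a', Or.inr ⟨a', ha', rfl⟩, hb⟩]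
    have h3 : (X ∪ Y).card = X.card + s.card := by
      rw [Finset.card_union_of_disjoint hYX, Finset.card_map]
    have h4 := Finset.card_union_le (X.biUnion acc) (s.biUnion t)
    rw [h2, h3] at h1
    omega
  obtain ⟨f, hf, hft⟩ := (Finset.all_card_le_biUnion_card_iff_exists_injective t).1 hall
  have hfX : ∀ i (x : α), x ∈ X → f i ∉ acc x := fun i x hx hc =>
    (Finset.mem_sdiff.1 (hft i)).2 (Finset.mem_biUnion.2 ⟨x, hx, hc⟩)
  -- Neighbours of `X` and matched vertices number at most `X.card + (C.card - X.card) = C.card`, so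
  -- some vertex is left over.
  obtain ⟨b, hb⟩ : ∃ b, b ∉ X.biUnion acc ∪ Finset.univ.image f := by
    by_contra! hcon
    have h1 := Finset.card_union_le (X.biUnion acc) (Finset.univ.image f)
    rw [Finset.eq_univ_iff_forall.2 hcon, Finset.card_univ,
      Finset.card_image_of_injective _ hf, Finset.card_univ, Fintype.card_coe,
      Finset.card_sdiff_of_subset hXC] at h1
    have := Finset.card_le_card hXC
    omega
  simp only [Finset.mem_union, Finset.mem_biUnion, Finset.mem_image, Finset.mem_univ, true_and,
    not_or, not_exists, not_and] at hb
  have hval : ∀ i (hi : i ∈ C \ X),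
      (fun i => if h : i ∈ C \ X then f ⟨i, h⟩ else b) i = f ⟨i, hi⟩ := fun i hi => dif_pos hi
  refine ⟨X, hXC, fun i => if h : i ∈ C \ X then f ⟨i, h⟩ else b, b, ?_, ?_, hb.1⟩
  · intro i hi j hj hij
    rw [hval i hi, hval j hj] at hij
    exact congrArg Subtype.val (hf hij)
  · intro i hi
    rw [hval i hi]
    exact ⟨(Finset.mem_sdiff.1 (hft ⟨i, hi⟩)).1, hb.2 _, hfX _⟩

/-- There is one chooser fewer than there are portions. So the matching leaves a portion for the
divider that no unserved player accepts. -/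
lemma exists_servable (V : Fin n → Valuation) {N : Finset (Fin n)} (R : Set ℝ)
    (Q : Fin N.card → Set ℝ) {d : Fin n} (hd : d ∈ N) : ∃ L σ, Servable V N R Q d L σ := by
  classical
  obtain ⟨X, hX, f, b, hinj, hf, hb⟩ := exists_conflict_free_matching (N.erase d)
    (fun i => {j | Accepts V N R Q i j}) (by
      rw [Finset.card_erase_of_mem hd, Fintype.card_fin]
      have := Finset.card_pos.2 ⟨d, hd⟩
      omega)
  simp only [Finset.mem_filter, Finset.mem_univ, true_and] at hf hb
  have hdX : d ∉ N.erase d \ X := by simp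
  have hne : ∀ i ∈ N.erase d \ X, i ≠ d := fun i hi h => hdX (h ▸ hi)
  refine ⟨insert d (N.erase d \ X), Function.update f d b, Finset.mem_insert_self _ _, ?_, ?_, ?_,
    ?_⟩
  · exact Finset.insert_subset hd (Finset.sdiff_subset.trans (Finset.erase_subset _ _))
  · intro i hi j hj hij
    rw [Finset.mem_coe, Finset.mem_insert] at hi hj
    rcases hi with rfl | hi <;> rcases hj with rfl | hj
    · rfl
    · rw [Function.update_self, Function.update_of_ne (hne j hj)] at hij
      exact absurd hij.symm (hf j hj).2.1
    · rw [Function.update_self, Function.update_of_ne (hne i hi)] at hij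
      exact absurd hij (hf i hi).2.1
    · rw [Function.update_of_ne (hne i hi), Function.update_of_ne (hne j hj)] at hij
      exact hinj hi hj hij
  · intro i hi hid
    rw [Function.update_of_ne hid]
    exact (hf i ((Finset.mem_insert.1 hi).resolve_left hid)).1
  · intro i hi l hl
    have hiX : i ∈ X := by
      simp only [Finset.mem_sdiff, Finset.mem_insert, Finset.mem_erase] at hi
      tauto
    rcases Finset.mem_insert.1 hl with rfl | hl
    · rw [Function.update_self]
      exact hb i hiX
    · rw [Function.update_of_ne (hne l hl)]
      exact (hf l hl).2.2 i hiX

lemma exists_maximal_servable (V : Fin n → Valuation) {N : Finset (Fin n)} (R : Set ℝ)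
    (Q : Fin N.card → Set ℝ) {d : Fin n} (hd : d ∈ N) : ∃ L σ, Servable V N R Q d L σ ∧
      ∀ L' σ', Servable V N R Q d L' σ' → L ⊆ L' → L' = L := by
  classical
  obtain ⟨L₀, σ₀, h₀⟩ := exists_servable V R Q hd
  obtain ⟨L, hL, hmax⟩ := (Finset.univ.filter fun L => ∃ σ, Servable V N R Q d L σ).exists_max_image
    Finset.card ⟨L₀, by simpa using ⟨σ₀, h₀⟩⟩
  simp only [Finset.mem_filter, Finset.mem_univ, true_and] at hL hmax
  obtain ⟨σ, hσ⟩ := hL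
  exact ⟨L, σ, hσ, fun L' σ' h hLL' =>
    (Finset.eq_of_subset_of_card_le hLL' (hmax L' ⟨σ', h⟩)).symm⟩

lemma exists_loneDividerRun (V : Fin n → Valuation) (s : ℕ) (N : Finset (Fin n))
    (hs : N.card = s) {R : Set ℝ} (hR : IsPortion R) : ∃ A, LoneDividerRun V N R A := by
  classical
  induction s using Nat.strong_induction_on generalizing N R with
  | _ s ih =>
  rcases N.eq_empty_or_nonempty with rfl | ⟨d, hd⟩
  · exact ⟨fun _ => ∅, .done _ _⟩
  obtain ⟨Q, hQ, hv⟩ := (V d).exists_equal_partition hR (Finset.card_pos.2 ⟨d, hd⟩)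
  obtain ⟨L, σ, hserv, hmax⟩ := exists_maximal_servable V R Q hd
  have hlt : (N \ L).card < s := by
    rw [← hs]
    refine Finset.card_lt_card ⟨Finset.sdiff_subset, fun h => ?_⟩
    exact (Finset.mem_sdiff.1 (h hd)).2 hserv.1
  obtain ⟨A, hA⟩ := ih _ hlt (N \ L) rfl (R := R \ ⋃ i ∈ L, Q (σ i))
    (hR.diff (.biUnion fun i _ => hQ.1 _))
  have hval : ∀ i ∈ L, (fun i => if i ∈ L then Q (σ i) else A i) i = Q (σ i) :=
    fun i hi => if_pos hi
  refine ⟨fun i => if i ∈ L then Q (σ i) else A i,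
    .round N R _ d Q L σ hQ hv hserv hmax hval ?_⟩
  rw [iUnion₂_congr hval]
  exact hA.congr fun i hi => (if_neg (Finset.mem_sdiff.1 hi).2).symm

lemma isProportional_loneDivider (hn : 0 < n) : IsProportional (loneDivider n) := by
  refine .of_isSharing hn (fun V => exists_loneDividerRun V _ _ rfl isPortion_cake) fun V A hA => ?_
  obtain ⟨h1, h2⟩ := LoneDividerRun.guarantee hA isPortion_cake ⟨⟨0, hn⟩, Finset.mem_univ _⟩
  refine ⟨h1, fun i => ?_⟩
  have := h2 i (Finset.mem_univ i)
  rw [(V i).normalized, Finset.card_univ, Fintype.card_fin] at this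
  rw [div_le_iff₀ (by positivity)]
  linarith

/-- The first round suffices. The divider does not envy the other `L.card - 1` served players, and
each served chooser has one relation by averaging. An unserved player envies nobody in `L`, and
averaging over the rest gives another relation if at least two players are unserved; a single
unserved player already has `n - 1 ≥ 2` relations unless `n = 2`. The total is at least `2 (L.card -
1) + 2 (n - L.card)`. -/
lemma le_envyFreeCount_loneDivider (hn : 2 ≤ n) {A : Fin n → Set ℝ} (hA : A ∈ loneDivider n V) :
    2 * n - 2 ≤ envyFreeCount V A := by
  classical
  have hdiv := (isProportional_loneDivider (by omega) V).2 A hA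
  have hA : LoneDividerRun V Finset.univ cake A := hA
  have hone : ∀ i, 1 ≤ (unenvied V A i Finset.univ).card := fun i =>
    hdiv.1.one_le_card_unenvied hn (hdiv.2 i)
  rw [envyFreeCount_eq_sum]
  generalize hN : (Finset.univ : Finset (Fin n)) = N at hA
  generalize hR : cake = R at hA
  have hNc : N.card = n := by rw [← hN, Finset.card_univ, Fintype.card_fin]
  cases hA with
  | done => simp at hNc; omega
  | round N R A d Q L σ hQ hd hserv _ hAQ hrun =>
    have hr := hserv.round hQ hd hAQ
    have hRp : IsPortion R := hR ▸ isPortion_cake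
    rw [hN] at hone
    have hsplit : ∑ i ∈ N, (unenvied V A i N).card =
        (unenvied V A d N).card + ∑ i ∈ L.erase d, (unenvied V A i N).card +
          ∑ i ∈ N \ L, (unenvied V A i N).card := by
      rw [Finset.add_sum_erase L (fun i => (unenvied V A i N).card) hr.mem, add_comm,
        Finset.sum_sdiff hr.subset]
    have hle1 : (L.erase d).card ≤ ∑ i ∈ L.erase d, (unenvied V A i N).card := by
      rw [Finset.card_eq_sum_ones]
      exact Finset.sum_le_sum fun i _ => hone i
    have hLN := Finset.card_le_card hr.subset
    have hLpos := Finset.card_pos.2 ⟨d, hr.mem⟩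
    have hLe := Finset.card_erase_of_mem hr.mem
    have hNL := Finset.card_sdiff_of_subset hr.subset
    have hdcount : (L.erase d).card ≤ (unenvied V A d N).card := by
      rw [← card_unenvied_eq (V := V) (A := A) (i := d) (s := L.erase d) (by simp)]
      · exact Finset.card_le_card (unenvied_mono ((Finset.erase_subset _ _).trans hr.subset))
      · intro j hj
        rw [hr.divider j (Finset.mem_of_mem_erase hj), hr.divider d hr.mem]
    have hgL : ∀ i ∈ N \ L, (unenvied V A i L).card = L.card := fun i hi => by
      refine card_unenvied_eq (Finset.mem_sdiff.1 hi).2 fun j hj => ?_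
      refine (hr.unserved i hi j hj).le.trans ?_
      rw [← hR, (V i).normalized, hNc]
      exact hdiv.2 i
    have htwo : ∀ i ∈ N \ L, 2 ≤ (unenvied V A i N).card ∨ N.card = 2 := by
      intro i hi
      have hLi := hgL i hi
      have hle := card_unenvied_add_le (V := V) (A := A) (i := i) (s := L) (t := (N \ L).erase i)
        (u := N) (Finset.disjoint_left.2 fun a ha ha' =>
          (Finset.mem_sdiff.1 (Finset.mem_of_mem_erase ha')).2 ha) hr.subset
        ((Finset.erase_subset _ _).trans Finset.sdiff_subset)
      have hei := Finset.card_erase_of_mem hi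
      have hipos := Finset.card_pos.2 ⟨i, hi⟩
      rcases Nat.lt_or_ge (N \ L).card 2 with hlt | hge
      · omega
      · left
        obtain ⟨h1, h2⟩ := hrun.guarantee (hRp.diff hr.sharing.isPortion) ⟨i, hi⟩
        have : 1 ≤ (unenvied V A i ((N \ L).erase i)).card := by
          refine one_le_card_unenvied (by simp) (Finset.card_pos.1 (by omega)) ?_
          have hs := h1.sum_eq (V i)
          rw [← Finset.add_sum_erase _ _ hi] at hs
          have hf := h2 i hi
          rw [hei, Nat.cast_sub (by omega), Nat.cast_one]
          linarith
        omega
    have h1d := hone d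
    rw [hsplit]
    by_cases hn2 : N.card = 2
    · have hge : (N \ L).card ≤ ∑ i ∈ N \ L, (unenvied V A i N).card := by
        rw [Finset.card_eq_sum_ones]
        exact Finset.sum_le_sum fun i _ => hone i
      omega
    · have hge : (N \ L).card * 2 ≤ ∑ i ∈ N \ L, (unenvied V A i N).card := by
        rw [← smul_eq_mul, ← Finset.sum_const]
        exact Finset.sum_le_sum fun i hi => (htwo i hi).resolve_right hn2
      omega

end loneDivider

/-! ### Lone Divider: an example attaining the bound. -/

lemma isPartition_blockAllocation {n k : ℕ} (hn : 0 < n) (hk : k = n) :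
    IsPartition cake fun j : Fin k => blockAllocation n (Fin.cast hk j) := by
  subst hk
  have h := blockAllocation_isSharing hn
  exact ⟨fun j => h.portion j (Finset.mem_univ _), fun i j hij => h.disjoint
    (Finset.mem_coe.2 (Finset.mem_univ i)) (Finset.mem_coe.2 (Finset.mem_univ j)) hij,
    by simpa using h.cover⟩

theorem hasDGEF_loneDivider {n : ℕ} (hn : 3 ≤ n) : HasDGEF (loneDivider n) (2 * n - 2) := by
  refine .intro (isProportional_loneDivider (by omega))
    (fun V A hA => le_envyFreeCount_loneDivider (by omega) hA) ?_
  let d : Fin n := ⟨0, by omega⟩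
  -- The divider `d` is indifferent. Everybody else undervalues the block of `d`, overvalues the
  -- other foreign blocks and accepts the own one, so the first round serves all players.
  obtain ⟨V, -, h2, h3⟩ := exists_envy_example (by omega : 0 < n) (fun _ => d)
    (fun i => if i = d then ∅ else Finset.univ \ {d, i}) (fun i => by split_ifs <;> simp)
  have hself : ∀ i, V i (blockAllocation n i) = 1 / n := fun i => by
    refine h3 i i (by split_ifs <;> simp) ?_
    by_cases h : i = d
    · right
      simp [h]
    · exact Or.inl h
  have hd : ∀ j, V d (blockAllocation n j) = 1 / n := fun j =>
    h3 d j (by simp) (Or.inr (by simp))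
  have hcard : (Finset.univ : Finset (Fin n)).card = n := by simp
  refine ⟨V, blockAllocation n, ?_, ?_⟩
  · refine LoneDividerRun.round Finset.univ cake _ d
      (fun j => blockAllocation n (Fin.cast hcard j)) Finset.univ (Fin.cast hcard.symm)
      (isPartition_blockAllocation (by omega) hcard) (fun j => ?_) ?_ (fun L' _ _ hL' => ?_)
      (fun i _ => rfl) ?_
    · rw [hd, (V d).normalized, hcard]
    · refine ⟨Finset.mem_univ _, subset_rfl, (Fin.cast_injective _).injOn, fun i _ _ => ?_,
        fun i hi => ?_⟩
      · have h1 : V i cake / ((Finset.univ : Finset (Fin n)).card : ℝ) = 1 / n := by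
          rw [(V i).normalized, hcard]
        exact (h1.trans (hself i).symm).le
      · simp at hi
    · exact Finset.univ_subset_iff.1 hL'
    · rw [Finset.sdiff_self]
      exact .done _ _
  · refine (envyFreeCount_le_sum (T := fun i => if i = d then Finset.univ.erase d else {d})
      fun i j hij h => ?_).trans ?_
    · split_ifs with hi
      · exact Finset.mem_erase.2 ⟨hi ▸ hij.symm, Finset.mem_univ _⟩
      · by_contra hj
        have := h2 i j (by
          rw [if_neg hi]
          simp only [Finset.mem_sdiff, Finset.mem_univ, Finset.mem_insert, true_and]
          rw [Finset.mem_singleton] at hj ⊢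
          push Not
          exact ⟨hj, hij.symm⟩)
        rw [hself] at h
        linarith
    · rw [← Finset.add_sum_erase _ _ (Finset.mem_univ d), if_pos rfl,
        Finset.sum_congr rfl fun i hi => by rw [if_neg (Finset.ne_of_mem_erase hi)]]
      simp
      omega

end CakeCutting

namespace CakeCutting

open Set

/-! ### Cut Your Own Piece -/

section cutYourOwnPiece

variable {n : ℕ} {V : Fin n → Valuation} {m : Marks n}

lemma exists_isMarking (hn : 0 < n) (V : Fin n → Valuation) : ∃ m, IsMarking V m := by
  have hn' : (0 : ℝ) < n := by exact_mod_cast hn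
  -- The outer marks are chosen by hand because `IsMarking` requires them to be exactly `0` and `1`.
  have key : ∀ (i : Fin n) (j : Fin (n + 1)), ∃ x ∈ Icc (0 : ℝ) 1,
      V i (cake ∩ Iic x) = (j : ℝ) / n ∧ (j = 0 → x = 0) ∧ (j = Fin.last n → x = 1) := by
    intro i j
    by_cases h0 : j = 0
    · subst h0
      refine ⟨0, by simp, by rw [(V i).val_inter_Iic_zero isPortion_cake]; simp, fun _ => rfl,
        fun h => ?_⟩
      rw [Fin.ext_iff] at h
      simp only [Fin.val_zero, Fin.val_last] at h
      omega
    by_cases h1 : j = Fin.last n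
    · subst h1
      refine ⟨1, by simp, ?_, fun h => absurd h h0, fun _ => rfl⟩
      rw [Valuation.inter_Iic_one isPortion_cake, (V i).normalized, Fin.val_last, div_self hn'.ne']
    · obtain ⟨x, hx, hv⟩ := (V i).exists_cut isPortion_cake (α := (j : ℝ) / n) (by positivity) (by
        rw [(V i).normalized]
        refine div_le_one_of_le₀ ?_ hn'.le
        exact_mod_cast Nat.lt_succ_iff.1 j.2)
      exact ⟨x, hx, hv, fun h => absurd h h0, fun h => absurd h h1⟩
  choose m hm hv h0 h1 using key
  have hmono : ∀ i, Monotone (m i) := by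
    intro i
    refine Fin.monotone_iff_le_succ.2 fun j => ?_
    by_contra hc
    have := (V i).inter_Iic_mono isPortion_cake (not_le.1 hc).le
    simp only [hv] at this
    rw [div_le_div_iff_of_pos_right hn'] at this
    simp only [Fin.val_succ, Fin.val_castSucc] at this
    push_cast at this
    linarith
  refine ⟨m, fun i => ⟨h0 i 0 rfl, h1 i _ rfl, hmono i, fun j => ?_⟩⟩
  rw [← (V i).Ioc_eq_Icc (hm i _).1 (hm i _).2]
  have hsub := (V i).inter_Iic_sub isPortion_cake (hmono i (Fin.castSucc_lt_succ (i := j)).le)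
  have hcake : cake ∩ Ioc (m i j.castSucc) (m i j.succ) = Ioc (m i j.castSucc) (m i j.succ) :=
    inter_eq_right.2 (Ioc_subset_Icc_self.trans (Icc_subset_Icc (hm i _).1 (hm i _).2))
  rw [hv, hv, hcake] at hsub
  rw [← hsub, Fin.val_succ, Fin.val_castSucc]
  push_cast
  ring

lemma IsMarking.nonneg (hm : IsMarking V m) (i : Fin n) (j : Fin (n + 1)) : 0 ≤ m i j :=
  (hm i).1 ▸ (hm i).2.2.1 (Fin.zero_le j)

lemma IsMarking.le_one (hm : IsMarking V m) (i : Fin n) (j : Fin (n + 1)) : m i j ≤ 1 :=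
  (hm i).2.1 ▸ (hm i).2.2.1 (Fin.le_last j)

lemma IsMarking.strictMono (hm : IsMarking V m) (hn : 0 < n) (i : Fin n) : StrictMono (m i) := by
  refine Fin.strictMono_iff_lt_succ.2 fun j => ?_
  refine ((hm i).2.2.1 (Fin.castSucc_lt_succ (i := j)).le).lt_of_ne fun h => ?_
  have hv := (hm i).2.2.2 j
  rw [h, Icc_self, (V i).singleton ⟨hm.nonneg i _, hm.le_one i _⟩] at hv
  have : (0 : ℝ) < 1 / n := by positivity
  linarith

lemma IsLegal.fair {A : Fin n → Set ℝ} (hA : IsLegal m A) (hm : IsMarking V m) (i : Fin n) :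
    1 / (n : ℝ) ≤ V i (A i) := by
  obtain ⟨S, -, -, -, hdiv, -, h⟩ := hA
  obtain ⟨j, hj⟩ := h i
  rw [← (hm i).2.2.2 j, ← (V i).Ioo_eq_Icc (hm.nonneg i _) (hm.le_one i _)]
  exact (V i).mono (isPortion_Ioo (hm.nonneg i _) (hm.le_one i _)) (hdiv.1.1 i) hj

lemma IsStrategy.isProportional (hn : 0 < n) {T : CutStrategy n} (hT : IsStrategy T) :
    IsProportional (cutYourOwnPieceWith T) := by
  intro V
  constructor
  · obtain ⟨m, hm⟩ := exists_isMarking hn V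
    obtain ⟨A, hA⟩ := (hT V m hm).1
    exact ⟨A, m, hm, hA⟩
  · rintro A ⟨m, hm, hA⟩
    have h := (hT V m hm).2 A hA
    have hd := h
    obtain ⟨S, -, -, -, hdiv, -⟩ := hd
    exact ⟨hdiv, h.fair hm⟩

/-! ### The left-right strategy -/

lemma isSharing_Ioc_union {N : Finset (Fin n)} {A : Fin n → Set ℝ} {i : Fin n} {x y z : ℝ}
    (hxy : x ≤ y) (hyz : y ≤ z) (hi : IsPortion (A i)) (hA : A i = Ioc x y)
    (h : IsSharing N (Ioc y z) A) : IsSharing ({i} ∪ N) (Ioc x z) A := by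
  have := (IsSharing.singleton hi).union h
    (hA ▸ disjoint_left.2 fun a ha ha' => absurd ha'.1 (not_lt.2 ha.2))
  rwa [hA, Ioc_union_Ioc_eq_Ioc hxy hyz] at this

/-- The players in `U` get adjacent intervals one after another: at each step, a player whose next
mark is leftmost gets the interval that ends at this mark. -/
lemma exists_greedy_pieces (M : Fin n → ℕ → ℝ) {N : ℕ} {y : ℝ} (hy1 : y ≤ 1) (c : ℕ)
    (U : Finset (Fin n)) (hU : U.card = c + 1) (a : ℕ) (ha : a + U.card = N)
    (hmono : ∀ i ∈ U, ∀ q, a ≤ q → q < N → M i q < M i (q + 1)) {x : ℝ} (hx0 : 0 ≤ x)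
    (hx : ∀ i ∈ U, x ≤ M i a) (hy : ∀ i ∈ U, M i N ≤ y) :
    ∃ (A : Fin n → Set ℝ) (S : Finset ℝ), S.card = c ∧
      (∀ s ∈ S, x < s ∧ s < y ∧ ∃ i q, a < q ∧ q < N ∧ s = M i q) ∧
      (∀ i ∈ U, ∃ lo hi, A i = Ioc lo hi ∧ (lo = x ∨ lo ∈ S) ∧ (hi = y ∨ hi ∈ S)) ∧
      (∀ i ∈ U, ∃ q, a ≤ q ∧ q < N ∧ Ioo (M i q) (M i (q + 1)) ⊆ A i) ∧
      IsSharing U (Ioc x y) A := by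
  induction c generalizing U a x with
  | zero =>
    obtain ⟨i, rfl⟩ := Finset.card_eq_one.1 hU
    rw [Finset.card_singleton] at ha
    refine ⟨fun _ => Ioc x y, ∅, rfl, by simp, fun _ _ => ⟨x, y, rfl, Or.inl rfl, Or.inl rfl⟩,
      fun j hj => ⟨a, le_rfl, by omega, fun z hz => ?_⟩, .singleton (A := fun _ => Ioc x y) (isPortion_Ioc hx0 hy1)⟩
    rw [ha] at hz
    exact ⟨(hx j hj).trans_lt hz.1, hz.2.le.trans (hy j hj)⟩
  | succ c ih =>
    -- By minimality the new left end does not pass the `(a + 1)`-st mark of anybody else. Each step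
    -- thus uses up one mark of every player, and `a + U.card = N` ensures that there are enough of
    -- them.
    obtain ⟨i, hi, hmin⟩ := U.exists_min_image (fun i => M i (a + 1))
      (Finset.card_pos.1 (by omega))
    have hcard : (U.erase i).card = c + 1 := by
      rw [Finset.card_erase_of_mem hi]
      omega
    have hx' : x < M i (a + 1) := (hx i hi).trans_lt (hmono i hi a le_rfl (by omega))
    obtain ⟨A, S, hS, hSm, hAe, hAq, hA⟩ := ih (U.erase i) hcard (a + 1) (by omega)
      (fun j hj q hq => hmono j (Finset.mem_of_mem_erase hj) q (by omega)) (x := M i (a + 1))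
      (hx0.trans hx'.le) (fun j hj => hmin j (Finset.mem_of_mem_erase hj))
      (fun j hj => hy j (Finset.mem_of_mem_erase hj))
    -- A second player `j` gives strictness: `M i (a + 1) ≤ M j (a + 1) < M j N ≤ y`. The cut points
    -- have to lie strictly inside, so that they stay distinct from `x` and `y`.
    have hyi : M i (a + 1) < y := by
      obtain ⟨j, hj⟩ := Finset.card_pos.1 (by omega : 0 < (U.erase i).card)
      have hjU := Finset.mem_of_mem_erase hj
      have hlt : ∀ k, a + 1 + (k + 1) ≤ N → M j (a + 1) < M j (a + 1 + (k + 1)) := by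
        intro k
        induction k with
        | zero => exact fun hk => hmono j hjU (a + 1) (by omega) (by omega)
        | succ k ihk =>
          exact fun hk => (ihk (by omega)).trans (hmono j hjU (a + 1 + (k + 1)) (by omega) (by omega))
      have := hlt (N - a - 2) (by omega)
      rw [show a + 1 + (N - a - 2 + 1) = N by omega] at this
      exact ((hmin j hjU).trans_lt this).trans_le (hy j hjU)
    have hne : ∀ j ∈ U.erase i, Function.update A i (Ioc x (M i (a + 1))) j = A j :=
      fun j hj => Function.update_of_ne (Finset.ne_of_mem_erase hj) _ _
    have hself : Function.update A i (Ioc x (M i (a + 1))) i = Ioc x (M i (a + 1)) :=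
      Function.update_self _ _ _
    refine ⟨Function.update A i (Ioc x (M i (a + 1))), insert (M i (a + 1)) S, ?_, ?_, ?_, ?_, ?_⟩
    · rw [Finset.card_insert_of_notMem fun h => lt_irrefl _ (hSm _ h).1, hS]
    · intro s hs
      rcases Finset.mem_insert.1 hs with rfl | hs
      · exact ⟨hx', hyi, i, a + 1, by omega, by omega, rfl⟩
      · obtain ⟨h1, h2, j, q, hq1, hq2, h3⟩ := hSm s hs
        exact ⟨hx'.trans h1, h2, j, q, by omega, hq2, h3⟩
    · intro j hj
      by_cases hji : j = i
      · subst hji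
        exact ⟨x, _, hself, Or.inl rfl, Or.inr (Finset.mem_insert_self _ _)⟩
      · have hj' := Finset.mem_erase.2 ⟨hji, hj⟩
        obtain ⟨lo, hi', h1, h2, h3⟩ := hAe j hj'
        refine ⟨lo, hi', (hne j hj').trans h1, Or.inr ?_, h3.imp id (Finset.mem_insert_of_mem ·)⟩
        rcases h2 with rfl | h2
        exacts [Finset.mem_insert_self _ _, Finset.mem_insert_of_mem h2]
    · intro j hj
      by_cases hji : j = i
      · subst hji
        refine ⟨a, le_rfl, by omega, ?_⟩
        rw [hself]
        exact fun z hz => ⟨(hx j hj).trans_lt hz.1, hz.2.le⟩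
      · have hj' := Finset.mem_erase.2 ⟨hji, hj⟩
        obtain ⟨q, hq1, hq2, hq⟩ := hAq j hj'
        rw [hne j hj']
        exact ⟨q, by omega, hq2, hq⟩
    · have := isSharing_Ioc_union hx'.le hyi.le
        (by rw [hself]; exact isPortion_Ioc hx0 (hyi.le.trans hy1)) hself
        (hA.congr fun j hj => (hne j hj).symm)
      rwa [← Finset.insert_eq, Finset.insert_erase hi] at this

lemma ofNat_val {q : ℕ} (hq : q ≤ n) : (Fin.ofNat (n + 1) q).val = q :=
  Nat.mod_eq_of_lt (by omega)

lemma ofNat_one (n : ℕ) : (Fin.ofNat (n + 1) 1) = 1 := rfl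

lemma ofNat_pred (hn : 0 < n) : (Fin.ofNat (n + 1) (n - 1)) = Fin.rev 1 := by
  ext
  rw [ofNat_val (by omega), Fin.val_rev, ← ofNat_one, ofNat_val (by omega)]
  omega

lemma ofNat_castSucc {q : ℕ} (hq : q < n) : Fin.ofNat (n + 1) q = Fin.castSucc ⟨q, hq⟩ := by
  ext
  rw [ofNat_val hq.le]
  rfl

lemma ofNat_succ {q : ℕ} (hq : q < n) : Fin.ofNat (n + 1) (q + 1) = Fin.succ ⟨q, hq⟩ := by
  ext
  rw [ofNat_val hq]
  rfl

/-- By the choice of `l` and `r`, the first mark of every other player is not left of `x`, and the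
last mark is not right of `y`. So the greedy procedure works between these points with `a = 1` and
`N = n - 1`. Its `n - 3` cuts together with `x` and `y` make `n - 1`. -/
lemma leftRight_nonempty (hn : 3 ≤ n) (hm : IsMarking V m) : (leftRight n m).Nonempty := by
  classical
  have hne : (Finset.univ : Finset (Fin n)).Nonempty := ⟨⟨0, by omega⟩, Finset.mem_univ _⟩
  obtain ⟨l, -, hl⟩ := Finset.univ.exists_min_image (fun i => m i 1) hne
  have hc1 : (Finset.univ.erase l).card = n - 1 := by simp
  obtain ⟨r, hr, hr'⟩ := (Finset.univ.erase l).exists_max_image (fun i => m i (Fin.rev 1))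
    (Finset.card_pos.1 (by omega))
  have hrl := Finset.ne_of_mem_erase hr
  set U := (Finset.univ.erase l).erase r with hUdef
  have hU : U.card = n - 2 := by
    rw [Finset.card_erase_of_mem hr]
    omega
  have hmem : ∀ i, i ∈ U ↔ i ≠ r ∧ i ≠ l := by
    intro i
    simp [hUdef]
  let M : Fin n → ℕ → ℝ := fun i q => m i (Fin.ofNat (n + 1) q)
  have hM1 : ∀ i, M i 1 = m i 1 := fun i => rfl
  have hMn : ∀ i, M i (n - 1) = m i (Fin.rev 1) := fun i => congrArg _ (ofNat_pred (by omega))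
  have hMlt : ∀ i p q, p < q → q ≤ n → M i p < M i q := fun i p q hpq hq =>
    hm.strictMono (by omega) i (by rw [Fin.lt_def, ofNat_val (by omega), ofNat_val hq]; exact hpq)
  set x := m l 1
  set y := m r (Fin.rev 1)
  have hxm : ∀ i, x ≤ M i 1 := fun i => hl i (Finset.mem_univ i)
  have hym : ∀ i, i ≠ l → M i (n - 1) ≤ y := fun i hi => by
    rw [hMn]
    exact hr' i (Finset.mem_erase.2 ⟨hi, Finset.mem_univ i⟩)
  obtain ⟨A, S, hS, hSm, hAe, hAq, hA⟩ := exists_greedy_pieces M (N := n - 1) (hm.le_one r (Fin.rev 1))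
    (n - 3) U (by omega) 1 (by omega) (fun i _ q _ hq => hMlt i q (q + 1) (by omega) (by omega))
    (hm.nonneg l 1) (fun i _ => hxm i) fun i hi => hym i ((hmem i).1 hi).2
  have hxy : x < y := by
    refine ((hxm r).trans_lt (hMlt r 1 (n - 1) (by omega) (by omega))).trans_le ?_
    exact hym r hrl
  let A' : Fin n → Set ℝ := fun i => if i = l then Icc 0 x else if i = r then Ioc y 1 else A i
  have hAl : A' l = Icc 0 x := if_pos rfl
  have hAr : A' r = Ioc y 1 := (if_neg hrl).trans (if_pos rfl)
  have hAU : ∀ i ∈ U, A i = A' i := fun i hi => by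
    rw [hmem] at hi
    simp only [A']
    rw [if_neg hi.2, if_neg hi.1]
  have hx0 : 0 ≤ x := hm.nonneg l 1
  have hy1 : y ≤ 1 := hm.le_one r _
  have hcases : ∀ i, i = l ∨ i = r ∨ i ∈ U := fun i => by
    rw [hmem]
    tauto
  have hlpiece : Ioo (m l (Fin.castSucc ⟨0, by omega⟩)) (m l (Fin.succ ⟨0, by omega⟩)) ⊆ A' l := by
    have h0 : m l (Fin.castSucc ⟨0, by omega⟩) = 0 := (hm l).1
    have h1 : m l (Fin.succ ⟨0, by omega⟩) = x := by
      rw [← ofNat_succ (n := n) (q := 0) (by omega)]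
      exact hM1 l
    rw [hAl, h0, h1]
    exact Ioo_subset_Icc_self
  have hrpiece : Ioo (m r (Fin.castSucc ⟨n - 1, by omega⟩)) (m r (Fin.succ ⟨n - 1, by omega⟩)) ⊆
      A' r := by
    have h0 : m r (Fin.castSucc ⟨n - 1, by omega⟩) = y := by
      rw [← ofNat_castSucc (n := n) (by omega)]
      exact hMn r
    rw [hAr, h0]
    exact fun z hz => ⟨hz.1, hz.2.le.trans (hm.le_one r _)⟩
  have hsh : IsSharing Finset.univ cake A' := by
    have h1 : IsSharing (U ∪ {r}) (Ioc x 1) A' := by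
      have hp : IsPortion (A' r) := hAr ▸ isPortion_Ioc (hx0.trans hxy.le) le_rfl
      have := (hA.congr hAU).union (IsSharing.singleton hp)
        (hAr ▸ disjoint_left.2 fun a ha ha' => absurd ha'.1 (not_lt.2 ha.2))
      rwa [hAr, Ioc_union_Ioc_eq_Ioc hxy.le hy1] at this
    have hp : IsPortion (A' l) := hAl ▸ isPortion_Icc le_rfl (hxy.le.trans hy1)
    have h2 := (IsSharing.singleton hp).union h1
      (hAl ▸ disjoint_left.2 fun a ha ha' => absurd ha'.1 (not_lt.2 ha.2))
    rw [hAl, Icc_union_Ioc_eq_Icc hx0 (hxy.le.trans hy1)] at h2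
    have huniv : {l} ∪ (U ∪ {r}) = Finset.univ := by
      ext i
      have := hcases i
      simp only [Finset.mem_univ, Finset.mem_union, Finset.mem_singleton, iff_true]
      tauto
    rwa [huniv] at h2
  have hpieces : ∀ i, ∃ j : Fin n, Ioo (m i j.castSucc) (m i j.succ) ⊆ A' i := by
    intro i
    rcases hcases i with rfl | rfl | hi
    · exact ⟨_, hlpiece⟩
    · exact ⟨_, hrpiece⟩
    · obtain ⟨q, -, hq, h⟩ := hAq i hi
      refine ⟨⟨q, by omega⟩, ?_⟩
      rw [← ofNat_castSucc (n := n) (by omega), ← ofNat_succ (n := n) (by omega), ← hAU i hi]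
      exact h
  refine ⟨A', l, r, hrl.symm, hxm, fun i hi => by rw [← hMn]; exact hym i hi, hAl, hAr,
    insert x (insert y S), ?_, ?_, ?_, ?_, hpieces⟩
  · have hyS : y ∉ S := fun h => lt_irrefl _ (hSm y h).2.1
    have hxS : x ∉ insert y S := fun h => by
      rcases Finset.mem_insert.1 h with h | h
      exacts [hxy.ne h, lt_irrefl _ (hSm x h).1]
    rw [Finset.card_insert_of_notMem hxS, Finset.card_insert_of_notMem hyS, hS]
    omega
  · have hmark : ∀ i q, 0 < q → q < n →
        ∃ (i' : Fin n) (j : Fin (n + 1)), j ≠ 0 ∧ j ≠ Fin.last n ∧ M i q = m i' j := by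
      refine fun i q h1 h2 => ⟨i, _, ?_, ?_, rfl⟩ <;>
      · intro h
        rw [Fin.ext_iff, ofNat_val h2.le] at h
        simp only [Fin.val_zero, Fin.val_last] at h
        omega
    intro s hs
    rcases Finset.mem_insert.1 hs with rfl | hs
    · exact hmark l 1 (by omega) (by omega)
    rcases Finset.mem_insert.1 hs with rfl | hs
    · have := hmark r (n - 1) (by omega) (by omega)
      rwa [hMn] at this
    · obtain ⟨-, -, i, q, h1, h2, rfl⟩ := hSm s hs
      exact hmark i q (by omega) (by omega)
  · refine ⟨⟨fun i => hsh.portion i (Finset.mem_univ i), fun i j hij => hsh.disjoint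
      (Finset.mem_coe.2 (Finset.mem_univ i)) (Finset.mem_coe.2 (Finset.mem_univ j)) hij,
      by simpa using hsh.cover⟩, fun i => ?_⟩
    obtain ⟨j, hj⟩ := hpieces i
    exact (nonempty_Ioo.2 (hm.strictMono (by omega) i Fin.castSucc_lt_succ)).mono hj
  · intro i a ha b hb hab
    have hS' : ∀ s, s = x ∨ s = y ∨ s ∈ S → (a ≤ s ↔ b ≤ s) := fun s hs =>
      hab s (by simpa only [Finset.mem_insert] using hs)
    rcases hcases i with rfl | rfl | hi
    · rw [hAl] at ha ⊢
      exact ⟨hb.1, (hS' x (by simp)).1 ha.2⟩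
    · rw [hAr] at ha ⊢
      exact ⟨not_le.1 fun h => absurd ((hS' y (by simp)).2 h) (not_le.2 ha.1), hb.2⟩
    · obtain ⟨lo, hi', h1, h2, h3⟩ := hAe i hi
      rw [← hAU i hi, h1] at ha ⊢
      refine ⟨not_le.1 fun h => absurd ((hS' lo (by tauto)).2 h) (not_le.2 ha.1),
        (hS' hi' (by tauto)).1 ha.2⟩

lemma isStrategy_leftRight (hn : 3 ≤ n) : IsStrategy (leftRight n) := by
  refine fun V m hm => ⟨leftRight_nonempty hn hm, ?_⟩
  rintro A ⟨l, r, -, -, -, -, -, S, hS, hA⟩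
  exact ⟨S, hS.ge, by omega, hA⟩

lemma isStrategy_isLegal (hn : 3 ≤ n) : IsStrategy (fun m : Marks n => {A | IsLegal m A}) := by
  intro V m hm
  obtain ⟨A, hA⟩ := leftRight_nonempty hn hm
  exact ⟨⟨A, (isStrategy_leftRight hn V m hm).2 A hA⟩, fun A hA => hA⟩

/-- The portion of `l` lies in everybody's first marked interval, and that of `r` in the last marked
interval of everybody but `l`. So these portions are worth at most `1 / n` to the players concerned.
Averaging supplies the one relation from `l`. -/
lemma le_envyFreeCount_leftRight (hn : 3 ≤ n) {A : Fin n → Set ℝ}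
    (hA : A ∈ cutYourOwnPieceWith (leftRight n) V) : 2 * n - 2 ≤ envyFreeCount V A := by
  classical
  have hdiv := (IsStrategy.isProportional (by omega) (isStrategy_leftRight hn) V).2 A hA
  obtain ⟨m, hm, l, r, hlr, hl, hr, hAl, hAr, -⟩ := hA
  have hone := hdiv.1.one_le_card_unenvied (by omega) (hdiv.2 l)
  have hleft : ∀ i, V i (A l) ≤ V i (A i) := by
    intro i
    refine le_trans ?_ (hdiv.2 i)
    rw [← (hm i).2.2.2 ⟨0, by omega⟩, hAl]
    have h0 : m i (Fin.castSucc ⟨0, by omega⟩) = 0 := (hm i).1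
    have h1 : m i (Fin.succ ⟨0, by omega⟩) = m i 1 := by
      rw [← ofNat_succ (n := n) (q := 0) (by omega)]
      rfl
    rw [h0, h1]
    exact (V i).mono (isPortion_Icc le_rfl (hm.le_one _ _)) (isPortion_Icc le_rfl (hm.le_one _ _))
      (Icc_subset_Icc le_rfl (hl i))
  have hright : ∀ i, i ≠ l → V i (A r) ≤ V i (A i) := by
    intro i hi
    refine le_trans ?_ (hdiv.2 i)
    rw [← (hm i).2.2.2 ⟨n - 1, by omega⟩, hAr]
    have h0 : m i (Fin.castSucc ⟨n - 1, by omega⟩) = m i (Fin.rev 1) := by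
      rw [← ofNat_castSucc (n := n) (by omega), ofNat_pred (by omega)]
    have h1 : m i (Fin.succ ⟨n - 1, by omega⟩) = 1 := by
      rw [← (hm i).2.1]
      congr 1
      ext
      simp
      omega
    rw [h0, h1]
    exact (V i).mono (isPortion_Ioc (hm.nonneg _ _) le_rfl) (isPortion_Icc (hm.nonneg _ _) le_rfl)
      (Ioc_subset_Icc_self.trans (Icc_subset_Icc (hr i hi) le_rfl))
  rw [envyFreeCount_eq_sum, ← Finset.add_sum_erase _ _ (Finset.mem_univ l),
    ← Finset.add_sum_erase _ _ (Finset.mem_erase.2 ⟨hlr.symm, Finset.mem_univ r⟩)]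
  have hr1 : 1 ≤ (unenvied V A r Finset.univ).card :=
    Finset.card_pos.2 ⟨l, mem_unenvied.2 ⟨Finset.mem_univ _, hlr.symm, hleft r⟩⟩
  have hcard : ((Finset.univ.erase l).erase r).card = n - 2 := by
    rw [Finset.card_erase_of_mem (Finset.mem_erase.2 ⟨hlr.symm, Finset.mem_univ r⟩)]
    simp
    omega
  have hrest : ((Finset.univ.erase l).erase r).card * 2 ≤
      ∑ i ∈ (Finset.univ.erase l).erase r, (unenvied V A i Finset.univ).card := by
    rw [← smul_eq_mul, ← Finset.sum_const]
    refine Finset.sum_le_sum fun i hi => ?_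
    have hir := Finset.ne_of_mem_erase hi
    have hil := Finset.ne_of_mem_erase (Finset.mem_of_mem_erase hi)
    rw [← Finset.card_pair hlr]
    refine Finset.card_le_card fun j hj => mem_unenvied.2 ⟨Finset.mem_univ _, ?_⟩
    rcases Finset.mem_insert.1 hj with rfl | hj
    · exact ⟨hil, hleft i⟩
    · rw [Finset.mem_singleton.1 hj]
      exact ⟨hir, hright i hil⟩
  omega

end cutYourOwnPiece

end CakeCutting

namespace CakeCutting

open Set

/-! ### Cut Your Own Piece: marks that admit few legal allocations -/

/-- The `q`-th mark of player `i`, in units of `1 / n ^ 2`. -/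
def markPos (n i q : ℕ) : ℕ := if q = 0 then 0 else if q = n then n * n else q * n + i

lemma markPos_zero (n i : ℕ) : markPos n i 0 = 0 := if_pos rfl

lemma markPos_last {n : ℕ} (hn : 0 < n) (i : ℕ) : markPos n i n = n * n := by
  rw [markPos, if_neg hn.ne', if_pos rfl]

lemma markPos_mid {n q : ℕ} (h0 : 0 < q) (h1 : q < n) (i : ℕ) : markPos n i q = q * n + i := by
  rw [markPos, if_neg h0.ne', if_neg h1.ne]

lemma markPos_le {n i q : ℕ} : markPos n i q ≤ q * n + i := by
  unfold markPos
  split_ifs with h1 h2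
  · exact Nat.zero_le _
  · subst h2
    exact Nat.le_add_right _ _
  · exact le_rfl

lemma le_markPos {n i q : ℕ} : q * n ≤ markPos n i q := by
  unfold markPos
  split_ifs with h1 h2
  · simp [h1]
  · simp [h2]
  · exact Nat.le_add_right _ _

lemma markPos_le_sq {n i q : ℕ} (hi : i < n) (hq : q ≤ n) : markPos n i q ≤ n * n := by
  rcases hq.eq_or_lt with rfl | hq
  · rw [markPos_last (by omega)]
  · refine markPos_le.trans ?_
    nlinarith

lemma markPos_lt {n i q : ℕ} (hi : i < n) : markPos n i q < markPos n i (q + 1) := by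
  rcases q.eq_zero_or_pos with rfl | hq
  · rw [markPos_zero]
    have := le_markPos (n := n) (i := i) (q := 0 + 1)
    omega
  · have h1 : markPos n i q ≤ q * n + i := markPos_le
    have h2 : (q + 1) * n ≤ markPos n i (q + 1) := le_markPos
    rw [add_mul] at h2
    omega

/-- The marks at the positions `markPos n i q / n ^ 2`. -/
noncomputable def tightMarks (n : ℕ) : Marks n :=
  fun i j => (markPos n i j : ℝ) / (n * n : ℕ)

section tightMarks

variable {n : ℕ}

/-- Intervals that both contain the cell `b` share its midpoint, so they cannot lie in the portions
of different players. -/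
lemma overlap_false {A : Fin n → Set ℝ} (hA : IsDivision A) {i i' j j' : Fin n} (hne : i ≠ i')
    (hj : Ioo (tightMarks n i j.castSucc) (tightMarks n i j.succ) ⊆ A i)
    (hj' : Ioo (tightMarks n i' j'.castSucc) (tightMarks n i' j'.succ) ⊆ A i') (b : ℕ)
    (h1 : markPos n i j ≤ b) (h2 : b < markPos n i (j + 1))
    (h3 : markPos n i' j' ≤ b) (h4 : b < markPos n i' (j' + 1)) : False := by
  have hn : (0 : ℝ) < (n * n : ℕ) := by
    have := i.pos
    positivity
  have key : ∀ p q : ℕ, p ≤ b → b < q →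
      ((b : ℝ) + 1 / 2) / (n * n : ℕ) ∈ Ioo ((p : ℝ) / (n * n : ℕ)) ((q : ℝ) / (n * n : ℕ)) := by
    intro p q hp hq
    have hp' : (p : ℝ) ≤ b := by exact_mod_cast hp
    have hq' : (b : ℝ) + 1 ≤ q := by exact_mod_cast hq
    constructor <;> rw [div_lt_div_iff_of_pos_right hn] <;> linarith
  exact Set.disjoint_left.1 (hA.1.2.1 i i' hne) (hj (key _ _ h1 h2)) (hj' (key _ _ h3 h4))

/-- In every legal allocation for these marks, player `i` gets the `i`-th interval that `i`
marked. -/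
lemma IsLegal.own_interval {A : Fin n → Set ℝ} (h : IsLegal (tightMarks n) A) (i : Fin n) :
    Ioo (tightMarks n i i.castSucc) (tightMarks n i i.succ) ⊆ A i := by
  obtain ⟨S, -, -, -, hdiv, -, hJ⟩ := h
  choose J hJ using hJ
  have hmulstep : ∀ q : ℕ, (q + 1) * n = q * n + n := fun q => by ring
  -- All intervals with the same number `j` contain the cell `j * n + (n - 1)`.
  have hinj : Function.Injective J := by
    intro i i' hii
    by_contra hne
    have hb : ∀ i : Fin n, markPos n i (J i) ≤ J i * n + (n - 1) ∧
        J i * n + (n - 1) < markPos n i (J i + 1) := by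
      intro i
      have h1 := markPos_le (n := n) (i := i) (q := J i)
      have h2 := le_markPos (n := n) (i := i) (q := J i + 1)
      rw [hmulstep] at h2
      have := i.2
      omega
    have h1 := hb i
    have h2 := hb i'
    rw [hii] at h1
    exact overlap_false hdiv hne (hJ i) (hJ i') _ (hii ▸ h1.1) (hii ▸ h1.2) h2.1 h2.2
  have hbij : Function.Bijective J := Finite.injective_iff_bijective.1 hinj
  let σ := (Equiv.ofBijective J hbij).symm
  have hJσ : ∀ j, J (σ j) = j := fun j => (Equiv.ofBijective J hbij).apply_symm_apply j
  -- The marks move to the right with the player. If the owner of interval `j + 1` preceded the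
  -- owner of interval `j`, these intervals would overlap. An increasing permutation is the
  -- identity.
  have hmono : StrictMono σ := by
    obtain ⟨n, rfl⟩ : ∃ m, n = m + 1 := ⟨n - 1, by have := i.pos; omega⟩
    refine Fin.strictMono_iff_lt_succ.2 fun j => ?_
    by_contra hcon
    have hne : σ j.succ ≠ σ j.castSucc := fun h => by
      have := σ.injective h
      rw [Fin.ext_iff] at this
      simp at this
    have hlt : (σ j.succ).val < (σ j.castSucc).val := lt_of_le_of_ne (not_lt.1 hcon)
      fun h => hne (Fin.ext h)
    have e1 : (J (σ j.castSucc)).val = j := by rw [hJσ]; rfl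
    have e2 : (J (σ j.succ)).val = j + 1 := by rw [hJσ]; rfl
    have hj := j.2
    have hs := (σ j.castSucc).2
    have hpos := markPos_mid (n := n + 1) (q := j + 1) (by omega) (by omega)
    refine overlap_false hdiv hne (hJ _) (hJ _) ((j + 1) * (n + 1) + (σ j.succ).val) ?_ ?_ ?_ ?_
    · rw [e2, hpos]
    · rw [e2]
      refine lt_of_lt_of_le ?_ (le_markPos (q := j.val + 1 + 1))
      rw [hmulstep (j + 1)]
      omega
    · rw [e1]
      refine (markPos_le (q := j.val)).trans ?_
      rw [hmulstep j]
      omega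
    · rw [e1, hpos]
      omega
  have hid : (σ : Fin n → Fin n) = id := StrictMono.range_inj hmono strictMono_id |>.1 (by
    rw [σ.surjective.range_eq, range_id])
  have hi : J i = i := by
    have := hJσ i
    rwa [show σ i = i from congrFun hid i] at this
  have := hJ i
  rwa [hi] at this

/-! ### Cut Your Own Piece: valuations for these marks -/

/-- Displacement, in small units, of the value to the left of the `q`-th mark of player `k`, as
seen by player `i`. -/
def markShift (n i q k : ℕ) : ℤ :=
  if q ≤ i then
    if q ≤ k then (n + 2) * ((k : ℤ) - i) else (n + 2) * ((q : ℤ) - i) + ((k : ℤ) - q)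
  else
    if k < q then (n + 2) * ((k : ℤ) - i) else (n + 2) * ((q : ℤ) - 1 - i) + ((k : ℤ) - q + 1)

lemma markShift_self (n i q : ℕ) : markShift n i q i = 0 := by
  unfold markShift
  split_ifs <;> omega

lemma markShift_lt (n i q k : ℕ) : markShift n i q k < markShift n i q (k + 1) := by
  unfold markShift
  have hn : (0 : ℤ) ≤ n := Nat.cast_nonneg _
  push_cast
  split_ifs with h1 h2 h3 h2 h2 h3 h4
  · linarith
  · omega
  · obtain rfl : q = k + 1 := by omega
    push_cast
    linarith
  · linarith
  · linarith
  · obtain rfl : q = k + 1 := by omega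
    push_cast
    linarith
  · omega
  · linarith

lemma abs_markShift_le {n i q k : ℕ} (hi : i < n) (hq : q < n) (hk : k < n) :
    |markShift n i q k| ≤ n * (n + 3) := by
  have key : ∀ a b : ℤ, |a| ≤ n → |b| ≤ n → |(n + 2) * a + b| ≤ n * (n + 3) := by
    intro a b ha hb
    calc |(n + 2) * a + b| ≤ |((n : ℤ) + 2) * a| + |b| := abs_add_le _ _
      _ ≤ (n + 2) * n + n := by
        rw [abs_mul, abs_of_nonneg (by positivity : (0 : ℤ) ≤ n + 2)]
        gcongr
      _ = n * (n + 3) := by ring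
  have h0 : |(0 : ℤ)| ≤ n := by simp
  unfold markShift
  split_ifs
  · have := key (k - i) 0 (by rw [abs_le]; omega) h0
    rwa [add_zero] at this
  · exact key _ _ (by rw [abs_le]; omega) (by rw [abs_le]; omega)
  · have := key (k - i) 0 (by rw [abs_le]; omega) h0
    rwa [add_zero] at this
  · exact key _ _ (by rw [abs_le]; omega) (by rw [abs_le]; omega)

/-- The small unit. -/
noncomputable def shiftUnit (n : ℕ) : ℝ := 1 / (4 * n * (n * (n + 3)))

lemma shiftUnit_pos (hn : 0 < n) : 0 < shiftUnit n := by
  unfold shiftUnit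
  positivity

lemma shiftUnit_mul (hn : 0 < n) : shiftUnit n * (n * (n + 3)) = 1 / n / 4 := by
  unfold shiftUnit
  field_simp

/-- The value of the part of the cake to the left of the position `q * n + k`, as seen by `i`. If
`θ` holds, then nearly all the value of the `0`-th interval is in the gap after its first part. -/
noncomputable def markValue (n i : ℕ) (θ : Prop) [Decidable θ] (q k : ℕ) : ℝ :=
  if q = 0 then k * shiftUnit n
  else if q = n then 1
  else if θ ∧ q = 1 ∧ k = 0 then n * shiftUnit n
  else (q : ℝ) / n + shiftUnit n * markShift n i q k

section markValue

variable {i : ℕ} {θ : Prop} [Decidable θ]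

lemma markValue_zero (k : ℕ) : markValue n i θ 0 k = k * shiftUnit n := if_pos rfl

lemma markValue_last (hn : 0 < n) (k : ℕ) : markValue n i θ n k = 1 := by
  rw [markValue, if_neg hn.ne', if_pos rfl]

lemma markValue_mid {q k : ℕ} (h0 : 0 < q) (h1 : q < n) (h : ¬(θ ∧ q = 1 ∧ k = 0)) :
    markValue n i θ q k = (q : ℝ) / n + shiftUnit n * markShift n i q k := by
  rw [markValue, if_neg h0.ne', if_neg h1.ne, if_neg h]

lemma markValue_special (hn : 1 < n) (h : θ) : markValue n i θ 1 0 = n * shiftUnit n := by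
  rw [markValue, if_neg one_ne_zero, if_neg hn.ne, if_pos ⟨h, rfl, rfl⟩]

lemma abs_shift_le (hi : i < n) {q k : ℕ} (hq : q < n) (hk : k < n) :
    |shiftUnit n * markShift n i q k| ≤ 1 / n / 4 := by
  have hn : 0 < n := by omega
  rw [abs_mul, abs_of_pos (shiftUnit_pos hn), ← shiftUnit_mul hn]
  refine mul_le_mul_of_nonneg_left ?_ (shiftUnit_pos hn).le
  exact_mod_cast abs_markShift_le hi hq hk

lemma mul_shiftUnit_le (hn : 0 < n) : n * shiftUnit n ≤ 1 / n / 4 := by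
  rw [← shiftUnit_mul hn, mul_comm]
  refine mul_le_mul_of_nonneg_left ?_ (shiftUnit_pos hn).le
  have : (1 : ℝ) ≤ n := by exact_mod_cast hn
  nlinarith

lemma markValue_lt (hi : i < n) {q k : ℕ} (hq : q < n) (hk : k + 1 < n) :
    markValue n i θ q k < markValue n i θ q (k + 1) := by
  have hn : 0 < n := by omega
  have hε := shiftUnit_pos hn
  rcases q.eq_zero_or_pos with rfl | hq0
  · rw [markValue_zero, markValue_zero]
    push_cast
    linarith
  rw [markValue_mid (k := k + 1) hq0 hq (by omega)]
  by_cases h : θ ∧ q = 1 ∧ k = 0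
  · obtain ⟨h1, rfl, rfl⟩ := h
    rw [markValue_special hq h1]
    have h2 := neg_le_of_abs_le (abs_shift_le hi hq hk)
    have h3 := mul_shiftUnit_le hn
    have h4 : (0 : ℝ) < 1 / n := by positivity
    push_cast
    linarith
  · rw [markValue_mid hq0 hq h]
    have : (markShift n i q k : ℝ) < markShift n i q (k + 1) := by
      exact_mod_cast markShift_lt n i q k
    have := mul_lt_mul_of_pos_left this hε
    linarith

/-- Displacements are at most a quarter of the distance `1 / n` between consecutive levels, so the
value also grows from one `q` to the next. For the exceptional value at `q = 1`, `k = 0` it grows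
from `n - 1` to `n` units. -/
lemma markValue_carry (hi : i < n) (hn : 1 < n) {q : ℕ} (hq : q < n) :
    markValue n i θ q (n - 1) < markValue n i θ (q + 1) 0 := by
  have hn0 : 0 < n := by omega
  have hε := shiftUnit_pos hn0
  have h4 : (0 : ℝ) < 1 / n := by positivity
  have h3 := mul_shiftUnit_le hn0
  have hle : markValue n i θ q (n - 1) ≤ (q : ℝ) / n + 1 / n / 4 := by
    rcases q.eq_zero_or_pos with rfl | hq0
    · rw [markValue_zero, Nat.cast_sub hn0]
      push_cast
      rw [zero_div]
      linarith
    · rw [markValue_mid hq0 hq (by omega)]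
      have := le_of_abs_le (abs_shift_le hi hq (by omega : n - 1 < n))
      linarith
  rcases (by omega : q + 1 ≤ n).eq_or_lt with h | h
  · refine hle.trans_lt ?_
    have hq' : (q : ℝ) / n = 1 - 1 / n := by
      have : (n : ℝ) = q + 1 := by exact_mod_cast h.symm
      rw [eq_sub_iff_add_eq, ← add_div, ← this, div_self (by positivity)]
    rw [h, markValue_last hn0, hq']
    linarith
  · by_cases hsp : θ ∧ q + 1 = 1 ∧ 0 = 0
    · obtain rfl : q = 0 := by omega
      rw [zero_add, markValue_special hn hsp.1, markValue_zero, Nat.cast_sub hn0]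
      push_cast
      linarith
    · rw [markValue_mid (by omega) h hsp]
      have := neg_le_of_abs_le (abs_shift_le hi h hn0)
      push_cast
      rw [add_div]
      linarith

/-- The value to the left of a position. -/
noncomputable def cutValue (n i : ℕ) (θ : Prop) [Decidable θ] (b : ℕ) : ℝ :=
  markValue n i θ (b / n) (b % n)

lemma cutValue_eq {q k : ℕ} (hk : k < n) : cutValue n i θ (q * n + k) = markValue n i θ q k := by
  rw [cutValue, mul_comm, Nat.mul_add_div (by omega), Nat.div_eq_of_lt hk, add_zero,
    Nat.mul_add_mod, Nat.mod_eq_of_lt hk]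

lemma cutValue_zero (hn : 0 < n) : cutValue n i θ 0 = 0 := by
  have := cutValue_eq (i := i) (θ := θ) (q := 0) hn
  rw [zero_mul, add_zero, markValue_zero] at this
  simpa using this

lemma cutValue_last (hn : 0 < n) : cutValue n i θ (n * n) = 1 := by
  have := cutValue_eq (i := i) (θ := θ) (q := n) hn
  rwa [add_zero, markValue_last hn] at this

lemma cutValue_lt (hi : i < n) (hn : 1 < n) {b : ℕ} (hb : b < n * n) :
    cutValue n i θ b < cutValue n i θ (b + 1) := by
  have hq : b / n < n := Nat.div_lt_of_lt_mul hb
  have hk := Nat.mod_lt b (by omega : 0 < n)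
  have hdm := Nat.div_add_mod' b n
  generalize b / n = q at *
  generalize b % n = k at *
  subst hdm
  rcases (by omega : k + 1 ≤ n).eq_or_lt with h | h
  · rw [add_assoc, h, cutValue_eq hk, show q * n + n = (q + 1) * n + 0 by ring,
      cutValue_eq (by omega)]
    obtain rfl : k = n - 1 := by omega
    exact markValue_carry hi hn hq
  · rw [add_assoc, cutValue_eq hk, cutValue_eq h]
    exact markValue_lt hi hq h

lemma cutValue_markPos (hi : i < n) (hθ : θ → 0 < i) {q : ℕ} (hq : q ≤ n) :
    cutValue n i θ (markPos n i q) = (q : ℝ) / n := by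
  have hn : 0 < n := by omega
  rcases q.eq_zero_or_pos with rfl | hq0
  · rw [markPos_zero, cutValue_zero hn]
    simp
  rcases hq.eq_or_lt with rfl | hq
  · rw [markPos_last hn, cutValue_last hn, div_self (by positivity)]
  · rw [markPos_mid hq0 hq, cutValue_eq hi, markValue_mid hq0 hq (by
      rintro ⟨h1, -, h2⟩
      have := hθ h1
      omega), markShift_self]
    simp

/-- The value that `i` assigns to the `k`-th interval marked by `k`. -/
noncomputable def intervalValue (n i : ℕ) (θ : Prop) [Decidable θ] (k : ℕ) : ℝ :=
  cutValue n i θ (markPos n k (k + 1)) - cutValue n i θ (markPos n k k)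

lemma intervalValue_self (hi : i < n) (hθ : θ → 0 < i) : intervalValue n i θ i = 1 / n := by
  rw [intervalValue, cutValue_markPos hi hθ hi, cutValue_markPos hi hθ hi.le]
  push_cast
  ring

/-- Between the start and the end of such an interval the shift grows by `n + 1`, and by `1` across
an ordinary gap. So a single surplus exceeds what all `n - 1` gaps are worth together. -/
lemma intervalValue_mid {k : ℕ} (hk0 : 0 < k) (hk1 : k + 1 < n) (hki : k ≠ i) :
    intervalValue n i θ k = 1 / n + (n + 1) * shiftUnit n := by
  have hshift : (markShift n i (k + 1) k : ℝ) - markShift n i k k = n + 1 := by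
    have : markShift n i (k + 1) k - markShift n i k k = n + 1 := by
      unfold markShift
      split_ifs <;> first | omega | (push_cast; ring)
    exact_mod_cast this
  rw [intervalValue, markPos_mid (by omega) hk1, markPos_mid hk0 (by omega),
    cutValue_eq (by omega), cutValue_eq (by omega), markValue_mid (by omega) hk1 (by omega),
    markValue_mid hk0 (by omega) (by omega), ← hshift]
  push_cast
  ring

/-- The value that `i` assigns to the gap between the `0`-th and the first of these intervals. -/
noncomputable def gapValue (n i : ℕ) (θ : Prop) [Decidable θ] : ℝ :=
  cutValue n i θ (n + 1) - cutValue n i θ n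

/-- Intervals and gaps telescope to `1`. Of the `n - 1` gaps the first is kept explicit, since it
depends on `θ`; each of the others is worth one unit. -/
lemma sum_intervalValue (hn : 2 ≤ n) :
    ∑ k ∈ Finset.range n, intervalValue n i θ k + gapValue n i θ =
      1 - (n - 2) * shiftUnit n := by
  have key : ∀ t, t + 2 ≤ n → ∑ k ∈ Finset.range (t + 1), intervalValue n i θ k + gapValue n i θ =
      cutValue n i θ (markPos n (t + 1) (t + 1)) - t * shiftUnit n := by
    intro t
    induction t with
    | zero =>
      intro ht
      rw [Finset.sum_range_one, intervalValue, gapValue, zero_add, markPos_zero,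
        cutValue_zero (by omega), markPos_mid one_pos (by omega), markPos_mid one_pos (by omega)]
      simp
    | succ t ih =>
      intro ht
      have ih := ih (by omega)
      have hshift : (markShift n i (t + 2) (t + 2) : ℝ) - markShift n i (t + 2) (t + 1) = 1 := by
        have : markShift n i (t + 2) (t + 2) - markShift n i (t + 2) (t + 1) = 1 := by
          unfold markShift
          split_ifs <;> first | omega | (push_cast; ring)
        exact_mod_cast this
      have hgap : cutValue n i θ (markPos n (t + 2) (t + 2)) -
          cutValue n i θ (markPos n (t + 1) (t + 2)) = shiftUnit n := by
        rw [markPos_mid (by omega) (by omega), markPos_mid (by omega) (by omega),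
          cutValue_eq (by omega), cutValue_eq (by omega), markValue_mid (by omega) (by omega)
          (by omega), markValue_mid (by omega) (by omega) (by omega), add_sub_add_left_eq_sub,
          ← mul_sub, hshift, mul_one]
      rw [Finset.sum_range_succ, intervalValue, add_right_comm, ih]
      push_cast
      linarith
  obtain ⟨t, rfl⟩ : ∃ t, n = t + 2 := ⟨n - 2, by omega⟩
  have h := key t le_rfl
  rw [Finset.sum_range_succ, add_right_comm, h, intervalValue, markPos_last (by omega),
    cutValue_last (by omega)]
  push_cast
  ring

/-- Under `θ` the `0`-th interval is worth only `n` units, so the first gap is worth at least `1 /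
(2 * n)`. The last interval is worth at least `3 / (4 * n)`. Together they clearly exceed `1 / n`.
-/
lemma le_gapValue_add (hi : i < n) (hn : 2 ≤ n) (h : θ) :
    1 / n + n * shiftUnit n ≤ intervalValue n i θ (n - 1) + gapValue n i θ := by
  have hn0 : 0 < n := by omega
  have e1 : cutValue n i θ n = n * shiftUnit n := by
    have := cutValue_eq (i := i) (θ := θ) (q := 1) hn0
    rw [one_mul, add_zero] at this
    rw [this, markValue_special (by omega) h]
  have e2 : 1 / n - 1 / n / 4 ≤ cutValue n i θ (n + 1) := by
    have := cutValue_eq (i := i) (θ := θ) (q := 1) (by omega : 1 < n)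
    rw [one_mul] at this
    rw [this, markValue_mid one_pos (by omega) (by omega)]
    have := neg_le_of_abs_le (abs_shift_le hi (by omega : 1 < n) (by omega : 1 < n))
    push_cast
    linarith
  have e3 : 1 / n - 1 / n / 4 ≤ intervalValue n i θ (n - 1) := by
    rw [intervalValue, Nat.sub_add_cancel (by omega), markPos_last hn0, cutValue_last hn0,
      markPos_mid (by omega) (by omega), cutValue_eq (by omega),
      markValue_mid (by omega) (by omega) (by omega)]
    have := le_of_abs_le (abs_shift_le hi (by omega : n - 1 < n) (by omega : n - 1 < n))
    rw [Nat.cast_sub (by omega), sub_div, Nat.cast_one, div_self (by positivity)]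
    linarith
  have e4 := mul_shiftUnit_le hn0
  have h4 : (0 : ℝ) < 1 / n := by positivity
  rw [gapValue, e1]
  linarith

end markValue

/-- Valuations for which `tightMarks n` are the marks of the players. -/
lemma exists_tight_valuations (hn : 2 ≤ n) (θ : Fin n → Prop) [∀ i, Decidable (θ i)]
    (hθ : ∀ i, θ i → 0 < i.val) : ∃ V : Fin n → Valuation, IsMarking V (tightMarks n) ∧
      ∀ i, ∀ a b : ℕ, a ≤ b → b ≤ n * n →
        V i (Icc ((a : ℝ) / (n * n : ℕ)) ((b : ℝ) / (n * n : ℕ))) =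
          cutValue n i (θ i) b - cutValue n i (θ i) a := by
  have hn0 : 0 < n := by omega
  have hex := fun i : Fin n => exists_valuation_Icc (K := n * n) (by positivity)
    (cutValue n i (θ i)) (cutValue_zero hn0) (cutValue_last hn0)
    fun b hb => cutValue_lt i.2 (by omega) hb
  choose V hV using hex
  refine ⟨V, fun i => ⟨?_, ?_, ?_, fun j => ?_⟩, hV⟩
  · simp [tightMarks, markPos_zero]
  · rw [tightMarks, Fin.val_last, markPos_last hn0, div_self]
    positivity
  · refine Fin.monotone_iff_le_succ.2 fun j => ?_
    rw [tightMarks, tightMarks, Fin.val_succ, Fin.val_castSucc]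
    gcongr
    exact (markPos_lt i.2).le
  · rw [tightMarks, tightMarks, Fin.val_succ, Fin.val_castSucc, hV i _ _ (markPos_lt i.2).le
      (markPos_le_sq i.2 j.2), cutValue_markPos i.2 (hθ i) j.2, cutValue_markPos i.2 (hθ i) j.2.le]
    push_cast
    ring

lemma intervalValue_le {θ : Fin n → Prop} [∀ i, Decidable (θ i)] {V : Fin n → Valuation}
    (hV : ∀ i, ∀ a b : ℕ, a ≤ b → b ≤ n * n →
      V i (Icc ((a : ℝ) / (n * n : ℕ)) ((b : ℝ) / (n * n : ℕ))) =
        cutValue n i (θ i) b - cutValue n i (θ i) a)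
    {A : Fin n → Set ℝ} (hA : IsDivision A) {k : Fin n}
    (hk : Ioo (tightMarks n k k.castSucc) (tightMarks n k k.succ) ⊆ A k) (i : Fin n) :
    intervalValue n i (θ i) k ≤ V i (A k) := by
  rw [intervalValue, ← hV i _ _ (markPos_lt k.2).le (markPos_le_sq k.2 k.2), ← (V i).Ioo_eq_Icc]
  · have hsub := hk
    rw [tightMarks, tightMarks, Fin.val_succ, Fin.val_castSucc] at hsub
    exact (V i).mono (isPortion_Ioo (by positivity) (div_le_one_of_le₀
      (by exact_mod_cast markPos_le_sq k.2 k.2) (Nat.cast_nonneg _))) (hA.1.1 k) hsub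
  · positivity
  · exact div_le_one_of_le₀ (by exact_mod_cast markPos_le_sq k.2 k.2) (Nat.cast_nonneg _)

lemma sum_intervalValue_erase (hn : 2 ≤ n) {θ : Prop} [Decidable θ] (i : Fin n)
    (hθ : θ → 0 < i.val) :
    ∑ k ∈ Finset.univ.erase i, intervalValue n i θ k + gapValue n i θ =
      1 - 1 / n - (n - 2) * shiftUnit n := by
  have h := sum_intervalValue (i := i) (θ := θ) hn
  rw [← Fin.sum_univ_eq_sum_range (fun k => intervalValue n i θ k) n,
    ← Finset.add_sum_erase _ _ (Finset.mem_univ i), intervalValue_self i.2 hθ] at h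
  linarith

lemma gapValue_of_not (hn : 2 ≤ n) {i : ℕ} {θ : Prop} [Decidable θ] (h : ¬θ) :
    gapValue n i θ = shiftUnit n := by
  have hshift : (markShift n i 1 1 : ℝ) - markShift n i 1 0 = 1 := by
    have : markShift n i 1 1 - markShift n i 1 0 = 1 := by
      unfold markShift
      split_ifs <;> first | omega | (push_cast; ring)
    exact_mod_cast this
  have h0 := cutValue_eq (i := i) (θ := θ) (q := 1) (by omega : 0 < n)
  have h1 := cutValue_eq (i := i) (θ := θ) (q := 1) (by omega : 1 < n)
  rw [one_mul] at h0 h1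
  rw [add_zero] at h0
  rw [gapValue, h0, h1, markValue_mid one_pos (by omega) (by tauto),
    markValue_mid one_pos (by omega) (by tauto), add_sub_add_left_eq_sub, ← mul_sub, hshift,
    mul_one]

/-- Without special gaps every player envies all players but the first and the last one. -/
lemma envies_of_own_intervals (hn : 2 ≤ n) {θ : Fin n → Prop} [∀ i, Decidable (θ i)]
    {V : Fin n → Valuation}
    (hV : ∀ i, ∀ a b : ℕ, a ≤ b → b ≤ n * n →
      V i (Icc ((a : ℝ) / (n * n : ℕ)) ((b : ℝ) / (n * n : ℕ))) =
        cutValue n i (θ i) b - cutValue n i (θ i) a)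
    {A : Fin n → Set ℝ} (hA : IsDivision A)
    (hk : ∀ k : Fin n, Ioo (tightMarks n k k.castSucc) (tightMarks n k k.succ) ⊆ A k)
    {i j : Fin n} (hθ : ¬θ i) (hij : i ≠ j) (h : V i (A j) ≤ V i (A i)) :
    j.val = 0 ∨ j.val = n - 1 := by
  by_contra! hj
  have hε := shiftUnit_pos (by omega : 0 < n)
  -- The other players' intervals leave at most `1 / n` and `n - 1` units for the own portion, less
  -- than the `1 / n` and `n + 1` units of a middle interval.
  have h1 := sum_intervalValue_erase hn i (θ := θ i) fun h => absurd h hθ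
  rw [gapValue_of_not hn hθ] at h1
  have h2 : ∑ k ∈ Finset.univ.erase i, intervalValue n i (θ i) k ≤
      ∑ k ∈ Finset.univ.erase i, V i (A k) :=
    Finset.sum_le_sum fun k _ => intervalValue_le hV hA (hk k) i
  have h3 := (V i).partition hA.1
  rw [← Finset.add_sum_erase _ _ (Finset.mem_univ i), (V i).normalized] at h3
  have h4 := intervalValue_le hV hA (hk j) i
  rw [intervalValue_mid (by omega) (by omega) fun h => hij (Fin.ext h.symm)] at h4
  linarith

/-- Whatever the strategy, there may be only `2 n - 2` envy-free-relations. -/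
lemma exists_few_envyFree_of_isStrategy (hn : 3 ≤ n) {T : CutStrategy n} (hT : IsStrategy T) :
    ∃ V, ∃ A ∈ cutYourOwnPieceWith T V, envyFreeCount V A ≤ 2 * n - 2 := by
  -- The marks alone force the own intervals, and without special gaps it does not matter how the
  -- strategy distributes the gaps.
  obtain ⟨V, hm, hV⟩ := exists_tight_valuations (by omega : 2 ≤ n) (fun _ => False)
    (fun _ h => h.elim)
  obtain ⟨A, hA⟩ := (hT V _ hm).1
  refine ⟨V, A, ⟨_, hm, hA⟩, ?_⟩
  have hlegal := (hT V _ hm).2 A hA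
  have hk := hlegal.own_interval
  obtain ⟨S, -, -, -, hdiv, -⟩ := hlegal
  let a : Fin n := ⟨0, by omega⟩
  let z : Fin n := ⟨n - 1, by omega⟩
  have haz : z ≠ a := fun h => by
    rw [Fin.ext_iff] at h
    simp only [a, z] at h
    omega
  refine (envyFreeCount_le_sum (T := fun i => ({a, z} : Finset (Fin n)).erase i)
    fun i j hij h => ?_).trans ?_
  · have := envies_of_own_intervals (by omega) hV hdiv hk (fun h => h) hij h
    simp only [Finset.mem_erase, Finset.mem_insert, Finset.mem_singleton, Fin.ext_iff, a, z]
    exact ⟨fun h => hij h.symm, this⟩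
  · rw [← Finset.add_sum_erase _ _ (Finset.mem_univ a),
      ← Finset.add_sum_erase _ _ (Finset.mem_erase.2 ⟨haz, Finset.mem_univ z⟩)]
    have hpair : ({a, z} : Finset (Fin n)).card = 2 := Finset.card_pair haz.symm
    have ha : (({a, z} : Finset (Fin n)).erase a).card = 1 := by
      rw [Finset.card_erase_of_mem (by simp), hpair]
    have hz : (({a, z} : Finset (Fin n)).erase z).card = 1 := by
      rw [Finset.card_erase_of_mem (by simp), hpair]
    have hrest : ∑ i ∈ (Finset.univ.erase a).erase z, (({a, z} : Finset (Fin n)).erase i).card ≤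
        ((Finset.univ.erase a).erase z).card * 2 := by
      rw [← smul_eq_mul, ← Finset.sum_const]
      exact Finset.sum_le_sum fun i _ => (Finset.card_erase_le).trans hpair.le
    rw [Finset.card_erase_of_mem (Finset.mem_erase.2 ⟨haz, Finset.mem_univ z⟩),
      Finset.card_erase_of_mem (Finset.mem_univ a), Finset.card_univ, Fintype.card_fin] at hrest
    omega

/-! ### Cut Your Own Piece: an allocation with `n` envy-free-relations -/

/-- The owner of the `b`-th cell: the gap after the first interval goes to the last player, and
every other gap goes to the owner of the interval on its right. -/
def cellOwner (n : ℕ) (hn : 0 < n) (b : ℕ) : Fin n :=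
  if b = n then ⟨n - 1, by omega⟩ else ⟨min ((b + 1) / (n + 1)) (n - 1), by omega⟩

lemma cellOwner_self (hn : 0 < n) : (cellOwner n hn n).val = n - 1 := by
  rw [cellOwner, if_pos rfl]

lemma cellOwner_val (hn : 0 < n) {b : ℕ} (hb : b ≠ n) :
    (cellOwner n hn b).val = min ((b + 1) / (n + 1)) (n - 1) := by
  rw [cellOwner, if_neg hb]

/-- The positions at which the cake is cut. -/
def cutPositions (n : ℕ) : Finset ℕ :=
  insert (n + 1) ((Finset.Icc 1 (n - 1)).image fun q => q * (n + 1) - 1)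

lemma card_cutPositions (hn : 2 ≤ n) :
    n - 1 ≤ (cutPositions n).card ∧ (cutPositions n).card ≤ 2 * (n - 1) := by
  have hcard : ((Finset.Icc 1 (n - 1)).image fun q => q * (n + 1) - 1).card = n - 1 := by
    rw [Finset.card_image_of_injOn]
    · simp
    · intro p hp q hq hpq
      simp only [Finset.coe_Icc, mem_Icc] at hp hq hpq
      have h1 : 0 < p * (n + 1) := Nat.mul_pos (by omega) (by omega)
      have h2 : 0 < q * (n + 1) := Nat.mul_pos (by omega) (by omega)
      exact Nat.eq_of_mul_eq_mul_right (by omega : 0 < n + 1) (by omega)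
  have h1 := Finset.card_le_card (Finset.subset_insert (n + 1)
    ((Finset.Icc 1 (n - 1)).image fun q => q * (n + 1) - 1))
  have h2 := Finset.card_insert_le (n + 1)
    ((Finset.Icc 1 (n - 1)).image fun q => q * (n + 1) - 1)
  rw [hcard] at h1 h2
  exact ⟨h1, h2.trans (by omega)⟩

lemma mem_cutPositions_of_mul {q : ℕ} (h0 : 0 < q) (h1 : q < n) :
    q * (n + 1) - 1 ∈ cutPositions n :=
  Finset.mem_insert_of_mem (Finset.mem_image.2 ⟨q, Finset.mem_Icc.2 ⟨h0, by omega⟩, rfl⟩)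

lemma cutPositions_eq_markPos (hn : 2 ≤ n) {c : ℕ} (hc : c ∈ cutPositions n) :
    ∃ i q, i < n ∧ 0 < q ∧ q < n ∧ c = markPos n i q := by
  rcases Finset.mem_insert.1 hc with rfl | hc
  · exact ⟨1, 1, by omega, one_pos, by omega, by rw [markPos_mid one_pos (by omega), one_mul]⟩
  · obtain ⟨q, hq, rfl⟩ := Finset.mem_image.1 hc
    rw [Finset.mem_Icc] at hq
    refine ⟨q - 1, q, by omega, hq.1, by omega, ?_⟩
    rw [markPos_mid hq.1 (by omega), mul_add]
    omega

/-- The quotient `(b + 1) / (n + 1)` jumps at the positions `q * (n + 1) - 1`, where gaps begin, and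
the exceptional first gap ends at `n + 1`. So the owner changes only at cut positions. -/
lemma cellOwner_congr (hn : 2 ≤ n) {b b' : ℕ} (h : ∀ c ∈ cutPositions n, b < c ↔ b' < c) :
    cellOwner n (by omega) b = cellOwner n (by omega) b' := by
  have h1 := h (n + 1) (Finset.mem_insert_self _ _)
  have h2 := h _ (mem_cutPositions_of_mul one_pos (by omega : 1 < n))
  rw [one_mul, Nat.add_sub_cancel] at h2
  by_cases hb : b = n
  · have : b' = n := by omega
    rw [hb, this]
  have hb' : b' ≠ n := by omega
  have key : ∀ b b' : ℕ, (∀ c ∈ cutPositions n, b < c ↔ b' < c) →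
      min ((b' + 1) / (n + 1)) (n - 1) ≤ min ((b + 1) / (n + 1)) (n - 1) := by
    intro b b' h
    by_contra! hlt
    generalize hp : min ((b' + 1) / (n + 1)) (n - 1) = p at hlt
    have hpn : p ≤ n - 1 := hp ▸ min_le_right _ _
    have hp0 : 0 < p := lt_of_le_of_lt (Nat.zero_le _) hlt
    have hc := h _ (mem_cutPositions_of_mul hp0 (by omega))
    have h1 : b + 1 < p * (n + 1) := by
      rw [← Nat.div_lt_iff_lt_mul (by omega)]
      exact (min_lt_iff.1 hlt).resolve_right (not_lt.2 hpn)
    have h2 : p * (n + 1) ≤ b' + 1 := by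
      rw [← Nat.le_div_iff_mul_le (by omega)]
      exact hp ▸ min_le_left _ _
    omega
  ext
  rw [cellOwner_val _ hb, cellOwner_val _ hb']
  exact le_antisymm (key b' b fun c hc => (h c hc).symm) (key b b' h)

lemma cellOwner_interval (hn : 2 ≤ n) (k : Fin n) {b : ℕ} (h1 : markPos n k k ≤ b)
    (h2 : b < markPos n k (k + 1)) : cellOwner n (by omega) b = k := by
  have hk := k.2
  rcases (k.val).eq_zero_or_pos with h0 | h0
  · rw [h0, zero_add, markPos_mid one_pos (by omega)] at h2
    ext
    rw [cellOwner_val _ (by omega), Nat.div_eq_of_lt (by omega)]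
    omega
  · rw [markPos_mid h0 hk] at h1
    have hle : k.val * (n + 1) ≤ b + 1 := by
      rw [mul_add]
      omega
    have hb : b ≠ n := by
      have := Nat.mul_le_mul_right n h0
      omega
    have hge := (Nat.le_div_iff_mul_le (by omega : 0 < n + 1)).2 hle
    ext
    rw [cellOwner_val _ hb]
    rcases (by omega : k.val + 1 ≤ n).eq_or_lt with h | h
    · omega
    · rw [markPos_mid (by omega) h] at h2
      have : (b + 1) / (n + 1) < k.val + 1 := by
        rw [Nat.div_lt_iff_lt_mul (by omega)]
        have : (k.val + 1) * (n + 1) = (k.val + 1) * n + (k.val + 1) := by ring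
        omega
      omega

/-- The allocation in which each player gets the cells that he or she owns. -/
noncomputable def ownerAllocation (n : ℕ) (hn : 0 < n) (i : Fin n) : Set ℝ :=
  cells (gridIndex (n * n)) {b ∈ Finset.range (n * n) | cellOwner n hn b = i}

lemma Ioo_subset_ownerAllocation (hn : 0 < n) {i : Fin n} {p q : ℕ} (hq : q ≤ n * n)
    (h : ∀ b, p ≤ b → b < q → cellOwner n hn b = i) :
    Ioo ((p : ℝ) / (n * n : ℕ)) ((q : ℝ) / (n * n : ℕ)) ⊆ ownerAllocation n hn i := by
  have hK : 0 < n * n := by positivity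
  intro x hx
  have hq0 : 0 < q := by
    rcases q.eq_zero_or_pos with rfl | h
    · have h0 : (0 : ℝ) ≤ (p : ℝ) / (n * n : ℕ) := by positivity
      have h1 := hx.1.trans hx.2
      rw [Nat.cast_zero, zero_div] at h1
      linarith
    · exact h
  have hxc : x ∈ cake := ⟨le_trans (by positivity) hx.1.le,
    hx.2.le.trans (div_le_one_of_le₀ (by exact_mod_cast hq) (Nat.cast_nonneg _))⟩
  have h2 : gridIndex (n * n) x < q := (gridIndex_lt_iff_le_div hK hq0).2 hx.2.le
  have h1 : p ≤ gridIndex (n * n) x := by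
    rcases p.eq_zero_or_pos with rfl | hp
    · exact Nat.zero_le _
    · rw [← not_lt, gridIndex_lt_iff_le_div hK hp, not_le]
      exact hx.1
  exact ⟨hxc, Finset.mem_filter.2 ⟨Finset.mem_range.2 (h2.trans_le hq), h _ h1 h2⟩⟩

lemma own_interval_ownerAllocation (hn : 2 ≤ n) (k : Fin n) :
    Ioo (tightMarks n k k.castSucc) (tightMarks n k k.succ) ⊆
      ownerAllocation n (by omega) k := by
  rw [tightMarks, tightMarks, Fin.val_succ, Fin.val_castSucc]
  exact Ioo_subset_ownerAllocation (by omega) (markPos_le_sq k.2 k.2)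
    fun b h1 h2 => cellOwner_interval hn k h1 h2

lemma isLegal_ownerAllocation (hn : 2 ≤ n) :
    IsLegal (tightMarks n) (ownerAllocation n (by omega)) := by
  have hn0 : 0 < n := by omega
  have hK : 0 < n * n := by positivity
  have hK' : (0 : ℝ) < (n * n : ℕ) := by exact_mod_cast hK
  have hinj : Function.Injective fun c : ℕ => (c : ℝ) / (n * n : ℕ) := fun a b h => by
    simp only [div_left_inj' hK'.ne', Nat.cast_inj] at h
    exact h
  have hcard := card_cutPositions hn
  have hpart : IsPartition cake (ownerAllocation n hn0) := by
    rw [cake_eq_gridCells hK]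
    exact isPartition_cells (fun s => isPortion_gridCells _ s) _ (cellOwner n hn0)
  refine ⟨(cutPositions n).image fun c : ℕ => (c : ℝ) / (n * n : ℕ), ?_, ?_, ?_,
    ⟨hpart, fun i => ?_⟩, ?_, fun i => ⟨i, own_interval_ownerAllocation hn i⟩⟩
  · rw [Finset.card_image_of_injective _ hinj]
    exact hcard.1
  · rw [Finset.card_image_of_injective _ hinj]
    exact hcard.2
  · intro s hs
    obtain ⟨c, hc, rfl⟩ := Finset.mem_image.1 hs
    obtain ⟨i, q, hi, hq0, hq, rfl⟩ := cutPositions_eq_markPos hn hc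
    refine ⟨⟨i, hi⟩, ⟨q, by omega⟩, fun h => ?_, fun h => ?_, rfl⟩ <;>
    · rw [Fin.ext_iff] at h
      simp only [Fin.val_zero, Fin.val_last] at h
      omega
  · refine Set.Nonempty.mono (own_interval_ownerAllocation hn i) (nonempty_Ioo.2 ?_)
    rw [tightMarks, tightMarks, Fin.val_succ, Fin.val_castSucc]
    exact div_lt_div_of_pos_right (by exact_mod_cast markPos_lt i.2) hK'
  · intro i x hx y hy hxy
    rw [ownerAllocation, mem_cells, Finset.mem_filter] at hx ⊢
    refine ⟨hy, Finset.mem_range.2 (gridIndex_lt hK hy), ?_⟩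
    rw [← hx.2.2]
    refine cellOwner_congr hn fun c hc => ?_
    have hc0 : 0 < c := by
      obtain ⟨i, q, hi, hq0, hq, rfl⟩ := cutPositions_eq_markPos hn hc
      rw [markPos_mid hq0 hq]
      positivity
    rw [gridIndex_lt_iff_le_div hK hc0, gridIndex_lt_iff_le_div hK hc0]
    exact (hxy _ (Finset.mem_image_of_mem _ hc)).symm

lemma exists_few_envyFree_isLegal (hn : 3 ≤ n) :
    ∃ V, ∃ A ∈ cutYourOwnPiece n V, envyFreeCount V A ≤ n := by
  have hn0 : 0 < n := by omega
  -- Only the middle players attach great value to the first gap. As it goes to the last player,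
  -- they come to envy that player too and are left with the first player as the only one not
  -- envied. The first and the last player can be free of envy only towards each other.
  obtain ⟨V, hm, hV⟩ := exists_tight_valuations (by omega : 2 ≤ n)
    (fun i => 0 < i.val ∧ i.val + 1 < n) (fun _ h => h.1)
  have hlegal := isLegal_ownerAllocation (n := n) (by omega)
  refine ⟨V, ownerAllocation n hn0, ⟨_, hm, hlegal⟩, ?_⟩
  have hk := own_interval_ownerAllocation (n := n) (by omega)
  obtain ⟨S, -, -, -, hdiv, -⟩ := hlegal
  have hε := shiftUnit_pos hn0
  let a : Fin n := ⟨0, hn0⟩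
  let z : Fin n := ⟨n - 1, by omega⟩
  have hgap : ∀ i : Fin n, intervalValue n i (0 < i.val ∧ i.val + 1 < n) z +
      gapValue n i (0 < i.val ∧ i.val + 1 < n) ≤ V i (ownerAllocation n hn0 z) := by
    intro i
    have hnn : n + 1 ≤ (n - 1) * n + (n - 1) := by
      obtain ⟨t, rfl⟩ : ∃ t, n = t + 3 := ⟨n - 3, by omega⟩
      rw [show t + 3 - 1 = t + 2 by omega]
      nlinarith
    have hpz : markPos n z z = (n - 1) * n + (n - 1) :=
      markPos_mid (by omega : 0 < n - 1) (by omega) _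
    have hlez := markPos_le_sq z.2 z.2.le
    have hK' : (0 : ℝ) < (n * n : ℕ) := by positivity
    have hle1 : ∀ c ≤ n * n, (c : ℝ) / (n * n : ℕ) ≤ 1 := fun c hc =>
      div_le_one_of_le₀ (by exact_mod_cast hc) hK'.le
    have hn1 : n + 1 ≤ n * n := by omega
    have hsub1 : Ioo ((n : ℝ) / (n * n : ℕ)) (((n + 1 : ℕ) : ℝ) / (n * n : ℕ)) ⊆
        ownerAllocation n hn0 z := by
      refine Ioo_subset_ownerAllocation hn0 hn1 fun b h1 h2 => ?_
      obtain rfl : b = n := by omega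
      exact Fin.ext (cellOwner_self hn0)
    have hsub2 := hk z
    rw [tightMarks, tightMarks, Fin.val_succ, Fin.val_castSucc] at hsub2
    have hp1 := isPortion_Ioo (a := (n : ℝ) / (n * n : ℕ)) (by positivity) (hle1 _ hn1)
    have hp2 := isPortion_Ioo (a := (markPos n z z : ℝ) / (n * n : ℕ)) (by positivity)
      (hle1 _ (markPos_le_sq z.2 z.2))
    have hd : Disjoint (Ioo ((markPos n z z : ℝ) / (n * n : ℕ))
        ((markPos n z (z + 1) : ℝ) / (n * n : ℕ)))
        (Ioo ((n : ℝ) / (n * n : ℕ)) (((n + 1 : ℕ) : ℝ) / (n * n : ℕ))) := by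
      refine disjoint_left.2 fun x hx hx' => ?_
      have : ((n + 1 : ℕ) : ℝ) / (n * n : ℕ) ≤ (markPos n z z : ℝ) / (n * n : ℕ) := by
        gcongr
        omega
      linarith [hx.1, hx'.2]
    have hadd := (V i).additive _ _ hp2 hp1 hd
    have hmono := (V i).mono (hp2.union hp1) (hdiv.1.1 z) (union_subset hsub2 hsub1)
    rw [hadd, (V i).Ioo_eq_Icc (by positivity) (hle1 _ (markPos_le_sq z.2 z.2)),
      (V i).Ioo_eq_Icc (by positivity) (hle1 _ hn1),
      hV i _ _ (markPos_lt z.2).le (markPos_le_sq z.2 z.2), hV i _ _ (by omega) hn1] at hmono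
    exact hmono
  refine (envyFreeCount_le_sum (T := fun i => if i = a then {z} else {a}) fun i j hij h => ?_).trans
    ?_
  · by_cases hθ : 0 < i.val ∧ i.val + 1 < n
    · have hia : i ≠ a := fun h => by
        rw [Fin.ext_iff] at h
        simp only [a] at h
        omega
      rw [if_neg hia, Finset.mem_singleton]
      by_contra hja
      have hja' : j.val ≠ 0 := fun h => hja (Fin.ext h)
      have hzi : z ∈ Finset.univ.erase i := Finset.mem_erase.2 ⟨fun h => by
        rw [Fin.ext_iff] at h
        simp only [z] at h
        omega, Finset.mem_univ z⟩
      have h1 := sum_intervalValue_erase (by omega) i (θ := 0 < i.val ∧ i.val + 1 < n) fun h => h.1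
      have h2 : ∑ k ∈ (Finset.univ.erase i).erase z,
          intervalValue n i (0 < i.val ∧ i.val + 1 < n) k ≤
          ∑ k ∈ (Finset.univ.erase i).erase z, V i (ownerAllocation n hn0 k) :=
        Finset.sum_le_sum fun k _ => intervalValue_le hV hdiv (hk k) i
      have h3 := (V i).partition hdiv.1
      have hz := hgap i
      rw [← Finset.add_sum_erase _ _ (Finset.mem_univ i), (V i).normalized,
        ← Finset.add_sum_erase _ _ hzi] at h3
      rw [← Finset.add_sum_erase _ _ hzi] at h1
      have hown : V i (ownerAllocation n hn0 i) ≤ 1 / n + (n - 2) * shiftUnit n := by linarith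
      by_cases hjz : j.val = n - 1
      · have hjz' : j = z := Fin.ext hjz
        have h4 := le_gapValue_add i.2 (by omega) hθ
        rw [hjz'] at h
        have h5 : intervalValue n i (0 < i.val ∧ i.val + 1 < n) z =
          intervalValue n i (0 < i.val ∧ i.val + 1 < n) (n - 1) := rfl
        linarith
      · have h4 := intervalValue_le hV hdiv (hk j) i
        rw [intervalValue_mid (by omega) (by omega) fun h => hij (Fin.ext h.symm)] at h4
        linarith
    · have := envies_of_own_intervals (by omega) hV hdiv hk hθ hij h
      have hij' : i.val ≠ j.val := fun h => hij (Fin.ext h)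
      by_cases hia : i = a
      · rw [if_pos hia, Finset.mem_singleton]
        have : i.val = 0 := congrArg Fin.val hia
        exact Fin.ext (by simp only [z]; omega)
      · rw [if_neg hia, Finset.mem_singleton]
        have : i.val ≠ 0 := fun h => hia (Fin.ext h)
        exact Fin.ext (by simp only [a]; omega)
  · rw [Finset.sum_congr rfl fun i _ => show (if i = a then {z} else {a} : Finset (Fin n)).card = 1
      by split_ifs <;> simp]
    simp

end tightMarks

/-! ### Degrees of Cut Your Own Piece. -/

theorem hasDGEF_cutYourOwnPiece {n : ℕ} (hn : 3 ≤ n) : HasDGEF (cutYourOwnPiece n) n := by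
  have hP : IsProportional (cutYourOwnPiece n) :=
    IsStrategy.isProportional (by omega) (isStrategy_isLegal hn)
  exact .intro hP (fun V A hA => hP.le_envyFreeCount (by omega) hA) (exists_few_envyFree_isLegal hn)

theorem hasDGEF_leftRight {n : ℕ} (hn : 3 ≤ n) :
    HasDGEF (cutYourOwnPieceWith (leftRight n)) (2 * n - 2) :=
  .intro (IsStrategy.isProportional (by omega) (isStrategy_leftRight hn))
    (fun V A hA => le_envyFreeCount_leftRight hn hA)
    (exists_few_envyFree_of_isStrategy hn (isStrategy_leftRight hn))

theorem IsStrategy.exists_hasDGEF {n : ℕ} (hn : 3 ≤ n) {T : CutStrategy n} (hT : IsStrategy T) :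
    ∃ d, d ≤ 2 * n - 2 ∧ HasDGEF (cutYourOwnPieceWith T) d :=
  HasDGEF.exists_le (IsStrategy.isProportional (by omega) hT)
    (exists_few_envyFree_of_isStrategy hn hT)

end CakeCutting

namespace CakeCutting

open Set

/-! ### Lone Chooser: proportionality -/

section loneChooser

variable {n : ℕ} {V : Fin n → Valuation}

/-- The first `m` players. -/
def firstPlayers (n m : ℕ) : Finset (Fin n) := {i : Fin n | i.val < m}

lemma mem_firstPlayers {m : ℕ} {i : Fin n} : i ∈ firstPlayers n m ↔ i.val < m := by
  simp [firstPlayers]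

lemma firstPlayers_succ {c : Fin n} : firstPlayers n (c + 1) = insert c (firstPlayers n c) := by
  ext i
  simp only [mem_firstPlayers, Finset.mem_insert, Fin.ext_iff]
  omega

lemma firstPlayers_self : firstPlayers n n = Finset.univ := by
  ext i
  simp [mem_firstPlayers]

/-- If every player in `N` hands over a part of the own portion to a further player `c`, the result
is again a sharing. -/
lemma IsSharing.hand_over {N : Finset (Fin n)} {R : Set ℝ} {A A' P : Fin n → Set ℝ} {c : Fin n}
    (h : IsSharing N R A) (hc : c ∉ N) (hP : ∀ i ∈ N, IsPortion (P i) ∧ P i ⊆ A i)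
    (hA : ∀ i ∈ N, A' i = A i \ P i) (hAc : A' c = ⋃ i ∈ N, P i) :
    IsSharing (insert c N) R A' where
  portion i hi := by
    rcases Finset.mem_insert.1 hi with rfl | hi
    · rw [hAc]
      exact .biUnion fun i hi => (hP i hi).1
    · rw [hA i hi]
      exact (h.portion i hi).diff (hP i hi).1
  disjoint := by
    rw [Finset.coe_insert]
    refine PairwiseDisjoint.insert ?_ fun j hj hcj => ?_
    · intro i hi j hj hij
      simp only [Function.onFun]
      rw [hA i hi, hA j hj]
      exact (h.disjoint hi hj hij).mono sdiff_subset sdiff_subset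
    · rw [hAc, hA j hj, disjoint_iUnion₂_left]
      intro i hi
      by_cases hij : i = j
      · rw [hij]
        exact disjoint_sdiff_right
      · exact (h.disjoint hi hj hij).mono (hP i hi).2 sdiff_subset
  cover := by
    rw [Finset.set_biUnion_insert, hAc, ← h.cover]
    simp only [← iUnion_union_distrib]
    refine iUnion₂_congr fun i hi => ?_
    rw [hA i hi, union_sdiff_cancel (hP i hi).2]

/-- A cutter keeps `m` pieces worth at least `1 / (m (m + 1))` each. The chooser takes the best of
`m + 1` pieces from every portion, hence at least the fraction `1 / (m + 1)` of the cake. -/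
lemma LoneChooserRun.fair {m : ℕ} {A : Fin n → Set ℝ} (H : LoneChooserRun V m A) :
    2 ≤ m ∧ IsSharing (firstPlayers n m) cake A ∧ ∀ i, i.val < m → 1 / (m : ℝ) ≤ V i (A i) := by
  induction H with
  | start p q A hp hq h =>
    have hpq : p ≠ q := fun e => by rw [e] at hp; omega
    refine ⟨le_rfl, ?_, fun i hi => ?_⟩
    · rw [show firstPlayers n 2 = {p, q} by
        ext i
        simp only [mem_firstPlayers, Finset.mem_insert, Finset.mem_singleton, Fin.ext_iff]
        omega]
      exact h.isSharing hpq
    · have hv := h.values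
      rw [(V p).normalized, (V q).normalized] at hv
      rcases (show i.val = 0 ∨ i.val = 1 by omega) with h0 | h0
      · rw [show i = p from Fin.ext (h0.trans hp.symm)]
        exact_mod_cast hv.1.ge
      · rw [show i = q from Fin.ext (h0.trans hq.symm)]
        exact_mod_cast hv.2.2
  | round m c A A' piece pick _ hc hpart hpick hA hAc ih =>
    obtain ⟨hm, hshare, hfair⟩ := ih
    subst hc
    have hmem : ∀ {i : Fin n}, i ∈ firstPlayers n c ↔ i < c := mem_firstPlayers
    have hsub : ∀ i < c, ∀ t, piece i t ⊆ A i := fun i hi t => by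
      rw [← (hpart i hi).1.2.2]
      exact subset_iUnion _ _
    have hAc' : A' c = ⋃ i ∈ firstPlayers n c, piece i (pick i) := by
      rw [hAc]
      simp only [hmem]
    have hshare' := hshare.hand_over (A' := A') (c := c) (by simp [hmem])
      (fun i hi => ⟨(hpart i (hmem.1 hi)).1.1 _, hsub i (hmem.1 hi) (pick i)⟩)
      (fun i hi => hA i (hmem.1 hi)) hAc'
    refine ⟨by omega, firstPlayers_succ ▸ hshare', fun i hi => ?_⟩
    have hm0 : (0 : ℝ) < (c.val : ℝ) := by
      have : 0 < c.val := by omega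
      exact_mod_cast this
    push_cast
    rcases Nat.lt_succ_iff_lt_or_eq.1 hi with hlt | heq
    · have hic : i < c := hlt
      have hd := (V i).diff_add ((hpart i hic).1.1 (pick i)) (hshare.portion i (hmem.2 hic))
        (hsub i hic _)
      have hs := (V i).partition (hpart i hic).1
      rw [← Finset.add_sum_erase _ _ (Finset.mem_univ (pick i))] at hs
      have hle := Finset.card_nsmul_le_sum (Finset.univ.erase (pick i))
        (fun t => V i (piece i t)) (1 / ((c.val : ℝ) * ((c.val : ℝ) + 1)))
        fun t _ => (hpart i hic).2 t
      rw [Finset.card_erase_of_mem (Finset.mem_univ _), Finset.card_univ, Fintype.card_fin,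
        Nat.add_sub_cancel, nsmul_eq_mul] at hle
      rw [hA i hic]
      have e : (c.val : ℝ) * (1 / ((c.val : ℝ) * ((c.val : ℝ) + 1))) = 1 / ((c.val : ℝ) + 1) := by
        field_simp
      linarith
    · obtain rfl : i = c := Fin.ext heq
      have hdisj : (firstPlayers n i : Set (Fin n)).PairwiseDisjoint
          fun j => piece j (pick j) := fun j hj k hk hjk =>
        (hshare.disjoint hj hk hjk).mono (hsub j (hmem.1 hj) _) (hsub k (hmem.1 hk) _)
      have hs := hshare.sum_eq (V i)
      rw [(V i).normalized] at hs
      rw [hAc', (V i).biUnion (fun j hj => (hpart j (hmem.1 hj)).1.1 _) hdisj,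
        div_le_iff₀ (by positivity), Finset.sum_mul]
      refine hs.ge.trans ?_
      refine Finset.sum_le_sum fun j hj => ?_
      have hj' := hmem.1 hj
      rw [← (V i).partition (hpart j hj').1]
      refine (Finset.sum_le_card_nsmul _ _ _ fun t _ => hpick j hj' t).trans_eq ?_
      rw [Finset.card_univ, Fintype.card_fin, nsmul_eq_mul, mul_comm]
      push_cast
      rfl

lemma exists_loneChooserRun (V : Fin n → Valuation) {m : ℕ} (hm : 2 ≤ m) (hmn : m ≤ n) :
    ∃ A, LoneChooserRun V m A := by
  induction m, hm using Nat.le_induction with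
  | base =>
    let p : Fin n := ⟨0, by omega⟩
    let q : Fin n := ⟨1, by omega⟩
    obtain ⟨X, Y, h⟩ := exists_cutAndChoose (V p) (V q) isPortion_cake
    have hqp : q ≠ p := by simp [p, q]
    refine ⟨fun i => if i = p then X else Y, .start p q _ rfl rfl ?_⟩
    simpa only [if_true, if_neg hqp] using h
  | succ m hm ih =>
    obtain ⟨A, hA⟩ := ih (by omega)
    obtain ⟨-, hshare, hfair⟩ := hA.fair
    let c : Fin n := ⟨m, by omega⟩
    have hex : ∀ i, ∃ Q : Fin (m + 1) → Set ℝ, i < c →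
        IsPartition (A i) Q ∧ ∀ t, V i (Q t) = V i (A i) / (m + 1 : ℕ) := by
      intro i
      by_cases hi : i < c
      · obtain ⟨Q, hQ⟩ := (V i).exists_equal_partition
          (hshare.portion i (mem_firstPlayers.2 hi)) m.succ_pos
        exact ⟨Q, fun _ => hQ⟩
      · exact ⟨fun _ => ∅, fun h => absurd h hi⟩
    choose piece hpiece using hex
    choose pick hpick using fun i => Finite.exists_max fun t => V c (piece i t)
    have hm0 : (0 : ℝ) < m := by positivity
    refine ⟨Function.update (fun i => A i \ piece i (pick i)) c
      (⋃ i, ⋃ (_ : i < c), piece i (pick i)), .round m c A _ piece pick hA rfl ?_ ?_ ?_ ?_⟩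
    · refine fun i hi => ⟨(hpiece i hi).1, fun t => ?_⟩
      rw [(hpiece i hi).2, ← div_div]
      push_cast
      exact div_le_div_of_nonneg_right (hfair i hi) (by positivity)
    · exact fun i _ t => hpick i t
    · exact fun i hi => Function.update_of_ne hi.ne _ _
    · exact Function.update_self _ _ _

lemma isProportional_loneChooser (hn : 2 ≤ n) : IsProportional (loneChooser n) :=
  .of_isSharing (by omega) (fun V => exists_loneChooserRun V hn le_rfl) fun V A hA => by
    obtain ⟨-, h, hf⟩ := LoneChooserRun.fair hA
    rw [firstPlayers_self] at h
    exact ⟨h, fun i => hf i i.2⟩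

end loneChooser

/-! ### Lone Chooser: a result with `n` envy-free-relations -/

/-- A finite set can be split evenly. -/
lemma exists_even_split {β : Type*} [DecidableEq β] {s : Finset β} {m q : ℕ} (hm : 0 < m)
    (h : s.card = m * q) : ∃ g : β → Fin m, ∀ t, {b ∈ s | g b = t}.card = q := by
  have e : s ≃ Fin m × Fin q := Fintype.equivOfCardEq (by simp [h])
  refine ⟨fun b => if hb : b ∈ s then (e ⟨b, hb⟩).1 else ⟨0, hm⟩, fun t => ?_⟩
  rw [show {b ∈ s | (if hb : b ∈ s then (e ⟨b, hb⟩).1 else ⟨0, hm⟩) = t} =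
    Finset.univ.image fun r : Fin q => (e.symm (t, r) : β) from ?_]
  · rw [Finset.card_image_of_injective _ fun r r' hr => ?_]
    · simp
    · simpa using e.symm.injective (Subtype.ext hr)
  · ext b
    simp only [Finset.mem_filter, Finset.mem_image, Finset.mem_univ, true_and]
    constructor
    · rintro ⟨hb, ht⟩
      rw [dif_pos hb] at ht
      refine ⟨(e ⟨b, hb⟩).2, ?_⟩
      rw [← ht, Prod.mk.eta, Equiv.symm_apply_apply]
    · rintro ⟨r, rfl⟩
      simp

/-- All classes of a colouring can be split evenly at once. -/
lemma exists_even_split_classes {β κ : Type*} [DecidableEq β] [DecidableEq κ] {s : Finset β}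
    {f : β → κ} {C : Set κ} {m q : ℕ} (hm : 0 < m)
    (h : ∀ j ∈ C, (s.filter fun b => f b = j).card = m * q) :
    ∃ g : β → Fin m, ∀ j ∈ C, ∀ t, (s.filter fun b => f b = j ∧ g b = t).card = q := by
  classical
  have hex : ∀ j, ∃ g : β → Fin m, j ∈ C →
      ∀ t, ((s.filter fun b => f b = j).filter fun b => g b = t).card = q := by
    intro j
    by_cases hj : j ∈ C
    · obtain ⟨g, hg⟩ := exists_even_split hm (h j hj)
      exact ⟨g, fun _ => hg⟩
    · exact ⟨fun _ => ⟨0, hm⟩, fun h => absurd h hj⟩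
  choose g hg using hex
  refine ⟨fun b => g (f b) b, fun j hj t => ?_⟩
  rw [← hg j hj t, Finset.filter_filter]
  congr 1
  ext b
  simp only [Finset.mem_filter]
  exact and_congr_right fun _ => and_congr_right fun hb => by rw [hb]

/-- The portions made up of the cells of each colour. -/
def colourClasses {β κ : Type*} [Fintype β] [DecidableEq κ] (idx : ℝ → β) (f : β → κ) (j : κ) :
    Set ℝ :=
  cells idx (Finset.univ.filter fun b => f b = j)

lemma mem_colourClasses {β κ : Type*} [Fintype β] [DecidableEq κ] {idx : ℝ → β} {f : β → κ} {j : κ}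
    {x : ℝ} : x ∈ colourClasses idx f j ↔ x ∈ cake ∧ f (idx x) = j := by
  simp [colourClasses, mem_cells]

/-- If all cells have the same value for all players, every balanced colouring of the cells is a
possible result of the rounds of Lone Chooser. -/
lemma loneChooserRun_of_equal_cells {n l : ℕ} {V : Fin n → Valuation} {β : Type*} [Fintype β]
    [DecidableEq β] {idx : ℝ → β} (hidx : ∀ s, IsPortion (cells idx s)) (hln : l ≤ n)
    (hV : ∀ i, i.val < l → ∀ s, V i (cells idx s) = (s.card : ℝ) / Fintype.card β)
    (hl : l.factorial ∣ Fintype.card β) {m : ℕ} (hm : 2 ≤ m) (hml : m ≤ l) (f : β → Fin n)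
    (hf : ∀ b, (f b).val < m)
    (hbal : ∀ j, j.val < m → m * (Finset.univ.filter fun b => f b = j).card = Fintype.card β) :
    LoneChooserRun V m (colourClasses idx f) := by
  induction m, hm using Nat.le_induction generalizing f with
  | base =>
    let p : Fin n := ⟨0, by omega⟩
    let q : Fin n := ⟨1, by omega⟩
    have hp := hbal p (by simp [p])
    have hq := hbal q (by simp [q])
    refine .start p q _ rfl rfl ⟨hidx _, hidx _, cells_disjoint ?_, ?_, ?_, ?_⟩
    · refine Finset.disjoint_left.2 fun b hb hb' => ?_
      rw [Finset.mem_filter] at hb hb'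
      have := hb.2.symm.trans hb'.2
      simp [p, q] at this
    · ext x
      simp only [mem_union, mem_colourClasses, ← and_or_left, and_iff_left_iff_imp]
      intro _
      have := hf (idx x)
      simp only [p, q, Fin.ext_iff]
      omega
    · rw [colourClasses, colourClasses, hV p (by simp only [p]; omega),
        hV p (by simp only [p]; omega), show (Finset.univ.filter fun b => f b = p).card =
        (Finset.univ.filter fun b => f b = q).card by omega]
    · rw [colourClasses, colourClasses, hV q (by simp only [q]; omega),
        hV q (by simp only [q]; omega), show (Finset.univ.filter fun b => f b = p).card =
        (Finset.univ.filter fun b => f b = q).card by omega]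
  | succ m hm ih =>
    -- Divisibility by the factorial is what makes the classes split evenly in every round.
    have hdvd : (m + 1) * m ∣ Fintype.card β := by
      refine Dvd.dvd.trans ?_ ((Nat.factorial_dvd_factorial hml).trans hl)
      obtain ⟨k, rfl⟩ : ∃ k, m = k + 1 := ⟨m - 1, by omega⟩
      rw [Nat.factorial_succ, Nat.factorial_succ, ← mul_assoc]
      exact dvd_mul_right _ _
    obtain ⟨q, hq⟩ := hdvd
    have hclass : ∀ j ∈ {j : Fin n | j.val < m + 1},
        (Finset.univ.filter fun b => f b = j).card = m * q := by
      intro j hj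
      have := hbal j hj
      rw [hq, mul_assoc] at this
      exact Nat.eq_of_mul_eq_mul_left m.succ_pos this
    obtain ⟨g, hg⟩ := exists_even_split_classes (by omega) hclass
    let c : Fin n := ⟨m, by omega⟩
    have hcv : c.val = m := rfl
    -- The last round is undone: the cells of the chooser `c` are returned to the cutters in equal
    -- numbers, as their pieces `0`, and the other cells of each cutter form `m` pieces of the same
    -- size. `f₀` is the colouring before the round, `h` the number of the piece.
    let f₀ : β → Fin n := fun b => if f b = c then ⟨g b, by omega⟩ else f b
    let h : β → Fin (m + 1) := fun b => if f b = c then 0 else (g b).succ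
    have hzero : ∀ b, ∀ i < c, (f₀ b = i ∧ h b = 0 ↔ f b = c ∧ (g b).val = i) := by
      intro b i _
      by_cases hb : f b = c
      · simp [f₀, h, hb, Fin.ext_iff]
      · simp [h, hb]
    have hsucc : ∀ b, ∀ i < c, ∀ t : Fin m, f₀ b = i ∧ h b = t.succ ↔ f b = i ∧ g b = t := by
      intro b i hi t
      by_cases hb : f b = c
      · simp [h, hb, (Fin.succ_ne_zero t).symm, hi.ne']
      · simp [f₀, h, hb]
    have hcard : ∀ i < c, ∀ t, ((Finset.univ.filter fun b => f₀ b = i).filter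
        fun b => h b = t).card = q := by
      intro i hi t
      rw [Finset.filter_filter]
      refine Fin.cases ?_ (fun t => ?_) t
      · simp only [hzero _ i hi]
        rw [← hg c (by simp [hcv]) ⟨i, hi⟩]
        simp only [Fin.ext_iff]
      · simp only [hsucc _ i hi]
        exact hg i (lt_trans (show i.val < m from hi) m.lt_succ_self) t
    have hf₀ : ∀ b, (f₀ b).val < m := by
      intro b
      simp only [f₀]
      split_ifs with hb
      · exact (g b).2
      · have := hf b
        rw [Fin.ext_iff] at hb
        omega
    have hrun := ih (by omega) f₀ hf₀ fun j hj => by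
      rw [Finset.card_eq_sum_card_fiberwise (f := h) (t := Finset.univ) (by simp [MapsTo]),
        Finset.sum_congr rfl fun t _ => hcard j hj t]
      simp only [Finset.sum_const, Finset.card_univ, Fintype.card_fin, smul_eq_mul]
      rw [hq]
      ring
    have hm0 : (0 : ℝ) < m := by positivity
    have hcell := hV c (by omega)
    by_cases hq0 : q = 0
    · exfalso
      have hpos := (V c).normalized
      rw [← cells_univ (idx := idx), hcell, Finset.card_univ, hq, hq0] at hpos
      simp at hpos
    refine .round m c _ _ (fun i t => cells idx ((Finset.univ.filter fun b => f₀ b = i).filter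
        fun b => h b = t)) (fun _ => 0) hrun rfl ?_ ?_ ?_ ?_
    · refine fun i hi => ⟨isPartition_cells hidx _ h, fun t => ?_⟩
      rw [hV i (lt_trans hi (by omega)), hcard i hi, hq]
      have : (0 : ℝ) < q := by positivity
      push_cast
      rw [div_le_div_iff₀ (by positivity) (by positivity)]
      nlinarith
    · intro i hi t
      rw [hcell, hcell, hcard i hi, hcard i hi]
    · intro i hi
      ext x
      have h0 := hzero (idx x) i hi
      simp only [mem_colourClasses, Set.mem_sdiff, mem_cells, Finset.mem_filter, Finset.mem_univ,
        true_and]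
      by_cases hb : f (idx x) = c
      · simp only [hb, true_and] at h0 ⊢
        have : c ≠ i := hi.ne'
        have hh : h (idx x) = 0 := if_pos hb
        simp only [this, hh]
        tauto
      · have h1 : f₀ (idx x) = f (idx x) := if_neg hb
        simp only [hb, false_and, iff_false] at h0
        rw [h1] at h0 ⊢
        tauto
    · ext x
      simp only [mem_colourClasses, mem_iUnion, mem_cells, Finset.mem_filter, Finset.mem_univ,
        true_and]
      constructor
      · rintro ⟨hx, hb⟩
        have hlt : (⟨g (idx x), by omega⟩ : Fin n) < c := (g (idx x)).2
        exact ⟨_, hlt, hx, (hzero _ _ hlt).2 ⟨hb, rfl⟩⟩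
      · rintro ⟨i, hi, hx, hb⟩
        exact ⟨hx, ((hzero _ i hi).1 hb).1⟩

lemma sum_comp_of_balanced {β : Type*} [Fintype β] {m q : ℕ} {f : β → Fin m}
    (hf : ∀ j, (Finset.univ.filter fun b => f b = j).card = q) (F : Fin m → ℝ) :
    ∑ b, F (f b) = q * ∑ j, F j := by
  rw [← Finset.sum_fiberwise Finset.univ f, Finset.mul_sum]
  refine Finset.sum_congr rfl fun j _ => ?_
  rw [Finset.sum_congr rfl fun b hb => by rw [(Finset.mem_filter.1 hb).2], Finset.sum_const, hf,
    nsmul_eq_mul]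

/-- The deviation of the values of the pieces cut by player `j` from the average, in the eyes of
the cutter `i`; the only player whom `i` is not to envy is `z`. -/
noncomputable def pieceDev {m : ℕ} (z i j : Fin m) : ℝ :=
  if j = i then 0 else if j = z then -((m : ℝ) - 1) else 1 / 2

/-- `m (m + 1)` times the value that player `i` assigns to the piece `t` of player `j`. -/
noncomputable def pieceValue {m : ℕ} (hm : 2 ≤ m) (z : Fin m → Fin m) :
    Fin (m + 1) → Fin m → Fin (m + 1) → ℝ :=
  Fin.lastCases (fun j _ => 1 + 1 / 2 *
      envyDev (⟨0, by omega⟩ : Fin m) (Finset.univ.erase ⟨0, by omega⟩) j)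
    fun i j t => 1 + pieceDev (z i) i j * envyDev 0 (Finset.univ.erase 0) t

section pieceValue

variable {m : ℕ} {hm : 2 ≤ m} {z : Fin m → Fin m}

lemma pieceValue_last (j : Fin m) (t : Fin (m + 1)) : pieceValue hm z (Fin.last m) j t =
    1 + 1 / 2 * envyDev (⟨0, by omega⟩ : Fin m) (Finset.univ.erase ⟨0, by omega⟩) j := by
  simp [pieceValue]

lemma pieceValue_castSucc (i j : Fin m) (t : Fin (m + 1)) : pieceValue hm z i.castSucc j t =
    1 + pieceDev (z i) i j * envyDev 0 (Finset.univ.erase 0) t := by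
  simp [pieceValue]

lemma envyDev_erase_self [NeZero m] :
    envyDev (0 : Fin (m + 1)) (Finset.univ.erase 0) 0 = -1 := by
  have h : (Finset.univ.erase (0 : Fin (m + 1))) ≠ ∅ := by
    rw [Ne, ← Finset.card_eq_zero, Finset.card_erase_of_mem (Finset.mem_univ _), Finset.card_univ,
      Fintype.card_fin]
    exact NeZero.ne m
  rw [envyDev, if_neg h, if_pos rfl]

lemma envyDev_erase_of_ne {k : ℕ} {z j : Fin k} (h : j ≠ z) :
    envyDev z (Finset.univ.erase z) j = 1 / ((k - 1 : ℕ) : ℝ) := by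
  have hj : j ∈ Finset.univ.erase z := Finset.mem_erase.2 ⟨h, Finset.mem_univ _⟩
  rw [envyDev, if_neg (Finset.ne_empty_of_mem hj), if_neg h, if_pos hj,
    Finset.card_erase_of_mem (Finset.mem_univ _), Finset.card_univ, Fintype.card_fin]

lemma sum_pieceValue_castSucc (i j : Fin m) : ∑ t, pieceValue hm z i.castSucc j t = m + 1 := by
  simp only [pieceValue_castSucc]
  rw [Finset.sum_add_distrib, ← Finset.mul_sum, sum_envyDev (by simp)]
  simp

lemma sum_pieceValue_last : ∑ j, ∑ t, pieceValue hm z (Fin.last m) j t = m * (m + 1) := by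
  simp only [pieceValue_last, Finset.sum_const, nsmul_eq_mul, ← Finset.mul_sum,
    Finset.sum_add_distrib, sum_envyDev (Finset.notMem_erase _ _)]
  simp only [Finset.card_univ, Fintype.card_fin]
  push_cast
  ring

lemma sum_pieceValue (i : Fin (m + 1)) : ∑ j, ∑ t, pieceValue hm z i j t = m * (m + 1) := by
  refine Fin.lastCases sum_pieceValue_last (fun i => ?_) i
  simp only [sum_pieceValue_castSucc, Finset.sum_const, Finset.card_univ, Fintype.card_fin,
    nsmul_eq_mul]

lemma pieceDev_lt_one (z i j : Fin m) : pieceDev z i j < 1 := by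
  have hm1 : (1 : ℝ) ≤ m := by
    have := i.pos
    exact_mod_cast this
  unfold pieceDev
  split_ifs <;> linarith

lemma neg_lt_pieceDev (z i j : Fin m) : -(m : ℝ) < pieceDev z i j := by
  have hm1 : (1 : ℝ) ≤ m := by
    have := i.pos
    exact_mod_cast this
  unfold pieceDev
  split_ifs <;> linarith

lemma pieceValue_pos (i : Fin (m + 1)) (j : Fin m) (t : Fin (m + 1)) :
    0 < pieceValue hm z i j t := by
  have : NeZero m := ⟨by omega⟩
  refine Fin.lastCases ?_ (fun i => ?_) i
  · rw [pieceValue_last]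
    have := neg_one_le_envyDev (⟨0, by omega⟩ : Fin m) (Finset.univ.erase ⟨0, by omega⟩) j
    linarith
  · rw [pieceValue_castSucc]
    have h1 := pieceDev_lt_one (z i) i j
    have h2 := neg_lt_pieceDev (z i) i j
    have hm0 : (0 : ℝ) < m := by positivity
    by_cases ht : t = 0
    · rw [ht, envyDev_erase_self]
      linarith
    · rw [envyDev_erase_of_ne ht, Nat.add_sub_cancel, mul_one_div,
        ← neg_lt_iff_pos_add', lt_div_iff₀ hm0]
      linarith

lemma sum_erase_pieceValue (i j : Fin m) :
    ∑ t ∈ Finset.univ.erase 0, pieceValue hm z i.castSucc j t = m + pieceDev (z i) i j := by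
  have : NeZero m := ⟨by omega⟩
  have h := sum_pieceValue_castSucc (hm := hm) (z := z) i j
  rw [← Finset.add_sum_erase _ _ (Finset.mem_univ 0), pieceValue_castSucc, envyDev_erase_self] at h
  linarith

/-- Piece `0` of `z i` counts `m` for the cutter `i`, and the own piece `0` counts `1`. Since `i`
keeps pieces worth `m`, the chooser is envied. -/
lemma lt_sum_pieceValue_zero (i : Fin m) (hz : z i ≠ i) :
    (m : ℝ) < ∑ j, pieceValue hm z i.castSucc j 0 := by
  have : NeZero m := ⟨by omega⟩
  have h := Finset.add_le_sum (s := Finset.univ)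
    (f := fun j => pieceValue hm z i.castSucc j 0) (fun j _ => (pieceValue_pos _ _ _).le)
    (Finset.mem_univ (z i)) (Finset.mem_univ i) hz
  refine lt_of_lt_of_le ?_ h
  rw [pieceValue_castSucc, pieceValue_castSucc, envyDev_erase_self, pieceDev, if_neg hz,
    if_pos rfl, pieceDev, if_pos rfl]
  linarith

lemma sum_pieceValue_last_zero : ∑ j, pieceValue hm z (Fin.last m) j 0 = m := by
  simp only [pieceValue_last, ← Finset.mul_sum, Finset.sum_add_distrib,
    sum_envyDev (Finset.notMem_erase _ _)]
  simp

/-- The chooser values all pieces of one cutter alike and undervalues only those of the cutter `0`.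
What any other cutter keeps exceeds the `m` that the chooser collects. -/
lemma lt_sum_erase_pieceValue_last (j : Fin m) (hj : j.val ≠ 0) :
    (m : ℝ) < ∑ t ∈ Finset.univ.erase 0, pieceValue hm z (Fin.last m) j t := by
  have hj' : j ≠ ⟨0, by omega⟩ := fun h => hj (by rw [h])
  have hm1 : (0 : ℝ) < ((m - 1 : ℕ) : ℝ) := by
    have : 0 < m - 1 := by omega
    exact_mod_cast this
  have hm0 : (0 : ℝ) < m := by positivity
  simp only [pieceValue_last]
  rw [Finset.sum_const, Finset.card_erase_of_mem (Finset.mem_univ _), Finset.card_univ,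
    Fintype.card_fin, Nat.add_sub_cancel, nsmul_eq_mul, envyDev_erase_of_ne hj']
  exact lt_mul_of_one_lt_right hm0 (by linarith [one_div_pos.2 hm1])

end pieceValue

/-- Each of `m.factorial` coarse cells is divided into `m + 1` fine ones. The cutters value all
coarse cells equally, so the rounds before the last can yield the colouring `f'`; deviations show
only when the last round separates the fine cells. The chooser takes piece `0` from everybody. Then
cutter `i` can be free of envy only towards `z i`, and the chooser only towards cutter `0`. -/
lemma exists_loneChooser_example {m : ℕ} (hm : 2 ≤ m) :
    ∃ V, ∃ A ∈ loneChooser (m + 1) V, envyFreeCount V A ≤ m + 1 := by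
  obtain ⟨q, hq⟩ : ∃ q, m.factorial = m * q :=
    ⟨(m - 1).factorial, (Nat.mul_factorial_pred (by omega)).symm⟩
  have hq0 : 0 < q := Nat.pos_of_ne_zero fun h => by
    rw [h, mul_zero] at hq
    exact m.factorial_ne_zero hq
  obtain ⟨f, hf⟩ := exists_even_split (s := (Finset.univ : Finset (Fin (m * q)))) (m := m) (q := q)
    (by omega) (by simp)
  have hmq : 0 < m * q := Nat.mul_pos (by omega) hq0
  have : Nonempty (Fin (m * q)) := ⟨⟨0, hmq⟩⟩
  obtain ⟨idx, hidx, hex⟩ := exists_cells (Fin (m * q) × Fin (m + 1))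
  have hm0 : (0 : ℝ) < m := by positivity
  have hqr : (0 : ℝ) < q := by positivity
  let z : Fin m → Fin m := fun i => if i.val = 0 then ⟨1, by omega⟩ else ⟨0, by omega⟩
  have hz : ∀ i, z i ≠ i := by
    intro i h
    by_cases hi : i.val = 0
    · simp [z, hi, Fin.ext_iff] at h
    · simp [z, hi, Fin.ext_iff] at h
      omega
  let U := pieceValue hm z
  choose V hV using fun i => hex (fun p => U i (f p.1) p.2 / (q * (m * (m + 1))))
    (fun p => div_pos (pieceValue_pos _ _ _) (by positivity)) (by
      rw [Fintype.sum_prod_type]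
      simp only [← Finset.sum_div]
      rw [sum_comp_of_balanced hf fun j => ∑ t, U i j t, sum_pieceValue]
      exact div_self (by positivity))
  have hval : ∀ i j T, V i (cells idx ((Finset.univ.filter fun b => f b = j) ×ˢ T)) =
      (∑ t ∈ T, U i j t) / (m * (m + 1)) := by
    intro i j T
    have hb : ∀ b ∈ Finset.univ.filter fun b => f b = j,
        ∑ t ∈ T, U i (f b) t / (q * (m * (m + 1))) = (∑ t ∈ T, U i j t) / (q * (m * (m + 1))) :=
      fun b hb => by rw [(Finset.mem_filter.1 hb).2, Finset.sum_div]
    rw [hV, Finset.sum_product, Finset.sum_congr rfl hb, Finset.sum_const, hf, nsmul_eq_mul]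
    field_simp
  have hzero : ∀ i, V i (cells idx (Finset.univ ×ˢ {0})) =
      (∑ j, U i j 0) / (m * (m + 1)) := by
    intro i
    rw [hV, Finset.sum_product]
    simp only [Finset.sum_singleton]
    rw [← Finset.sum_div, sum_comp_of_balanced hf fun j => U i j 0]
    field_simp
  let idx' : ℝ → Fin (m * q) := fun x => (idx x).1
  let f' : Fin (m * q) → Fin (m + 1) := fun b => (f b).castSucc
  have hcells : ∀ s, cells idx' s = cells idx (s ×ˢ Finset.univ) := by
    intro s
    ext x
    simp [mem_cells, idx']
  have hrun : LoneChooserRun V m (colourClasses idx' f') := by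
    refine loneChooserRun_of_equal_cells (l := m) (fun s => by rw [hcells]; exact hidx _) (by omega)
      ?_ (by simp [hq]) hm le_rfl f' (fun b => by simp [f']) fun j hj => ?_
    · intro i hi s
      obtain ⟨i, rfl⟩ : ∃ k : Fin m, i = k.castSucc := ⟨⟨i, hi⟩, rfl⟩
      rw [hcells, hV, Finset.sum_product]
      simp only [← Finset.sum_div]
      rw [Finset.sum_congr rfl fun b _ => sum_pieceValue_castSucc i (f b), Finset.sum_const,
        nsmul_eq_mul, Fintype.card_fin]
      push_cast
      field_simp
    · obtain ⟨j, rfl⟩ : ∃ k : Fin m, j = k.castSucc := ⟨⟨j, hj⟩, rfl⟩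
      simp [f', hf]
  let o : Fin (m * q) × Fin (m + 1) → Fin (m + 1) :=
    fun p => if p.2 = 0 then Fin.last m else (f p.1).castSucc
  let A := colourClasses idx o
  have hpiece : ∀ j t, ((Finset.univ.filter fun p : Fin (m * q) × Fin (m + 1) =>
      (f p.1).castSucc = j.castSucc).filter fun p => p.2 = t) =
      (Finset.univ.filter fun b => f b = j) ×ˢ {t} := by
    intro j t
    ext p
    simp only [Finset.mem_filter, Finset.mem_product, Finset.mem_univ, true_and,
      Finset.mem_singleton, Fin.castSucc_inj]
  have hclass : ∀ j, colourClasses idx' f' j = cells idx (Finset.univ.filter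
      fun p : Fin (m * q) × Fin (m + 1) => (f p.1).castSucc = j) := by
    intro j
    ext x
    simp [mem_colourClasses, mem_cells, idx', f']
  have hA : A ∈ loneChooser (m + 1) V := by
    refine .round m (Fin.last m) _ _ (fun i t => cells idx ((Finset.univ.filter
      fun p : Fin (m * q) × Fin (m + 1) => (f p.1).castSucc = i).filter fun p => p.2 = t))
      (fun _ => 0) hrun rfl ?_ ?_ ?_ ?_
    · intro i hi
      rw [hclass]
      refine ⟨isPartition_cells hidx _ _, fun t => ?_⟩
      obtain ⟨i, rfl⟩ : ∃ k : Fin m, i = k.castSucc := ⟨⟨i, hi⟩, rfl⟩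
      simp only [hpiece, hval, Finset.sum_singleton, U]
      rw [pieceValue_castSucc, pieceDev, if_pos rfl, zero_mul,
        add_zero]
    · intro i hi t
      obtain ⟨i, rfl⟩ : ∃ k : Fin m, i = k.castSucc := ⟨⟨i, hi⟩, rfl⟩
      simp only [hpiece, hval, Finset.sum_singleton]
      exact le_of_eq (by simp only [U, pieceValue_last])
    · intro i hi
      rw [hclass]
      ext x
      have : Fin.last m ≠ i := hi.ne'
      simp only [A, o, mem_colourClasses, Set.mem_sdiff, mem_cells, Finset.mem_filter,
        Finset.mem_univ, true_and]
      by_cases h0 : (idx x).2 = 0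
      · simp only [h0, if_true, this]
        tauto
      · simp only [h0, if_false]
        tauto
    · ext x
      simp only [A, o, mem_colourClasses, mem_iUnion, mem_cells, Finset.mem_filter,
        Finset.mem_univ, true_and]
      by_cases h0 : (idx x).2 = 0
      · simp only [h0, if_true, and_true]
        exact ⟨fun hx => ⟨_, Fin.castSucc_lt_last _, hx, rfl⟩, fun ⟨_, _, hx, _⟩ => hx⟩
      · simp only [h0, if_false, (Fin.castSucc_lt_last _).ne, and_false, exists_false]
  have hAcast : ∀ j : Fin m, A j.castSucc =
      cells idx ((Finset.univ.filter fun b => f b = j) ×ˢ Finset.univ.erase 0) := by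
    intro j
    ext x
    simp only [A, o, mem_colourClasses, mem_cells, Finset.mem_product, Finset.mem_filter,
      Finset.mem_univ, Finset.mem_erase, true_and, and_true]
    by_cases h0 : (idx x).2 = 0
    · simp [h0, (Fin.castSucc_lt_last j).ne']
    · simp [h0]
  have hAlast : A (Fin.last m) = cells idx (Finset.univ ×ˢ {0}) := by
    ext x
    simp only [A, o, mem_colourClasses, mem_cells, Finset.mem_product, Finset.mem_singleton,
      Finset.mem_univ, true_and]
    by_cases h0 : (idx x).2 = 0
    · simp [h0]
    · simp [h0, (Fin.castSucc_lt_last _).ne]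
  let T : Fin (m + 1) → Finset (Fin (m + 1)) :=
    Fin.lastCases {(⟨0, by omega⟩ : Fin m).castSucc} fun i => {(z i).castSucc}
  have hpos : (0 : ℝ) < m * (m + 1) := by positivity
  refine ⟨V, A, hA, (envyFreeCount_le_sum (T := T) fun i => ?_).trans ?_⟩
  · refine Fin.lastCases (fun j => ?_) (fun i j => ?_) i
    · refine Fin.lastCases (fun h => absurd rfl h) (fun j _ hle => ?_) j
      by_contra hj
      simp only [T, Fin.lastCases_last, Finset.mem_singleton, Fin.castSucc_inj] at hj
      rw [hAcast, hAlast, hval, hzero, div_le_div_iff_of_pos_right hpos,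
        sum_pieceValue_last_zero] at hle
      exact absurd hle (not_le.2 (lt_sum_erase_pieceValue_last j fun h => hj (Fin.ext h)))
    · refine Fin.lastCases (fun _ hle => ?_) (fun j hij hle => ?_) j
      · rw [hAcast, hAlast, hval, hzero, div_le_div_iff_of_pos_right hpos,
          sum_erase_pieceValue, pieceDev, if_pos rfl, add_zero] at hle
        exact absurd hle (not_le.2 (lt_sum_pieceValue_zero i (hz i)))
      · by_contra hj
        simp only [T, Fin.lastCases_castSucc, Finset.mem_singleton, Fin.castSucc_inj] at hj
        rw [hAcast, hAcast, hval, hval, div_le_div_iff_of_pos_right hpos,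
          sum_erase_pieceValue, sum_erase_pieceValue, pieceDev, if_neg fun h => hij (by rw [h]),
          if_neg hj, pieceDev, if_pos rfl] at hle
        linarith
  · rw [Fin.sum_univ_castSucc]
    simp [T]

theorem hasDGEF_loneChooser {n : ℕ} (hn : 3 ≤ n) : HasDGEF (loneChooser n) n := by
  obtain ⟨m, rfl⟩ : ∃ m, n = m + 1 := ⟨n - 1, by omega⟩
  have h := isProportional_loneChooser (by omega : 2 ≤ m + 1)
  exact .intro h (fun _ _ hA => h.le_envyFreeCount (by omega) hA)
    (exists_loneChooser_example (by omega))

end CakeCutting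

namespace CakeCutting

open Set

/-! ### Recursive Divide and Choose: proportionality -/

lemma IsPartition.subset {k : ℕ} {R : Set ℝ} {Q : Fin k → Set ℝ} (h : IsPartition R Q) (j : Fin k) :
    Q j ⊆ R := h.2.2 ▸ subset_iUnion Q j

/-- Collecting parts of a partition, according to their owners, gives a partition. -/
lemma IsPartition.collect {k l : ℕ} {R : Set ℝ} {Q : Fin k → Set ℝ} (h : IsPartition R Q)
    (o : Fin k → Fin l) : IsPartition R fun s => ⋃ t, ⋃ (_ : o t = s), Q t := by
  refine ⟨fun s => ?_, fun s s' hs => ?_, ?_⟩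
  · refine .iUnion fun t => ?_
    by_cases ht : o t = s
    · simpa [ht] using h.1 t
    · simpa [ht] using isPortion_empty
  · simp only [disjoint_iUnion_left, disjoint_iUnion_right]
    intro t ht t' ht'
    exact h.2.1 _ _ fun e => hs (by rw [← ht, ← ht', e])
  · rw [← h.2.2]
    ext x
    simp only [mem_iUnion, exists_prop]
    exact ⟨fun ⟨_, t, _, hx⟩ => ⟨t, hx⟩, fun ⟨t, hx⟩ => ⟨_, t, rfl, hx⟩⟩

/-- Partitions of the parts of a partition give a partition. -/
lemma IsPartition.refine {k l : ℕ} {R : Set ℝ} {Q : Fin k → Set ℝ} (h : IsPartition R Q)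
    {P : Fin k → Fin l → Set ℝ} (hP : ∀ j, IsPartition (Q j) (P j)) :
    IsPartition R fun s => ⋃ j, P j s := by
  refine ⟨fun s => .iUnion fun j => (hP j).1 s, fun s s' hs => ?_, ?_⟩
  · simp only [disjoint_iUnion_left, disjoint_iUnion_right]
    intro j j'
    by_cases hj : j' = j
    · rw [hj]
      exact (hP j).2.1 _ _ hs
    · exact (h.2.1 _ _ hj).mono ((hP j').subset s) ((hP j).subset s')
  · rw [iUnion_comm, ← h.2.2]
    exact iUnion_congr fun j => (hP j).2.2

lemma CutAndChoose.isPartition {a b : Valuation} {R : Set ℝ} {B : Fin 2 → Set ℝ} {i j : Fin 2}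
    (hij : i ≠ j) (h : CutAndChoose a b R (B i) (B j)) : IsPartition R B := by
  have hs := h.isSharing hij
  rw [show ({i, j} : Finset (Fin 2)) = Finset.univ by
    clear h hs
    revert i j
    decide] at hs
  exact ⟨fun i => hs.portion i (Finset.mem_univ i), fun i j hij =>
    hs.disjoint (Finset.mem_coe.2 (Finset.mem_univ i)) (Finset.mem_coe.2 (Finset.mem_univ j)) hij,
    by simpa using hs.cover⟩

lemma CutAndChoose.fair {a b : Valuation} {R X Y : Set ℝ} (h : CutAndChoose a b R X Y) :
    a R ≤ 2 * a X ∧ b R ≤ 2 * b Y := by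
  obtain ⟨h1, -, h3⟩ := h.values
  constructor <;> linarith

/-- The `k` best of `k + 1` portions have at least an average value. -/
lemma Valuation.le_sum_best (v : Valuation) {k : ℕ} {R : Set ℝ} {Q : Fin (k + 1) → Set ℝ}
    (h : IsPartition R Q) {M : Finset (Fin (k + 1))} (hM : M.card = k)
    (hbest : ∀ j ∈ M, ∀ j' ∉ M, v (Q j') ≤ v (Q j)) :
    (k : ℝ) * v R ≤ (k + 1) * ∑ j ∈ M, v (Q j) := by
  have hc : Mᶜ.card = 1 := by
    rw [Finset.card_compl, Fintype.card_fin, hM, Nat.add_sub_cancel_left]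
  obtain ⟨j', hj'⟩ := Finset.card_eq_one.1 hc
  have hmem : j' ∉ M := by
    rw [← Finset.mem_compl, hj']
    exact Finset.mem_singleton_self _
  have hs := v.partition h
  rw [← Finset.sum_add_sum_compl M, hj', Finset.sum_singleton] at hs
  have hle := Finset.card_nsmul_le_sum M (fun j => v (Q j)) (v (Q j'))
    fun j hj => hbest j hj j' hmem
  rw [hM, nsmul_eq_mul] at hle
  rw [← hs]
  linarith

section round

variable {m : ℕ} {w : Fin (m + 3) → Valuation} {R : Set ℝ} {d : Fin (m + 3)}
  {Q : Fin (m + 3) → Set ℝ} {mark : Fin (m + 3) → Finset (Fin (m + 3))}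
  {slot : Fin (m + 3) → Fin (m + 2) → Fin (m + 3)}

lemma card_slots_of_mark (h1 : ∀ j s, s ≠ d → j ∈ mark s → ∃! t, slot j t = s)
    (h2 : ∀ j s, s ≠ d → j ∉ mark s → ∀ t, slot j t ≠ s) (j : Fin (m + 3)) {s : Fin (m + 3)}
    (hs : s ≠ d) :
    (Finset.univ.filter fun t => slot j t = s).card = if j ∈ mark s then 1 else 0 := by
  split_ifs with hj
  · obtain ⟨t, ht, hu⟩ := h1 j s hs hj
    refine Finset.card_eq_one.2 ⟨t, ?_⟩
    ext t'
    simp only [Finset.mem_filter, Finset.mem_univ, true_and, Finset.mem_singleton]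
    exact ⟨fun h => hu t' h, fun h => h ▸ ht⟩
  · rw [Finset.card_eq_zero, Finset.filter_eq_empty_iff]
    exact fun t _ => h2 j s hs hj t

/-- There are `(m + 3) (m + 2)` slots, and each of the `m + 2` other participants holds `m + 2` of
them. The divider and the clones hold the rest. -/
lemma sum_card_slots_divider (hmark : ∀ s, s ≠ d → (mark s).card = m + 2)
    (h1 : ∀ j s, s ≠ d → j ∈ mark s → ∃! t, slot j t = s)
    (h2 : ∀ j s, s ≠ d → j ∉ mark s → ∀ t, slot j t ≠ s) :
    ∑ j, (Finset.univ.filter fun t => slot j t = d).card = m + 2 := by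
  have hall : ∑ s, ∑ j, (Finset.univ.filter fun t => slot j t = s).card = (m + 3) * (m + 2) := by
    rw [Finset.sum_comm]
    have : ∀ j, ∑ s, (Finset.univ.filter fun t => slot j t = s).card = m + 2 := fun j => by
      rw [← Finset.card_eq_sum_card_fiberwise (by simp [MapsTo]), Finset.card_univ,
        Fintype.card_fin]
    simp [this]
  have hother : ∀ s ∈ Finset.univ.erase d,
      ∑ j, (Finset.univ.filter fun t => slot j t = s).card = m + 2 := by
    intro s hs
    have hs' := Finset.ne_of_mem_erase hs
    rw [Finset.sum_congr rfl fun j _ => card_slots_of_mark h1 h2 j hs', ← hmark s hs']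
    simp
  rw [← Finset.add_sum_erase _ _ (Finset.mem_univ d), Finset.sum_congr rfl hother,
    Finset.sum_const, Finset.card_erase_of_mem (Finset.mem_univ _), Finset.card_univ,
    Fintype.card_fin, smul_eq_mul] at hall
  have e : m + 3 - 1 = m + 2 := rfl
  rw [e] at hall
  linarith

/-- The owners of slots get enough from a round if they get enough from every slot. -/
lemma round_fair (hQ : IsPartition R Q) (hd : ∀ j, w d (Q j) = w d R / ((m + 3 : ℕ) : ℝ))
    (hmark : ∀ s, s ≠ d → (mark s).card = m + 2 ∧
      ∀ j ∈ mark s, ∀ j', j' ∉ mark s → w s (Q j') ≤ w s (Q j))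
    (h1 : ∀ j s, s ≠ d → j ∈ mark s → ∃! t, slot j t = s)
    (h2 : ∀ j s, s ≠ d → j ∉ mark s → ∀ t, slot j t ≠ s)
    {P : Fin (m + 3) → Fin (m + 3) → Set ℝ} (hP : ∀ j, IsPartition (Q j) (P j))
    (hfair : ∀ j s, ((Finset.univ.filter fun t => slot j t = s).card : ℝ) * w s (Q j) ≤
      (m + 2) * w s (P j s)) (s : Fin (m + 3)) :
    w s R ≤ ((m + 3 : ℕ) : ℝ) * w s (⋃ j, P j s) := by
  have hval : w s (⋃ j, P j s) = ∑ j, w s (P j s) :=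
    (w s).iUnion (fun j => (hP j).1 s) fun j j' hj =>
      (hQ.2.1 j j' hj).mono ((hP j).subset s) ((hP j').subset s)
  have hle := Finset.sum_le_sum fun j (_ : j ∈ Finset.univ) => hfair j s
  rw [← Finset.mul_sum, ← hval] at hle
  have hm : (0 : ℝ) < m + 2 := by positivity
  push_cast
  refine le_of_mul_le_mul_left ?_ hm
  -- The divider has `m + 2` slots in portions worth `1 / (m + 3)` of `R` each. Any other
  -- participant has one slot in each of `m + 2` best portions, which together are worth at least
  -- `(m + 2) / (m + 3)` of `R`.
  by_cases hs : s = d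
  · subst hs
    simp only [hd] at hle
    have hsum := sum_card_slots_divider (fun s hs => (hmark s hs).1) h1 h2
    rw [← Finset.sum_mul, ← Nat.cast_sum, hsum] at hle
    push_cast at hle
    have h3 : (0 : ℝ) < (m : ℝ) + 3 := by positivity
    rw [mul_div_assoc', div_le_iff₀ h3] at hle
    linarith
  · simp only [card_slots_of_mark h1 h2 _ hs, Nat.cast_ite, Nat.cast_one, Nat.cast_zero, ite_mul,
      one_mul, zero_mul, Finset.sum_ite_mem, Finset.univ_inter] at hle
    have hb := (w s).le_sum_best hQ (hmark s hs).1 (hmark s hs).2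
    push_cast at hb
    have h3 : (0 : ℝ) < (m : ℝ) + 3 := by positivity
    nlinarith

end round

/-- By induction each slot yields its holder at least `1 / (m + 2)` of the portion. A participant's
slots add up, so that clones count with multiplicity, and `round_fair` collects the portions. -/
lemma RecursiveRun.fair {m : ℕ} {w : Fin m → Valuation} {R : Set ℝ} {B : Fin m → Set ℝ}
    (hR : IsPortion R) (H : RecursiveRun m w R B) :
    IsPartition R B ∧ ∀ s, w s R ≤ (m : ℝ) * w s (B s) := by
  induction m using Nat.strong_induction_on generalizing R with
  | _ m ih =>
    match m, w, B, H with
    | 0, _, _, H => exact H.elim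
    | 1, w, B, H =>
      have H' : B 0 = R := H
      refine ⟨⟨fun j => ?_, fun i j hij => absurd (Subsingleton.elim i j) hij, ?_⟩, fun s => ?_⟩
      · rw [Subsingleton.elim j 0, H']
        exact hR
      · ext x
        simp [H']
      · rw [Subsingleton.elim s 0, H']
        simp
    | 2, w, B, H =>
      rcases H with h | h
      · refine ⟨h.isPartition (by decide), fun s => ?_⟩
        have hf := h.fair
        fin_cases s
        exacts [hf.1, hf.2]
      · refine ⟨h.isPartition (by decide), fun s => ?_⟩
        have hf := h.fair
        fin_cases s
        exacts [hf.2, hf.1]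
    | m + 3, w, B, H =>
      obtain ⟨d, Q, mark, slot, B', hQ, hd, hmark, h1, h2, hrun, hrest, hB⟩ := H
      have hmarked : ∀ j, (∃ s, s ≠ d ∧ j ∈ mark s) → IsPartition (Q j) (B' j) ∧
          ∀ t, w (slot j t) (Q j) ≤ ((m + 2 : ℕ) : ℝ) * w (slot j t) (B' j t) :=
        fun j hj => ih (m + 2) (by omega) (hQ.1 j) (hrun j hj)
      have hslot : ∀ j, (¬ ∃ s, s ≠ d ∧ j ∈ mark s) → ∀ t, slot j t = d := by
        intro j hj t
        by_contra hne
        exact h2 j _ hne (fun h => hj ⟨_, hne, h⟩) t rfl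
      let P : Fin (m + 3) → Fin (m + 3) → Set ℝ := fun j s => ⋃ t, ⋃ (_ : slot j t = s), B' j t
      have hPd : ∀ j, (¬ ∃ s, s ≠ d ∧ j ∈ mark s) → P j d = Q j := by
        intro j hj
        simp only [P, hslot j hj, iUnion_true]
        exact hrest j hj
      have hPne : ∀ j, (¬ ∃ s, s ≠ d ∧ j ∈ mark s) → ∀ s, s ≠ d → P j s = ∅ := by
        intro j hj s hs
        simp [P, hslot j hj, hs.symm]
      have hP : ∀ j, IsPartition (Q j) (P j) := by
        intro j
        by_cases hj : ∃ s, s ≠ d ∧ j ∈ mark s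
        · exact (hmarked j hj).1.collect _
        · refine ⟨fun s => ?_, fun s s' hss => ?_, ?_⟩
          · by_cases hs : s = d
            · rw [hs, hPd j hj]
              exact hQ.1 j
            · rw [hPne j hj s hs]
              exact isPortion_empty
          · by_cases hs : s = d
            · rw [hPne j hj s' fun h => hss (hs.trans h.symm)]
              exact disjoint_empty _
            · rw [hPne j hj s hs]
              exact empty_disjoint _
          · refine Subset.antisymm (iUnion_subset fun s => ?_)
              ((hPd j hj).symm.subset.trans (subset_iUnion (P j) d))
            by_cases hs : s = d
            · rw [hs, hPd j hj]
            · rw [hPne j hj s hs]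
              exact empty_subset _
      have hBP : B = fun s => ⋃ j, P j s := funext hB
      rw [hBP]
      refine ⟨hQ.refine hP, round_fair hQ hd hmark h1 h2 hP fun j s => ?_⟩
      by_cases hj : ∃ s, s ≠ d ∧ j ∈ mark s
      · obtain ⟨hpart, hfair⟩ := hmarked j hj
        have hPs : P j s = ⋃ t ∈ Finset.univ.filter fun t => slot j t = s, B' j t := by
          simp [P]
        rw [hPs, (w s).biUnion (fun t _ => hpart.1 t) fun t _ t' _ ht => hpart.2.1 t t' ht,
          Finset.mul_sum, ← nsmul_eq_mul]
        refine Finset.card_nsmul_le_sum _ _ _ fun t ht => ?_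
        have := hfair t
        rw [(Finset.mem_filter.1 ht).2] at this
        exact_mod_cast this
      · by_cases hs : s = d
        · rw [hs, hPd j hj]
          refine mul_le_mul_of_nonneg_right ?_ ((w d).nonneg (hQ.1 j))
          have := Finset.card_filter_le (Finset.univ : Finset (Fin (m + 2))) fun t => slot j t = d
          rw [Finset.card_univ, Fintype.card_fin] at this
          exact_mod_cast this
        · rw [hPne j hj s hs, Valuation.empty, mul_zero]
          simp [hslot j hj, Ne.symm hs]

lemma exists_recursiveRun {m : ℕ} (hm : 0 < m) (w : Fin m → Valuation) {R : Set ℝ}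
    (hR : IsPortion R) : ∃ B, RecursiveRun m w R B := by
  induction m using Nat.strong_induction_on generalizing R with
  | _ m ih =>
    match m, w with
    | 0, _ => exact absurd hm (lt_irrefl _)
    | 1, w => exact ⟨fun _ => R, rfl⟩
    | 2, w =>
      obtain ⟨X, Y, h⟩ := exists_cutAndChoose (w 0) (w 1) hR
      exact ⟨![X, Y], Or.inl h⟩
    | m + 3, w =>
      obtain ⟨Q, hQ, hd⟩ := (w 0).exists_equal_partition hR (Nat.succ_pos (m + 2))
      choose worst hworst using fun s => Finite.exists_min fun j => w s (Q j)
      -- Slot `t` of every portion is reserved for participant `t.succ`. It falls to the divider `0`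
      -- in the one portion that this participant does not mark.
      let slot : Fin (m + 3) → Fin (m + 2) → Fin (m + 3) :=
        fun j t => if j = worst t.succ then 0 else t.succ
      choose B' hB' using fun j => ih (m + 2) (by omega) (by omega) (fun t => w (slot j t)) (hQ.1 j)
      refine ⟨_, 0, Q, fun s => Finset.univ.erase (worst s), slot, B', hQ, hd, fun s _ => ⟨?_, ?_⟩,
        ?_, ?_, fun j _ => hB' j, fun j _ => ((hB' j).fair (hQ.1 j)).1.2.2, fun s => rfl⟩
      · rw [Finset.card_erase_of_mem (Finset.mem_univ _), Finset.card_univ, Fintype.card_fin]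
        rfl
      · intro j _ j' hj'
        have : j' = worst s := by simpa using hj'
        rw [this]
        exact hworst s j
      · intro j s hs hj
        obtain ⟨t, rfl⟩ := Fin.exists_succ_eq.2 hs
        have hj' := Finset.ne_of_mem_erase hj
        refine ⟨t, if_neg hj', fun t' ht' => ?_⟩
        simp only [slot] at ht'
        split_ifs at ht'
        · exact absurd ht'.symm (Fin.succ_ne_zero t)
        · exact Fin.succ_injective _ ht'
      · intro j s hs hj t ht
        have hj' : j = worst s := by simpa using hj
        simp only [slot] at ht
        split_ifs at ht with hne
        · exact hs ht.symm
        · rw [ht] at hne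
          exact hne hj'

lemma isProportional_recursiveDivideAndChoose {n : ℕ} (hn : 0 < n) :
    IsProportional (recursiveDivideAndChoose n) :=
  .of_isSharing hn (fun V => exists_recursiveRun hn V isPortion_cake) fun V A hA => by
    obtain ⟨h, hf⟩ := RecursiveRun.fair isPortion_cake hA
    refine ⟨⟨fun i _ => h.1 i, fun i _ j _ hij => h.2.1 i j hij, by simpa using h.2.2⟩,
      fun i => ?_⟩
    have hi := hf i
    have hn0 : (0 : ℝ) < n := by positivity
    rw [(V i).normalized] at hi
    rw [div_le_iff₀ hn0, mul_comm]
    exact hi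

/-! ### Recursive Divide and Choose: a result with `n` envy-free-relations -/

/-- If all cells have the same value for all participants, every balanced colouring of the cells is
a possible result of Recursive Divide and Choose. -/
lemma recursiveRun_of_equal_cells {β : Type*} [DecidableEq β] {idx : ℝ → β}
    (hidx : ∀ s, IsPortion (cells idx s)) {m q : ℕ} (hm : 0 < m) {w : Fin m → Valuation} {x : ℝ}
    {s : Finset β} (hw : ∀ i, ∀ b ⊆ s, w i (cells idx b) = b.card * x) (f : β → Fin m)
    (hbal : ∀ j, (s.filter fun b => f b = j).card = (m - 1).factorial * q) :
    RecursiveRun m w (cells idx s) fun j => cells idx (s.filter fun b => f b = j) := by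
  induction m using Nat.strong_induction_on generalizing s q with
  | _ m ih =>
    match m, w, f with
    | 0, _, _ => exact absurd hm (lt_irrefl _)
    | 1, w, f =>
      change cells idx _ = _
      rw [Finset.filter_true_of_mem fun b _ => Subsingleton.elim _ _]
    | 2, w, f =>
      have hv : ∀ i j, w i (cells idx (s.filter fun b => f b = j)) = q * x := by
        intro i j
        rw [hw i _ (Finset.filter_subset _ _), hbal]
        simp
      have hp := isPartition_cells hidx s f
      refine Or.inl ⟨hp.1 0, hp.1 1, hp.2.1 0 1 (by decide), ?_, ?_, ?_⟩
      · rw [← hp.2.2]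
        ext y
        simp only [mem_union, mem_iUnion, Fin.exists_fin_two]
      · rw [hv, hv]
      · rw [hv, hv]
    | m + 3, w, f =>
      have hcard : ∀ j, (s.filter fun b => f b = j).card = (m + 2) * ((m + 1).factorial * q) := by
        intro j
        rw [hbal, ← mul_assoc]
        rfl
      obtain ⟨g, hg⟩ := exists_even_split_classes (C := univ) (by omega : 0 < m + 2)
        fun j _ => hcard j
      -- Portion `0` consists of what the divider `0` is to receive, and nobody marks it. Every
      -- other portion contains equally many cells of each other colour, so it is shared without
      -- clones of the divider and the induction continues with `m + 2` colours.
      let h : β → Fin (m + 3) := fun b => if f b = 0 then 0 else (g b).succ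
      have h0 : ∀ b, h b = 0 ↔ f b = 0 := fun b => by
        by_cases hb : f b = 0 <;> simp [h, hb]
      have hsucc : ∀ b k t, h b = Fin.succ k ∧ f b = Fin.succ t ↔ f b = Fin.succ t ∧ g b = k := by
        intro b k t
        by_cases hb : f b = 0
        · simp [hb, (Fin.succ_ne_zero t).symm]
        · simp only [h, hb, if_false, Fin.succ_inj]
          exact and_comm
      let f' : β → Fin (m + 2) := fun b => Fin.predAbove 0 (f b)
      have hf' : ∀ b k t, h b = Fin.succ k → (f' b = t ↔ f b = Fin.succ t) := by
        intro b k t hb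
        have hne : f b ≠ 0 := fun h' => Fin.succ_ne_zero k (hb.symm.trans ((h0 b).2 h'))
        obtain ⟨t', ht'⟩ := Fin.exists_succ_eq.2 hne
        simp only [f', ← ht', Fin.predAbove_zero_succ, Fin.succ_inj]
      have hsub : ∀ k t, ((s.filter fun b => h b = Fin.succ k).filter fun b => f' b = t) =
          s.filter fun b => f b = Fin.succ t ∧ g b = k := by
        intro k t
        ext b
        simp only [Finset.mem_filter, and_assoc, and_congr_right_iff]
        intro _
        rw [← hsucc]
        exact and_congr_right fun hb => hf' b k t hb
      have hQcard : ∀ j, (s.filter fun b => h b = j).card = (m + 2) * ((m + 1).factorial * q) := by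
        intro j
        refine Fin.cases ?_ (fun k => ?_) j
        · simp only [h0]
          exact hcard 0
        · rw [Finset.card_eq_sum_card_fiberwise (f := f') (t := Finset.univ) (by simp [MapsTo])]
          simp only [hsub, hg _ (mem_univ _)]
          simp
      have hscard : s.card = (m + 3) * ((m + 2) * ((m + 1).factorial * q)) := by
        rw [Finset.card_eq_sum_card_fiberwise (f := h) (t := Finset.univ) (by simp [MapsTo])]
        simp only [hQcard]
        simp
      have hv : ∀ i j, w i (cells idx (s.filter fun b => h b = j)) =
          w i (cells idx s) / ((m + 3 : ℕ) : ℝ) := by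
        intro i j
        rw [hw i _ (Finset.filter_subset _ _), hw i _ Finset.Subset.rfl, hQcard, hscard]
        have : ((m + 3 : ℕ) : ℝ) ≠ 0 := Nat.cast_ne_zero.2 (by omega)
        rw [Nat.cast_mul (m + 3)]
        field_simp
      refine ⟨0, fun j => cells idx (s.filter fun b => h b = j), fun _ => Finset.univ.erase 0,
        fun j t => if j = 0 then 0 else t.succ, fun j t => if j = 0 then
          cells idx (s.filter fun b => f b = 0) else
          cells idx ((s.filter fun b => h b = j).filter fun b => f' b = t),
        isPartition_cells hidx s h, hv 0, fun i _ => ⟨by simp, fun j _ j' _ => by rw [hv, hv]⟩,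
        ?_, ?_, ?_, ?_, ?_⟩
      · intro j i hi hj
        obtain ⟨t, rfl⟩ := Fin.exists_succ_eq.2 hi
        have hj' := Finset.ne_of_mem_erase hj
        refine ⟨t, if_neg hj', fun t' ht' => ?_⟩
        simpa only [if_neg hj', Fin.succ_inj] using ht'
      · intro j i hi hj t
        have hj' : j = 0 := by simpa using hj
        simpa only [if_pos hj'] using hi.symm
      · rintro j ⟨i, hi, hj⟩
        obtain ⟨k, rfl⟩ := Fin.exists_succ_eq.2 (Finset.ne_of_mem_erase hj)
        simp only [if_neg (Fin.succ_ne_zero k)]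
        refine ih (m + 2) (by omega) (by omega) (fun t b hb => hw _ b
          (hb.trans (Finset.filter_subset _ _))) f' (q := q) fun t => ?_
        rw [hsub, hg _ (mem_univ _)]
        rfl
      · intro j hj
        have hj' : j = 0 := by
          by_contra hne
          exact hj ⟨1, by simp, Finset.mem_erase.2 ⟨hne, Finset.mem_univ _⟩⟩
        simp only [hj', if_true, h0, iUnion_const]
      · intro i
        ext y
        simp only [mem_iUnion, exists_prop]
        refine Fin.cases ?_ (fun t => ?_) i
        · constructor
          · exact fun hy => ⟨0, 0, if_pos rfl, by simpa using hy⟩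
          · rintro ⟨j, t, hjt, hy⟩
            by_cases hj : j = 0
            · simpa only [if_pos hj] using hy
            · rw [if_neg hj] at hjt
              exact absurd hjt (Fin.succ_ne_zero t)
        · constructor
          · intro hy
            rw [mem_cells, Finset.mem_filter] at hy
            refine ⟨(g (idx y)).succ, t, if_neg (Fin.succ_ne_zero _), ?_⟩
            rw [if_neg (Fin.succ_ne_zero _), hsub, mem_cells, Finset.mem_filter]
            exact ⟨hy.1, hy.2.1, hy.2.2, rfl⟩
          · rintro ⟨j, t', hjt, hy⟩
            by_cases hj : j = 0
            · rw [if_pos hj] at hjt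
              exact absurd hjt.symm (Fin.succ_ne_zero t)
            · rw [if_neg hj, Fin.succ_inj] at hjt
              obtain ⟨k, rfl⟩ := Fin.exists_succ_eq.2 hj
              rw [if_neg hj, hsub, hjt, mem_cells, Finset.mem_filter] at hy
              rw [mem_cells, Finset.mem_filter]
              exact ⟨hy.1, hy.2.1, hy.2.2.1⟩

/-- `n (n - 1)` times the value that player `i` assigns to the part of the `j`-th piece that goes to
its `t`-th slot. -/
noncomputable def slotValue {m : ℕ} (i j : Fin (m + 3)) (t : Fin (m + 2)) : ℝ :=
  1 + if j = i then 1 / 2 * envyDev 0 (Finset.univ.erase 0) t else 0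

lemma slotValue_pos {m : ℕ} (i j : Fin (m + 3)) (t : Fin (m + 2)) : 0 < slotValue i j t := by
  have := neg_one_le_envyDev 0 (Finset.univ.erase 0) t
  unfold slotValue
  split_ifs <;> linarith

lemma sum_slotValue {m : ℕ} (i j : Fin (m + 3)) : ∑ t, slotValue i j t = m + 2 := by
  unfold slotValue
  rw [Finset.sum_add_distrib]
  split_ifs
  · rw [← Finset.mul_sum, sum_envyDev (Finset.notMem_erase _ _)]
    simp
  · simp

/-- What the slots of player `s` are worth to player `i`. -/
lemma sum_slotValue_owner {m : ℕ} (i s : Fin (m + 3)) :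
    ∑ j : Fin (m + 3), ∑ t, (if j.succAbove t = s then slotValue i j t else 0) =
      m + 2 + ∑ t, if i.succAbove t = s then 1 / 2 * envyDev 0 (Finset.univ.erase 0) t else 0 := by
  have hrow : ∀ j : Fin (m + 3), ∑ t, (if j.succAbove t = s then (1 : ℝ) else 0) =
      1 - if j = s then 1 else 0 := by
    intro j
    have h := Fin.sum_univ_succAbove (fun k => if k = s then (1 : ℝ) else 0) j
    rw [Finset.sum_ite_eq' Finset.univ s, if_pos (Finset.mem_univ _)] at h
    linarith
  have hsplit : ∀ (j : Fin (m + 3)) t, (if j.succAbove t = s then slotValue i j t else 0) =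
      (if j.succAbove t = s then 1 else 0) + if j = i then
        (if i.succAbove t = s then 1 / 2 * envyDev 0 (Finset.univ.erase 0) t else 0) else 0 := by
    intro j t
    unfold slotValue
    by_cases hj : j = i
    · subst hj
      split_ifs <;> simp
    · simp [hj]
  simp only [hsplit, Finset.sum_add_distrib, hrow]
  congr 1
  · rw [Finset.sum_sub_distrib, Finset.sum_ite_eq' Finset.univ s]
    simp
    ring
  · rw [Finset.sum_comm]
    exact Finset.sum_congr rfl fun t _ => by simp

/-- In the first round all portions are worth the same to everybody, so each participant `s` other
than the divider may leave out portion `s`. Portion `j` is then shared by all but `j`, who see cells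
of equal value in it, so `recursiveRun_of_equal_cells` applies. Player `j` deviates from equality
only inside portion `j`: its slot `0` is undervalued and the others are overvalued, so only the
holder of slot `0` is not envied. -/
lemma exists_recursiveDivideAndChoose_example (m : ℕ) :
    ∃ V, ∃ A ∈ recursiveDivideAndChoose (m + 3) V, envyFreeCount V A ≤ m + 3 := by
  set K := (m + 1).factorial with hK
  have hK0 : 0 < K := Nat.factorial_pos _
  have hKr : (0 : ℝ) < K := by exact_mod_cast hK0
  have : Nonempty (Fin K) := ⟨⟨0, hK0⟩⟩
  obtain ⟨idx, hidx, hex⟩ := exists_cells ((Fin (m + 3) × Fin (m + 2)) × Fin K)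
  have hN : (0 : ℝ) < (m + 3) * (m + 2) := by positivity
  choose V hV using fun i : Fin (m + 3) => hex
    (fun p => slotValue i p.1.1 p.1.2 / ((m + 3) * (m + 2) * K))
    (fun p => div_pos (slotValue_pos _ _ _) (by positivity)) (by
      rw [Fintype.sum_prod_type]
      simp only [Finset.sum_const, Finset.card_univ, Fintype.card_fin]
      rw [← Finset.smul_sum, Fintype.sum_prod_type]
      simp only [← Finset.sum_div, sum_slotValue]
      simp
      field_simp)
  have hval : ∀ i (c : Fin (m + 3) × Fin (m + 2) → Prop) [DecidablePred c],
      V i (cells idx (Finset.univ.filter fun p => c p.1)) =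
        (∑ j, ∑ t, if c (j, t) then slotValue i j t else 0) / ((m + 3) * (m + 2)) := by
    intro i c _
    rw [hV, Finset.sum_filter, Fintype.sum_prod_type]
    simp only [Finset.sum_const, Finset.card_univ, Fintype.card_fin]
    rw [← Finset.smul_sum, Fintype.sum_prod_type, Finset.sum_div, Finset.smul_sum]
    refine Finset.sum_congr rfl fun j _ => ?_
    rw [Finset.sum_div, Finset.smul_sum]
    refine Finset.sum_congr rfl fun t _ => ?_
    split_ifs
    · rw [nsmul_eq_mul]
      field_simp
    · simp
  let Q : Fin (m + 3) → Set ℝ := fun j => cells idx (Finset.univ.filter fun p => p.1.1 = j)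
  have hQ : IsPartition cake Q := by
    have := isPartition_cells hidx Finset.univ fun p => p.1.1
    rwa [cells_univ] at this
  have hQval : ∀ i j, V i (Q j) = 1 / ((m + 3 : ℕ) : ℝ) := by
    intro i j
    have hinner : ∀ k, (∑ t, if k = j then slotValue i k t else 0) =
        if k = j then (m : ℝ) + 2 else 0 := by
      intro k
      split_ifs
      · exact sum_slotValue i k
      · simp
    simp only [Q]
    rw [hval i fun p => p.1 = j]
    simp only [hinner]
    rw [Finset.sum_ite_eq' Finset.univ j, if_pos (Finset.mem_univ _)]
    push_cast
    field_simp
  let A : Fin (m + 3) → Set ℝ :=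
    fun s => cells idx (Finset.univ.filter fun p => p.1.1.succAbove p.1.2 = s)
  have hA : A ∈ recursiveDivideAndChoose (m + 3) V := by
    refine ⟨0, Q, fun s => Finset.univ.erase s, Fin.succAbove, fun j t => cells idx
      ((Finset.univ.filter fun p => p.1.1 = j).filter fun p => p.1.2 = t), hQ,
      fun j => by rw [hQval, (V 0).normalized], fun s _ => ⟨by simp, fun j _ j' _ => by
        rw [hQval, hQval]⟩, ?_, ?_, ?_, ?_, ?_⟩
    · intro j s _ hj
      obtain ⟨t, ht⟩ := Fin.exists_succAbove_eq (Finset.ne_of_mem_erase hj).symm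
      exact ⟨t, ht, fun t' ht' => Fin.succAbove_right_injective (ht'.trans ht.symm)⟩
    · intro j s _ hj t
      have hj' : j = s := by simpa using hj
      rw [← hj']
      exact Fin.succAbove_ne j t
    · intro j _
      refine recursiveRun_of_equal_cells hidx (by omega) (x := 1 / ((m + 3) * (m + 2) * K))
        (fun t b hb => ?_) (fun p => p.1.2) (q := 1) fun t => ?_
      · rw [hV, ← nsmul_eq_mul, ← Finset.sum_const]
        refine Finset.sum_congr rfl fun p hp => ?_
        rw [(Finset.mem_filter.1 (hb hp)).2, slotValue, if_neg (Fin.succAbove_ne j t).symm,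
          add_zero]
      · rw [show ((Finset.univ.filter fun p : (Fin (m + 3) × Fin (m + 2)) × Fin K =>
          p.1.1 = j).filter fun p => p.1.2 = t) = {(j, t)} ×ˢ Finset.univ by
            ext p
            simp [Prod.ext_iff, eq_comm], Finset.card_product]
        simp [hK]
    -- With at least three participants every portion is marked by somebody other than the divider,
    -- so this case does not occur.
    · intro j hj
      obtain ⟨s, hs0, hsj⟩ : ∃ s : Fin (m + 3), s ≠ 0 ∧ s ≠ j := by
        by_cases h1 : j = 1
        · exact ⟨Fin.last _, Fin.last_pos.ne', fun h => by simp [h1, Fin.ext_iff] at h⟩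
        · exact ⟨1, by simp, fun h => h1 h.symm⟩
      exact absurd ⟨s, hs0, Finset.mem_erase.2 ⟨hsj.symm, Finset.mem_univ _⟩⟩ hj
    · intro s
      ext x
      simp only [A, mem_iUnion, mem_cells, Finset.mem_filter, Finset.mem_univ, true_and,
        exists_prop]
      constructor
      · exact fun ⟨hx, h⟩ => ⟨_, _, h, hx, rfl, rfl⟩
      · rintro ⟨j, t, h, hx, rfl, rfl⟩
        exact ⟨hx, h⟩
  have hAval : ∀ i s, V i (A s) = (m + 2 + ∑ t, if i.succAbove t = s then
      1 / 2 * envyDev 0 (Finset.univ.erase 0) t else 0) / ((m + 3) * (m + 2)) := by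
    intro i s
    rw [← sum_slotValue_owner]
    exact hval i fun p => p.1.succAbove p.2 = s
  refine ⟨V, A, hA, (envyFreeCount_le_sum (T := fun i => {i.succAbove 0})
    fun i s his hle => ?_).trans (by simp)⟩
  obtain ⟨t, rfl⟩ := Fin.exists_succAbove_eq his.symm
  rw [Finset.mem_singleton]
  by_contra hne
  have ht : t ≠ 0 := fun h => hne (by rw [h])
  rw [hAval, hAval, div_le_div_iff_of_pos_right hN] at hle
  simp only [Fin.succAbove_ne, if_false, Finset.sum_const_zero, Fin.succAbove_right_inj] at hle
  rw [Finset.sum_ite_eq' Finset.univ t, if_pos (Finset.mem_univ _), envyDev_erase_of_ne ht] at hle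
  have : (0 : ℝ) < 1 / ((m + 2 - 1 : ℕ) : ℝ) :=
    one_div_pos.2 (Nat.cast_pos.2 (Nat.succ_pos m))
  linarith

theorem hasDGEF_recursiveDivideAndChoose {n : ℕ} (hn : 3 ≤ n) :
    HasDGEF (recursiveDivideAndChoose n) n := by
  obtain ⟨m, rfl⟩ : ∃ m, n = m + 3 := ⟨n - 3, by omega⟩
  have h := isProportional_recursiveDivideAndChoose (by omega : 0 < m + 3)
  exact .intro h (fun _ _ hA => h.le_envyFreeCount (by omega) hA)
    (exists_recursiveDivideAndChoose_example m)

end CakeCutting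

/-! ### The degrees of all protocols together. -/

theorem mainTheorem2 (n : ℕ) (hn : 3 ≤ n) :
    CakeCutting.HasDGEF (CakeCutting.lastDiminisher n) (2 + n * (n - 1) / 2) ∧
    CakeCutting.HasDGEF (CakeCutting.loneChooser n) n ∧
    CakeCutting.HasDGEF (CakeCutting.loneDivider n) (2 * n - 2) ∧
    CakeCutting.HasDGEF (CakeCutting.cutYourOwnPiece n) n ∧
    (CakeCutting.IsStrategy (CakeCutting.leftRight n) ∧
      CakeCutting.HasDGEF (CakeCutting.cutYourOwnPieceWith (CakeCutting.leftRight n))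
        (2 * n - 2)) ∧
    (∀ T : CakeCutting.CutStrategy n, CakeCutting.IsStrategy T →
      ∃ d, d ≤ 2 * n - 2 ∧ CakeCutting.HasDGEF (CakeCutting.cutYourOwnPieceWith T) d) ∧
    CakeCutting.HasDGEF (CakeCutting.divideAndConquer n)
      (n * Nat.log 2 n + 2 * n - 2 ^ (Nat.log 2 n + 1)) ∧
    CakeCutting.HasDGEF (CakeCutting.minimalEnvyDivideAndConquer n)
      (n * Nat.log 2 n + 2 * n - 2 ^ (Nat.log 2 n + 1)) ∧
    CakeCutting.HasDGEF (CakeCutting.recursiveDivideAndChoose n) n := by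
  have h0 : 0 < n := by omega
  exact ⟨CakeCutting.hasDGEF_lastDiminisher hn, CakeCutting.hasDGEF_loneChooser hn,
    CakeCutting.hasDGEF_loneDivider hn, CakeCutting.hasDGEF_cutYourOwnPiece hn,
    ⟨CakeCutting.isStrategy_leftRight (by omega), CakeCutting.hasDGEF_leftRight hn⟩,
    fun _ hT => hT.exists_hasDGEF hn, CakeCutting.hasDGEF_divideAndConquer h0,
    CakeCutting.hasDGEF_minimalEnvyDivideAndConquer h0,
    CakeCutting.hasDGEF_recursiveDivideAndChoose hn⟩
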